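/- There is a universal constant $0<C<\infty$ such that the following holds for every dimension $d\ge 1$. Let $\mu$ be a probability measure on $\mathbb R^d$ with Lebesgue density $p$, and let $Q$ be a proposal kernel on $\mathbb R^d$ with isotropic density $q(x,y)=q(\|x-y\|)$, where $x\mapsto q(\|x\|)$ is a unimodal probability density on $\mathbb R^d$. Here a function $f$ on a convex set $\Theta\subseteq\mathbb R^d$ is called unimodal if for all $x\in\Theta$, $v\in\mathbb R^d$ the function $s\mapsto f(x+sv)$ on the interval $I=\{s: x+sv\in\Theta\}$ has a mode $s_0\in I$ such that it is (weakly) increasing on $I\cap(-\infty,s_0]$ and (weakly) decreasing on $I\cap[s_0,\infty)$. Write $B_r(x)$ for the closed Euclidean ball of radius $r$ around $x$. Let $\varepsilon,L,\delta_1,c_1,c_2>0$, let $\Theta\subseteq\mathbb R^d$ be convex and measurable, and let $m\in\Theta$ with $B_\varepsilon(m)\subseteq\Theta\subseteq B_L(m)$. Assume that $0<p<\infty$ on $\Theta$, that $p$ is unimodal on $\Theta$ with mode $m$, i.e. $p(m)=\max_\Theta p$, that $$\inf_{x\in B_{2\varepsilon}(m)}p(x)>\tfrac{15}{16}\,p(m),$$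 and that for all $x\in\mathbb R^d$ $$q(\|x\|)\ \ge\ \delta_1\,\frac{\Gamma(d/2+1)}{\pi^{d/2}\varepsilon^{d}}\,\mathbf 1_{\|x\|\le\varepsilon},\qquad q(\|x\|)\ \le\ c_1e^{-c_2\|x\|/\varepsilon},$$ so that $Q(x,\cdot)$ dominates $\delta_1$ times the uniform distribution on $B_\varepsilon(x)$. Let $\mu_\Theta(A)=\mu(A\cap\Theta)/\mu(\Theta)$, $p_\Theta=\mu(\Theta)^{-1}p\,\mathbf 1_\Theta$, and let $P_\Theta$ be the Metropolis--Hastings kernel with proposal kernel $Q$ and target $\mu_\Theta$, that is, with acceptance probability $\alpha_\Theta(x,y)=1\wedge\frac{p_\Theta(y)q(y,x)}{p_\Theta(x)q(x,y)}$. Let $$\tau_{B_\varepsilon(m)}(P_\Theta)=\min\Big\{t\in\mathbb N:\ \sup_{x\in B_\varepsilon(m)}\|\delta_xP_\Theta^t-\mu_\Theta\|_{\mathrm{TV}}\le\tfrac18\Big\},\qquad \|\nu_1-\nu_2\|_{\mathrm{TV}}=\sup_A|\nu_1(A)-\nu_2(A)|.$$ Then $$\tau_{B_\varepsilon(m)}(P_\Theta)\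 \le\ C\log(16)\,\varepsilon^{-3}\delta_1^{-1}L^{d+3}\,p_\Theta(m)\,\frac{\pi^{d/2}\,3^{d+2}}{\Gamma(d/2+1)}.$$ In particular, $\tau_{B_\varepsilon(m)}(P_\Theta)<\infty$. -/

import Mathlib

open MeasureTheory ProbabilityTheory Set
open scoped ENNReal

noncomputable section

/-- `f` is unimodal on `I ⊆ ℝ`: for some mode `m ∈ I` it increases on `I` up to `m` and decreases
on `I` from `m` on (both in the weak sense). -/
def IsUnimodalOn (f : ℝ → ℝ) (I : Set ℝ) : Prop :=
  ∃ m ∈ I, MonotoneOn f (I ∩ Iic m) ∧ AntitoneOn f (I ∩ Ici m)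

/-- `f` is multivariate unimodal on `Θ`: its restriction to every line through a point of `Θ` is
unimodal on the part of the line that lies in `Θ`. -/
def IsMultivariateUnimodalOn {d : ℕ} (f : EuclideanSpace ℝ (Fin d) → ℝ)
    (Θ : Set (EuclideanSpace ℝ (Fin d))) : Prop :=
  ∀ x ∈ Θ, ∀ v : EuclideanSpace ℝ (Fin d),
    IsUnimodalOn (fun s : ℝ => f (x + s • v)) {s : ℝ | x + s • v ∈ Θ}

/-- `p` is a probability density on `ℝ^d` with respect to Lebesgue measure. -/
structure IsProbDensity {d : ℕ} (p : EuclideanSpace ℝ (Fin d) → ℝ) : Prop where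
  measurable : Measurable p
  nonneg : ∀ x, 0 ≤ p x
  lintegral_eq_one : ∫⁻ x, ENNReal.ofReal (p x) = 1

/-- The measure on `ℝ^d` with Lebesgue density `p`. -/
def densityMeasure {d : ℕ} (p : EuclideanSpace ℝ (Fin d) → ℝ) :
    Measure (EuclideanSpace ℝ (Fin d)) :=
  volume.withDensity (fun x => ENNReal.ofReal (p x))

/-- The density `p_Θ = 1_Θ p / μ(Θ)` of `μ` conditioned on `Θ`, where `μ` has density `p`. -/
def restrictDensity {d : ℕ} (p : EuclideanSpace ℝ (Fin d) → ℝ)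
    (Θ : Set (EuclideanSpace ℝ (Fin d))) (x : EuclideanSpace ℝ (Fin d)) : ℝ :=
  ((densityMeasure p).real Θ)⁻¹ * Θ.indicator p x

/-- Metropolis-Hastings acceptance probability for target density `p`, proposal density `q`. -/
def mhAccept {d : ℕ} (p : EuclideanSpace ℝ (Fin d) → ℝ)
    (q : EuclideanSpace ℝ (Fin d) → EuclideanSpace ℝ (Fin d) → ℝ)
    (x y : EuclideanSpace ℝ (Fin d)) : ℝ :=
  min 1 ((p y * q y x) / (p x * q x y))

theorem measurable_mhAccept {d : ℕ} {p : EuclideanSpace ℝ (Fin d) → ℝ}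
    {q : EuclideanSpace ℝ (Fin d) → EuclideanSpace ℝ (Fin d) → ℝ}
    (hp : Measurable p) (hq : Measurable (Function.uncurry q)) :
    Measurable (Function.uncurry (mhAccept p q)) := by
  have h1 : Measurable fun z : EuclideanSpace ℝ (Fin d) × EuclideanSpace ℝ (Fin d) =>
      q z.2 z.1 := hq.comp measurable_swap
  have h2 : Measurable fun z : EuclideanSpace ℝ (Fin d) × EuclideanSpace ℝ (Fin d) =>
      q z.1 z.2 := hq
  exact measurable_const.min
    (((hp.comp measurable_snd).mul h1).div ((hp.comp measurable_fst).mul h2))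

/-- One Metropolis-Hastings step from `x`: the accepted moves have density `α(x,y) q(x,y)`, and the
total rejection probability `∫ (1 - α(x,y)) q(x,y) dy` is put on `x` itself. -/
def mhStep {d : ℕ} (p : EuclideanSpace ℝ (Fin d) → ℝ)
    (q : EuclideanSpace ℝ (Fin d) → EuclideanSpace ℝ (Fin d) → ℝ)
    (x : EuclideanSpace ℝ (Fin d)) : Measure (EuclideanSpace ℝ (Fin d)) :=
  volume.withDensity (fun y => ENNReal.ofReal (mhAccept p q x y * q x y)) +
    (∫⁻ y, ENNReal.ofReal ((1 - mhAccept p q x y) * q x y)) • Measure.dirac x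

theorem measurable_mhStep {d : ℕ} {p : EuclideanSpace ℝ (Fin d) → ℝ}
    {q : EuclideanSpace ℝ (Fin d) → EuclideanSpace ℝ (Fin d) → ℝ}
    (hp : Measurable p) (hq : Measurable (Function.uncurry q)) :
    Measurable (mhStep p q) := by
  have hα := measurable_mhAccept hp hq
  have h1 : Measurable (Function.uncurry fun x y => ENNReal.ofReal (mhAccept p q x y * q x y)) :=
    (hα.mul hq).ennreal_ofReal
  have h2 : Measurable
      (Function.uncurry fun x y => ENNReal.ofReal ((1 - mhAccept p q x y) * q x y)) :=
    ((measurable_const.sub hα).mul hq).ennreal_ofReal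
  refine Measure.measurable_of_measurable_coe _ fun s hs => ?_
  simp only [mhStep, Measure.add_apply, Measure.smul_apply, smul_eq_mul,
    withDensity_apply _ hs, Measure.dirac_apply' _ hs]
  exact (Measurable.lintegral_prod_right h1).add
    ((Measurable.lintegral_prod_right h2).mul (measurable_one.indicator hs))

/-- The Metropolis-Hastings kernel with target density `p` and proposal density `q`. -/
def mhKernel {d : ℕ} (p : EuclideanSpace ℝ (Fin d) → ℝ)
    (q : EuclideanSpace ℝ (Fin d) → EuclideanSpace ℝ (Fin d) → ℝ)
    (hp : Measurable p) (hq : Measurable (Function.uncurry q)) :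
    Kernel (EuclideanSpace ℝ (Fin d)) (EuclideanSpace ℝ (Fin d)) :=
  ⟨mhStep p q, measurable_mhStep hp hq⟩

theorem measurable_restrictDensity {d : ℕ} {p : EuclideanSpace ℝ (Fin d) → ℝ}
    {Θ : Set (EuclideanSpace ℝ (Fin d))} (hp : Measurable p) (hΘ : MeasurableSet Θ) :
    Measurable (restrictDensity p Θ) :=
  (hp.indicator hΘ).const_mul _

theorem measurable_isotropic {d : ℕ} {q : ℝ → ℝ} (hq : Measurable q) :
    Measurable (Function.uncurry fun x y : EuclideanSpace ℝ (Fin d) => q ‖x - y‖) :=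
  hq.comp (measurable_fst.sub measurable_snd).norm

/-- The restricted chain `P_Θ`: the Metropolis-Hastings kernel whose target is `μ_Θ` and whose
proposal density is `q(x,y) = q(‖x - y‖)`. -/
def restrictedChain {d : ℕ} (p : EuclideanSpace ℝ (Fin d) → ℝ) (q : ℝ → ℝ)
    (Θ : Set (EuclideanSpace ℝ (Fin d))) (hp : Measurable p) (hq : Measurable q)
    (hΘ : MeasurableSet Θ) : Kernel (EuclideanSpace ℝ (Fin d)) (EuclideanSpace ℝ (Fin d)) :=
  mhKernel (restrictDensity p Θ) (fun x y => q ‖x - y‖)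
    (measurable_restrictDensity hp hΘ) (measurable_isotropic hq)

/-- Total variation distance `sup_A |ν₁(A) - ν₂(A)|`, over measurable sets `A`. -/
def tvDist {E : Type*} [MeasurableSpace E] (ν₁ ν₂ : Measure E) : ℝ≥0∞ :=
  ⨆ (A : Set E) (_ : MeasurableSet A), ENNReal.ofReal |ν₁.real A - ν₂.real A|

/-- The mixing time of `P` towards `π` from initial points in `A`: the least `t` such that
`sup_{x ∈ A} ‖δ_x P^t - π‖_TV ≤ 1/8`, and `⊤` if there is none. Here `(P ^ t) x` is `δ_x P^t`, the law
after `t` steps of the chain started at `x`. -/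
def mixingTimeFrom {E : Type*} [MeasurableSpace E] (P : Kernel E E) (π : Measure E)
    (A : Set E) : ℕ∞ :=
  ⨅ (t : ℕ) (_ : ⨆ x ∈ A, tvDist ((P ^ t) x) π ≤ 1 / 8), (t : ℕ∞)

end

/-!
The chain acts on bounded measurable functions by the operator `mhOp`, which is symmetric on
`L²` of the target `w`. Its Dirichlet form is `½ ∫ q(h) Φ(h) dh`, where
`Φ(h) = ∫ (f(x+h) - f(x))² min(w(x), w(x+h)) dx` (`incr`). Everything rests on bounds for `Φ`.

*Spectral gap.* Since `w` is quasi-concave, a move `h` may be split along the straight line into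
`N` equal moves that stay where `w` is at least `min(w(x), w(x+h))`, so `Φ(N h) ≤ N² Φ(h)`
(`incr_natCast_smul_le`). The variance is at most a multiple of the integral of `Φ` over the ball of
radius `2 L`, and this is at most `(32/11 · L/ε)^(d+2)` times the integral over the `ε`-ball, where `q`
is large (`FlatMode.poincare`). At the other end of the spectrum, three moves `h`, `-h/2`, `-h/2` form a
triangle, an odd cycle, which keeps the spectrum away from `-1` (`wInner_add_mhLin_ge`). Together,
mean-zero functions contract at a rate whose inverse is `gapInv` (`FlatMode.sq_norm_iterate_le`).

*Starting points.* The contraction is in `L²`, while the chain starts at a point and `q` may be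
arbitrarily high. By `FlatMode.local_smoothing`, after `O((5/2)^d / δ)` steps from a point within `ε`
of the mode, the law is, up to an error of `1/16`, at most `10 ^ (8 d²)`, in units of
`(vol B_ε · w(m))⁻¹`, in the norm of `L²`, whatever the height of `q`. To see this, let `κ` be the
height of `q` at the radius `ε / 1000 ^ d`, and split `q` into `min(q, κ)` and the excess over `κ`,
which makes moves of length at most `ε / 1000 ^ d` only. Moves of the first kind have density at most
`κ`, and at rate at least a multiple of `δ` they occur and are accepted. Moves of the second kind
drift away from the mode hardly more than a symmetric walk does (`drift_ge`), because `w` is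
quasi-concave with mode `m`; the barrier `((|y - m|² - ε²)₊)²` turns this into a bound on the
probability to leave the flat part of `w` (`FlatMode.iterate_le_of_barrier`). If the second moment of
the excess is so small that the chain is still near the mode when a move of the first kind has
occurred, then that move smooths the law (`FlatMode.smoothing_of_frequent`). Otherwise the small moves
alone spread out the law to a multiple of `ε / d`, up to a factor exponential in `d`, and a Nash
inequality bounds its square norm (`FlatMode.nash`, `FlatMode.smoothing_small_moves`).

*Combination.* Smoothing followed by contraction gives `FlatMode.mixing`. The logarithm of the
smoothing constant is of order `d²`, and this is absorbed by `3 ^ d` because `32 / 11 < 3`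
(`gapInv_mul_log_le`). Powers of the Metropolis-Hastings kernel are identified with iterates of
`mhOp` in `real_pow_mhKernel`.
-/

/-! ### Weights, proposals and the Metropolis-Hastings operator -/

/-- The ambient Euclidean space. -/
abbrev Eu (d : ℕ) : Type := EuclideanSpace ℝ (Fin d)

/-- A target weight: an integrable nonnegative function that is quasi-concave on segments. It is
the density of the stationary measure and need not be normalized. -/
structure IsWeight {d : ℕ} (w : Eu d → ℝ) : Prop where
  measurable : Measurable w
  nonneg : ∀ x, 0 ≤ w x
  integrable : Integrable w
  quasiconcave : ∀ x y : Eu d, ∀ t : ℝ, 0 ≤ t → t ≤ 1 → min (w x) (w y) ≤ w (x + t • (y - x))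

/-- A density of proposed increments: radially decreasing, of total mass at most one. The missing
mass is a probability of holding. -/
structure IsProposal {d : ℕ} (q : Eu d → ℝ) : Prop where
  measurable : Measurable q
  nonneg : ∀ x, 0 ≤ q x
  integrable : Integrable q
  antitone : ∀ x y : Eu d, ‖x‖ ≤ ‖y‖ → q y ≤ q x
  integral_le_one : ∫ x, q x ≤ 1

/-- The overlap `min (w x) (w (x + h))`: times `q h`, it is the stationary flow along the
increment `h`. -/
def overlap {d : ℕ} (w : Eu d → ℝ) (x h : Eu d) : ℝ := min (w x) (w (x + h))

/-- The acceptance probability of the increment `h` at `x`. It vanishes where `w x = 0`. -/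
noncomputable def accept {d : ℕ} (w : Eu d → ℝ) (x h : Eu d) : ℝ := min 1 (w (x + h) / w x)

/-- The Metropolis-Hastings operator with target weight `w` and proposed increments `q`, acting on
functions. -/
noncomputable def mhOp {d : ℕ} (w q g : Eu d → ℝ) (x : Eu d) : ℝ :=
  g x + ∫ h, q h * accept w x h * (g (x + h) - g x)

/-- Bounded measurable functions. -/
structure IsBdd {d : ℕ} (f : Eu d → ℝ) : Prop where
  measurable : Measurable f
  bounded : ∃ M, ∀ x, |f x| ≤ M

namespace IsBdd

variable {d : ℕ} {f g : Eu d → ℝ}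

theorem exists_bound (hf : IsBdd f) : ∃ M, 0 ≤ M ∧ ∀ x, |f x| ≤ M := by
  obtain ⟨M, hM⟩ := hf.2
  exact ⟨M, (abs_nonneg _).trans (hM 0), hM⟩

theorem add (hf : IsBdd f) (hg : IsBdd g) : IsBdd (f + g) := by
  obtain ⟨M, hM⟩ := hf.2
  obtain ⟨N, hN⟩ := hg.2
  exact ⟨hf.1.add hg.1, M + N, fun x => (abs_add_le _ _).trans (add_le_add (hM x) (hN x))⟩

theorem mul (hf : IsBdd f) (hg : IsBdd g) : IsBdd fun x => f x * g x := by
  obtain ⟨M, hM0, hM⟩ := exists_bound hf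
  obtain ⟨N, hN0, hN⟩ := exists_bound hg
  refine ⟨hf.1.mul hg.1, M * N, fun x => ?_⟩
  rw [abs_mul]
  exact mul_le_mul (hM x) (hN x) (abs_nonneg _) hM0

theorem const (c : ℝ) : IsBdd (d := d) fun _ => c := ⟨measurable_const, |c|, fun _ => le_rfl⟩

theorem smul (c : ℝ) (hf : IsBdd f) : IsBdd (c • f) := (const c).mul hf

theorem sub (hf : IsBdd f) (hg : IsBdd g) : IsBdd fun x => f x - g x := by
  have := hf.add (hg.smul (-1))
  refine ⟨hf.1.sub hg.1, ?_⟩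
  obtain ⟨M, hM⟩ := this.2
  exact ⟨M, fun x => by simpa [sub_eq_add_neg] using hM x⟩

theorem abs (hf : IsBdd f) : IsBdd fun x => |f x| := by
  obtain ⟨M, hM⟩ := hf.2
  exact ⟨continuous_abs.measurable.comp hf.1, M, fun x => by simpa using hM x⟩

theorem shift (hf : IsBdd f) (h : Eu d) : IsBdd fun x => f (x + h) := by
  obtain ⟨M, hM⟩ := hf.2
  exact ⟨hf.1.comp (measurable_id.add_const h), M, fun x => hM _⟩

theorem shift_left (hf : IsBdd f) (x : Eu d) : IsBdd fun h => f (x + h) := by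
  simpa only [add_comm] using hf.shift x

theorem of_nonneg_le (hf : Measurable f) (h0 : ∀ x, 0 ≤ f x) {M : ℝ} (hM : ∀ x, f x ≤ M) :
    IsBdd f := ⟨hf, M, fun x => by rw [abs_of_nonneg (h0 x)]; exact hM x⟩

theorem integrable_mul (hf : IsBdd f) {w : Eu d → ℝ} (hw : Integrable w) :
    Integrable fun x => f x * w x := by
  obtain ⟨M, hM⟩ := hf.2
  exact hw.bdd_mul (c := M) hf.1.aestronglyMeasurable (Filter.Eventually.of_forall hM)

end IsBdd

/-- The space of bounded measurable functions. -/
def bddMeas (d : ℕ) : Submodule ℝ (Eu d → ℝ) where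
  carrier := {f | IsBdd f}
  add_mem' hf hg := hf.add hg
  zero_mem' := IsBdd.const 0
  smul_mem' c _ hf := hf.smul c

theorem isBdd_coe {d : ℕ} (f : bddMeas d) : IsBdd f.1 := f.2

section basic

variable {d : ℕ} {w q : Eu d → ℝ}

theorem IsProposal.even (hq : IsProposal q) (h : Eu d) : q (-h) = q h :=
  le_antisymm (hq.antitone _ _ (by simp)) (hq.antitone _ _ (by simp))

theorem accept_nonneg (hw : IsWeight w) (x h : Eu d) : 0 ≤ accept w x h :=
  le_min zero_le_one (div_nonneg (hw.nonneg _) (hw.nonneg _))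

theorem accept_le_one (x h : Eu d) : accept w x h ≤ 1 := min_le_left _ _

theorem overlap_nonneg (hw : IsWeight w) (x h : Eu d) : 0 ≤ overlap w x h :=
  le_min (hw.nonneg _) (hw.nonneg _)

theorem overlap_le (x h : Eu d) : overlap w x h ≤ w x := min_le_left _ _

theorem mul_accept (hw : IsWeight w) (x h : Eu d) : w x * accept w x h = overlap w x h := by
  unfold accept overlap
  rcases (hw.nonneg x).eq_or_lt with h0 | h0
  · rw [← h0]; simp [hw.nonneg]
  · rw [mul_min_of_nonneg _ _ h0.le, mul_one, mul_div_cancel₀ _ h0.ne']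

theorem overlap_swap (x h : Eu d) : overlap w (x + h) (-h) = overlap w x h := by
  unfold overlap; rw [add_neg_cancel_right, min_comm]

theorem IsWeight.measurable_overlap (hw : IsWeight w) :
    Measurable fun z : Eu d × Eu d => overlap w z.1 z.2 :=
  (hw.measurable.comp measurable_fst).min (hw.measurable.comp (measurable_fst.add measurable_snd))

theorem IsWeight.measurable_accept (hw : IsWeight w) :
    Measurable fun z : Eu d × Eu d => accept w z.1 z.2 :=
  measurable_const.min ((hw.measurable.comp (measurable_fst.add measurable_snd)).div
    (hw.measurable.comp measurable_fst))

theorem measurable_accept_right (hw : IsWeight w) (x : Eu d) :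
    Measurable fun h : Eu d => accept w x h :=
  hw.measurable_accept.comp measurable_prodMk_left

theorem integrable_flow (hw : IsWeight w) (hq : IsProposal q) {F : Eu d × Eu d → ℝ}
    (hF : Measurable F) {M : ℝ} (hM : ∀ z, |F z| ≤ M) :
    Integrable (fun z : Eu d × Eu d => q z.2 * overlap w z.1 z.2 * F z)
      (volume.prod volume) := by
  have h1 : Integrable (fun z : Eu d × Eu d => w z.1 * q z.2) (volume.prod volume) :=
    hw.integrable.mul_prod hq.integrable
  have h2 : Integrable (fun z : Eu d × Eu d => q z.2 * overlap w z.1 z.2) (volume.prod volume) := by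
    refine h1.mono' ((hq.measurable.comp measurable_snd).mul
      hw.measurable_overlap).aestronglyMeasurable (Filter.Eventually.of_forall fun z => ?_)
    rw [Real.norm_of_nonneg (mul_nonneg (hq.nonneg _) (overlap_nonneg hw _ _)), mul_comm]
    exact mul_le_mul_of_nonneg_right (overlap_le _ _) (hq.nonneg _)
  have := h2.bdd_mul (c := M) hF.aestronglyMeasurable (Filter.Eventually.of_forall hM)
  exact this.congr (Filter.Eventually.of_forall fun z => mul_comm _ _)

theorem integrable_proposal_mul (hq : IsProposal q) {F : Eu d → ℝ} (hF : IsBdd F) :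
    Integrable fun h => q h * F h :=
  (hF.integrable_mul hq.integrable).congr (Filter.Eventually.of_forall fun _ => mul_comm _ _)

theorem accept_mem (hw : IsWeight w) (x : Eu d) : IsBdd fun h => accept w x h :=
  IsBdd.of_nonneg_le (measurable_accept_right hw x) (accept_nonneg hw x) (accept_le_one x)

theorem integrable_rate (hw : IsWeight w) (hq : IsProposal q) (x : Eu d) :
    Integrable fun h => q h * accept w x h := integrable_proposal_mul hq (accept_mem hw x)

theorem integrable_rate_mul (hw : IsWeight w) (hq : IsProposal q) (x : Eu d) {F : Eu d → ℝ}
    (hF : IsBdd F) : Integrable fun h => q h * accept w x h * F h :=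
  (integrable_proposal_mul hq ((accept_mem hw x).mul hF)).congr
    (Filter.Eventually.of_forall fun _ => (mul_assoc _ _ _).symm)

theorem integral_rate_le_one (hw : IsWeight w) (hq : IsProposal q) (x : Eu d) :
    ∫ h, q h * accept w x h ≤ 1 := by
  refine le_trans (integral_mono (integrable_rate hw hq x) hq.integrable fun h => ?_)
    hq.integral_le_one
  exact mul_le_of_le_one_right (hq.nonneg h) (accept_le_one x h)

theorem integral_rate_nonneg (hw : IsWeight w) (hq : IsProposal q) (x : Eu d) :
    0 ≤ ∫ h, q h * accept w x h :=
  integral_nonneg fun h => mul_nonneg (hq.nonneg h) (accept_nonneg hw x h)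

theorem integrable_mhOp (hw : IsWeight w) (hq : IsProposal q) {g : Eu d → ℝ}
    (hg : IsBdd g) (x : Eu d) :
    Integrable fun h => q h * accept w x h * (g (x + h) - g x) :=
  integrable_rate_mul hw hq x ((hg.shift_left x).sub (IsBdd.const (g x)))

/-- The operator as accepted moves plus holding. -/
theorem mhOp_eq (hw : IsWeight w) (hq : IsProposal q) {g : Eu d → ℝ} (hg : IsBdd g)
    (x : Eu d) : mhOp w q g x =
      (∫ h, q h * accept w x h * g (x + h)) + (1 - ∫ h, q h * accept w x h) * g x := by
  unfold mhOp
  have h1 := integrable_rate_mul hw hq x (hg.shift_left x)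
  have h2 := (integrable_rate hw hq x).mul_const (g x)
  simp_rw [mul_sub]
  rw [integral_sub h1 h2, integral_mul_const]
  ring

theorem mhOp_mono (hw : IsWeight w) (hq : IsProposal q) {f g : Eu d → ℝ} (hf : IsBdd f)
    (hg : IsBdd g) (x : Eu d) (h : ∀ y, f y ≤ g y) : mhOp w q f x ≤ mhOp w q g x := by
  rw [mhOp_eq hw hq hf, mhOp_eq hw hq hg]
  refine add_le_add (integral_mono (integrable_rate_mul hw hq x (hf.shift_left x))
    (integrable_rate_mul hw hq x (hg.shift_left x)) fun y => ?_) ?_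
  · exact mul_le_mul_of_nonneg_left (h _) (mul_nonneg (hq.nonneg _) (accept_nonneg hw x _))
  · exact mul_le_mul_of_nonneg_left (h x) (sub_nonneg.2 (integral_rate_le_one hw hq x))

theorem mhOp_const (c : ℝ) : mhOp w q (fun _ => c) = fun _ => c := by
  funext x; simp [mhOp]

theorem mhOp_add (hw : IsWeight w) (hq : IsProposal q) {f g : Eu d → ℝ} (hf : IsBdd f)
    (hg : IsBdd g) : mhOp w q (f + g) = mhOp w q f + mhOp w q g := by
  funext x
  simp only [mhOp, Pi.add_apply]
  rw [add_add_add_comm, ← integral_add (integrable_mhOp hw hq hf x) (integrable_mhOp hw hq hg x)]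
  congr 2; funext h; ring

theorem mhOp_smul (c : ℝ) (f : Eu d → ℝ) : mhOp w q (c • f) = c • mhOp w q f := by
  funext x
  simp only [mhOp, Pi.smul_apply, smul_eq_mul]
  rw [mul_add, ← integral_const_mul]
  congr 2; funext h; ring

theorem mhOp_mem (hw : IsWeight w) (hq : IsProposal q) {g : Eu d → ℝ} (hg : IsBdd g) :
    IsBdd (mhOp w q g) := by
  obtain ⟨M, hM0, hM⟩ := hg.exists_bound
  refine ⟨?_, M, fun x => ?_⟩
  · have h1 : Measurable fun z : Eu d × Eu d =>
        q z.2 * accept w z.1 z.2 * (g (z.1 + z.2) - g z.1) :=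
      ((hq.measurable.comp measurable_snd).mul hw.measurable_accept).mul
        ((hg.1.comp (measurable_fst.add measurable_snd)).sub (hg.1.comp measurable_fst))
    exact hg.1.add (StronglyMeasurable.integral_prod_right
      (f := fun x h => q h * accept w x h * (g (x + h) - g x)) h1.stronglyMeasurable).measurable
  · rw [abs_le]
    constructor
    · have := mhOp_mono hw hq (IsBdd.const (-M)) hg x fun y => (abs_le.1 (hM y)).1
      rwa [mhOp_const] at this
    · have := mhOp_mono hw hq hg (IsBdd.const M) x fun y => (abs_le.1 (hM y)).2
      rwa [mhOp_const] at this

/-- The Metropolis-Hastings operator as a linear map on the bounded measurable functions. -/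
noncomputable def mhLin (hw : IsWeight w) (hq : IsProposal q) : bddMeas d →ₗ[ℝ] bddMeas d where
  toFun f := ⟨mhOp w q f, mhOp_mem hw hq f.2⟩
  map_add' f g := Subtype.ext (mhOp_add hw hq (isBdd_coe f) (isBdd_coe g))
  map_smul' c f := Subtype.ext (mhOp_smul c f.1)

/-- The inner product of `L²(w dx)` on the bounded measurable functions. -/
noncomputable def wInner (hw : IsWeight w) : bddMeas d →ₗ[ℝ] bddMeas d →ₗ[ℝ] ℝ :=
  LinearMap.mk₂ ℝ (fun f g => ∫ x, f.1 x * g.1 x * w x)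
    (fun f f' g => by
      rw [← integral_add (((isBdd_coe f).mul (isBdd_coe g)).integrable_mul hw.integrable)
        (((isBdd_coe f').mul (isBdd_coe g)).integrable_mul hw.integrable)]
      congr 1; funext x; simp only [Submodule.coe_add, Pi.add_apply]; ring)
    (fun c f g => by
      rw [smul_eq_mul, ← integral_const_mul]
      congr 1; funext x; simp only [Submodule.coe_smul, Pi.smul_apply, smul_eq_mul]; ring)
    (fun f g g' => by
      rw [← integral_add (((isBdd_coe f).mul (isBdd_coe g)).integrable_mul hw.integrable)
        (((isBdd_coe f).mul (isBdd_coe g')).integrable_mul hw.integrable)]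
      congr 1; funext x; simp only [Submodule.coe_add, Pi.add_apply]; ring)
    (fun c f g => by
      rw [smul_eq_mul, ← integral_const_mul]
      congr 1; funext x; simp only [Submodule.coe_smul, Pi.smul_apply, smul_eq_mul]; ring)

theorem wInner_apply (hw : IsWeight w) (f g : bddMeas d) :
    wInner hw f g = ∫ x, f.1 x * g.1 x * w x := rfl

theorem mhLin_apply (hw : IsWeight w) (hq : IsProposal q) (f : bddMeas d) (x : Eu d) :
    (mhLin hw hq f).1 x = mhOp w q f x := rfl

end basic

/-! ### The Dirichlet form -/

section dirichlet

variable {d : ℕ} {w q : Eu d → ℝ}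

/-- The weighted square increment `∫ (f (x + h) - f x)² min (w x) (w (x + h)) dx` of `f` along
`h`. -/
noncomputable def incr (w f : Eu d → ℝ) (h : Eu d) : ℝ :=
  ∫ x, overlap w x h * (f (x + h) - f x) ^ 2

/-- The companion of `incr` with a plus sign. -/
noncomputable def coincr (w f : Eu d → ℝ) (h : Eu d) : ℝ :=
  ∫ x, overlap w x h * (f (x + h) + f x) ^ 2

theorem measurable_add_fst_snd {f : Eu d → ℝ} (hf : Measurable f) :
    Measurable fun z : Eu d × Eu d => f (z.1 + z.2) := hf.comp (measurable_fst.add measurable_snd)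

/-- The flow `q h * overlap w x h` is invariant under reversing the increment. -/
theorem integral_flow_swap (hq : IsProposal q) (F : Eu d → Eu d → ℝ) :
    ∫ h, ∫ x, q h * overlap w x h * F x (x + h) =
      ∫ h, ∫ x, q h * overlap w x h * F (x + h) x := by
  rw [← integral_neg_eq_self (fun h => ∫ x, q h * overlap w x h * F x (x + h))]
  congr 1; funext h
  rw [← integral_add_right_eq_self _ h]
  congr 1; funext x
  rw [overlap_swap, add_neg_cancel_right, hq.even]

/-- Integration by parts for the Metropolis-Hastings operator. -/
theorem wInner_mhLin (hw : IsWeight w) (hq : IsProposal q) (f g : bddMeas d) :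
    wInner hw f (mhLin hw hq g) = wInner hw f g -
      (∫ h, ∫ x, q h * overlap w x h * ((f.1 (x + h) - f.1 x) * (g.1 (x + h) - g.1 x))) / 2 := by
  obtain ⟨M, hM0, hM⟩ := (isBdd_coe f).exists_bound
  obtain ⟨N, hN0, hN⟩ := (isBdd_coe g).exists_bound
  have hf1 := (isBdd_coe f).1; have hg1 := (isBdd_coe g).1
  have bound : ∀ (a b c : ℝ), |a| ≤ M → |b| ≤ N → |c| ≤ N → |a * (b - c)| ≤ M * (N + N) := by
    intro a b c ha hb hc
    rw [abs_mul]
    exact mul_le_mul ha ((abs_sub _ _).trans (add_le_add hb hc)) (abs_nonneg _) hM0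
  have i1 := integrable_flow hw hq (F := fun z => f.1 z.1 * (g.1 (z.1 + z.2) - g.1 z.1))
    ((hf1.comp measurable_fst).mul ((measurable_add_fst_snd hg1).sub (hg1.comp measurable_fst)))
    (fun z => bound _ _ _ (hM _) (hN _) (hN _))
  have i2 := integrable_flow hw hq (F := fun z => f.1 (z.1 + z.2) * (g.1 z.1 - g.1 (z.1 + z.2)))
    ((measurable_add_fst_snd hf1).mul ((hg1.comp measurable_fst).sub (measurable_add_fst_snd hg1)))
    (fun z => bound _ _ _ (hM _) (hN _) (hN _))
  have e1 : wInner hw f (mhLin hw hq g) = wInner hw f g +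
      ∫ h, ∫ x, q h * overlap w x h * (f.1 x * (g.1 (x + h) - g.1 x)) := by
    rw [← integral_integral_swap (f := fun x h =>
      q h * overlap w x h * (f.1 x * (g.1 (x + h) - g.1 x))) i1, wInner_apply, wInner_apply,
      ← integral_add (((isBdd_coe f).mul (isBdd_coe g)).integrable_mul hw.integrable) i1.integral_prod_left]
    congr 1; funext x
    simp only [mhLin_apply, mhOp]
    rw [mul_add, add_mul, ← integral_const_mul, ← integral_mul_const]
    congr 2; funext h
    rw [← mul_accept hw]; ring
  have e2 := integral_flow_swap (w := w) hq (fun a b => f.1 a * (g.1 b - g.1 a))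
  have e3 : ∫ h, ∫ x, q h * overlap w x h * ((f.1 (x + h) - f.1 x) * (g.1 (x + h) - g.1 x)) =
      - (∫ h, ∫ x, q h * overlap w x h * (f.1 x * (g.1 (x + h) - g.1 x))) -
      ∫ h, ∫ x, q h * overlap w x h * (f.1 (x + h) * (g.1 x - g.1 (x + h))) := by
    have j1 : Integrable fun h => ∫ x, q h * overlap w x h * (f.1 x * (g.1 (x + h) - g.1 x)) :=
      i1.integral_prod_right
    have j2 : Integrable fun h => ∫ x, q h * overlap w x h *
        (f.1 (x + h) * (g.1 x - g.1 (x + h))) := i2.integral_prod_right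
    rw [← integral_neg, ← integral_sub j1.fun_neg j2]
    refine integral_congr_ae ?_
    filter_upwards [i1.prod_left_ae, i2.prod_left_ae] with h h1 h2
    rw [← integral_neg, ← integral_sub h1.fun_neg h2]
    congr 1; funext x; ring
  rw [e1, e3, ← e2]
  ring

end dirichlet

section increments

variable {d : ℕ} {w q f : Eu d → ℝ}

theorem isBdd_overlap_mul_sq (hw : IsWeight w) {F : Eu d × Eu d → ℝ} (hF : Measurable F)
    {M : ℝ} (hM : ∀ z, |F z| ≤ M) :
    IsBdd fun h => ∫ x, overlap w x h * F (x, h) ^ 2 := by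
  have hm : Measurable fun z : Eu d × Eu d => overlap w z.1 z.2 * F z ^ 2 :=
    hw.measurable_overlap.mul (hF.pow_const 2)
  refine IsBdd.of_nonneg_le (M := M ^ 2 * ∫ x, w x) ?_ ?_ ?_
  · exact (StronglyMeasurable.integral_prod_left
      (f := fun x h => overlap w x h * F (x, h) ^ 2) hm.stronglyMeasurable).measurable
  · exact fun h => integral_nonneg fun x => mul_nonneg (overlap_nonneg hw _ _) (sq_nonneg _)
  · intro h
    rw [← integral_const_mul]
    refine integral_mono_of_nonneg (Filter.Eventually.of_forall fun x =>
      mul_nonneg (overlap_nonneg hw _ _) (sq_nonneg _)) (hw.integrable.const_mul _)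
      (Filter.Eventually.of_forall fun x => ?_)
    have : F (x, h) ^ 2 ≤ M ^ 2 := by
      rw [← sq_abs]; exact pow_le_pow_left₀ (abs_nonneg _) (hM _) 2
    change overlap w x h * F (x, h) ^ 2 ≤ M ^ 2 * w x
    rw [mul_comm (M ^ 2)]
    exact mul_le_mul (overlap_le x h) this (sq_nonneg _) (hw.nonneg x)

theorem integrable_overlap_mul (hw : IsWeight w) (h : Eu d) {F : Eu d → ℝ} (hF : IsBdd F) :
    Integrable fun x => overlap w x h * F x := by
  have : Integrable fun x => overlap w x h := by
    refine hw.integrable.mono' (hw.measurable_overlap.comp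
      measurable_prodMk_right).aestronglyMeasurable (Filter.Eventually.of_forall fun x => ?_)
    rw [Real.norm_of_nonneg (overlap_nonneg hw _ _)]
    exact overlap_le _ _
  exact (hF.integrable_mul this).congr (Filter.Eventually.of_forall fun _ => mul_comm _ _)

theorem isBdd_incr (hw : IsWeight w) (hf : IsBdd f) : IsBdd (incr w f) := by
  obtain ⟨M, hM0, hM⟩ := hf.exists_bound
  exact isBdd_overlap_mul_sq hw (F := fun z => f (z.1 + z.2) - f z.1) (M := M + M)
    ((measurable_add_fst_snd hf.1).sub (hf.1.comp measurable_fst))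
    fun z => (abs_sub _ _).trans (add_le_add (hM _) (hM _))

theorem isBdd_coincr (hw : IsWeight w) (hf : IsBdd f) : IsBdd (coincr w f) := by
  obtain ⟨M, hM0, hM⟩ := hf.exists_bound
  exact isBdd_overlap_mul_sq hw (F := fun z => f (z.1 + z.2) + f z.1) (M := M + M)
    ((measurable_add_fst_snd hf.1).add (hf.1.comp measurable_fst))
    fun z => (abs_add_le _ _).trans (add_le_add (hM _) (hM _))

theorem incr_nonneg (hw : IsWeight w) (f : Eu d → ℝ) (h : Eu d) : 0 ≤ incr w f h :=
  integral_nonneg fun _ => mul_nonneg (overlap_nonneg hw _ _) (sq_nonneg _)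

theorem coincr_nonneg (hw : IsWeight w) (f : Eu d → ℝ) (h : Eu d) : 0 ≤ coincr w f h :=
  integral_nonneg fun _ => mul_nonneg (overlap_nonneg hw _ _) (sq_nonneg _)

theorem IsBdd.sq (hf : IsBdd f) : IsBdd fun x => f x ^ 2 := by
  simpa only [pow_two] using hf.mul hf

theorem IsBdd.add' {g : Eu d → ℝ} (hf : IsBdd f) (hg : IsBdd g) : IsBdd fun x => f x + g x :=
  hf.add hg

/-- Quasi-concavity: the overlap of two points is at most the overlap of two points of the segment
between them. -/
theorem overlap_le_overlap (hw : IsWeight w) (x h : Eu d) {s t : ℝ} (hs : 0 ≤ s) (ht : 0 ≤ t)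
    (hst : s + t ≤ 1) : overlap w x h ≤ overlap w (x + s • h) (t • h) := by
  have h1 := hw.quasiconcave x (x + h) s hs (by linarith)
  have h2 := hw.quasiconcave x (x + h) (s + t) (by linarith) hst
  rw [add_sub_cancel_left] at h1 h2
  refine le_min h1 ?_
  rw [add_assoc, ← add_smul]
  exact h2

theorem dirichlet_eq (hw : IsWeight w) (hq : IsProposal q) (f : bddMeas d) :
    wInner hw f (mhLin hw hq f) = wInner hw f f - (∫ h, q h * incr w f.1 h) / 2 := by
  rw [wInner_mhLin hw hq f f]
  congr 3; funext h
  unfold incr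
  rw [← integral_const_mul]
  congr 1; funext x; ring

/-- Moving along `h` repeatedly: the square increment along `N h` is at most `N²` times the one
along `h`, because the weight is quasi-concave along the straight line. -/
theorem incr_natCast_smul_le (hw : IsWeight w) (hf : IsBdd f) {N : ℕ} (hN : 0 < N) (h : Eu d) :
    incr w f ((N : ℝ) • h) ≤ (N : ℝ) ^ 2 * incr w f h := by
  have hN' : (0 : ℝ) < N := by exact_mod_cast hN
  have key : ∀ x, overlap w x ((N : ℝ) • h) * (f (x + (N : ℝ) • h) - f x) ^ 2 ≤
      N * ∑ i ∈ Finset.range N, overlap w (x + (i : ℝ) • h) h *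
        (f (x + (i : ℝ) • h + h) - f (x + (i : ℝ) • h)) ^ 2 := by
    intro x
    have h1 : f (x + (N : ℝ) • h) - f x =
        ∑ i ∈ Finset.range N, (f (x + (i : ℝ) • h + h) - f (x + (i : ℝ) • h)) := by
      have := Finset.sum_range_sub (fun i : ℕ => f (x + (i : ℝ) • h)) N
      simp only [Nat.cast_zero, zero_smul, add_zero] at this
      rw [← this]
      refine Finset.sum_congr rfl fun i _ => ?_
      rw [add_assoc, Nat.cast_succ, add_smul, one_smul]
    have h2 : (f (x + (N : ℝ) • h) - f x) ^ 2 ≤ N * ∑ i ∈ Finset.range N,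
        (f (x + (i : ℝ) • h + h) - f (x + (i : ℝ) • h)) ^ 2 := by
      rw [h1]
      simpa using sq_sum_le_card_mul_sum_sq (s := Finset.range N)
        (f := fun i : ℕ => f (x + (i : ℝ) • h + h) - f (x + (i : ℝ) • h))
    refine (mul_le_mul_of_nonneg_left h2 (overlap_nonneg hw _ _)).trans ?_
    rw [mul_left_comm, Finset.mul_sum]
    refine mul_le_mul_of_nonneg_left (Finset.sum_le_sum fun i hi => ?_) hN'.le
    refine mul_le_mul_of_nonneg_right ?_ (sq_nonneg _)
    have hi' : ((i : ℝ) + 1) ≤ N := by exact_mod_cast Finset.mem_range.1 hi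
    have := overlap_le_overlap hw x ((N : ℝ) • h) (s := i / N) (t := 1 / N) (by positivity)
      (by positivity) (by rw [← add_div]; exact (div_le_one hN').2 hi')
    rwa [smul_smul, smul_smul, div_mul_cancel₀ _ hN'.ne', div_mul_cancel₀ _ hN'.ne', one_smul]
      at this
  have hint : ∀ i : ℕ, Integrable fun x => overlap w (x + (i : ℝ) • h) h *
        (f (x + (i : ℝ) • h + h) - f (x + (i : ℝ) • h)) ^ 2 := fun i =>
    (integrable_overlap_mul hw h ((hf.shift h).sub hf).sq).comp_add_right ((i : ℝ) • h)
  unfold incr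
  refine (integral_mono (integrable_overlap_mul hw _ ((hf.shift _).sub hf).sq)
    ((integrable_finsetSum _ fun i _ => hint i).const_mul _) key).trans ?_
  rw [integral_const_mul, integral_finsetSum _ fun i _ => hint i]
  have : ∀ i ∈ Finset.range N, (∫ x, overlap w (x + (i : ℝ) • h) h *
        (f (x + (i : ℝ) • h + h) - f (x + (i : ℝ) • h)) ^ 2) =
      ∫ x, overlap w x h * (f (x + h) - f x) ^ 2 := fun i _ =>
    integral_add_right_eq_self (fun x => overlap w x h * (f (x + h) - f x) ^ 2) ((i : ℝ) • h)
  rw [Finset.sum_congr rfl this]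
  simp only [Finset.sum_const, Finset.card_range, nsmul_eq_mul]
  apply le_of_eq; ring

/-- The mean square increment over a ball of radius `R`, not normalized. -/
noncomputable def ballIncr (w f : Eu d → ℝ) (R : ℝ) : ℝ := ∫ h in Metric.ball 0 R, incr w f h

theorem integrableOn_incr (hw : IsWeight w) (hf : IsBdd f) (R : ℝ) :
    IntegrableOn (incr w f) (Metric.ball 0 R) := by
  obtain ⟨M, hM⟩ := (isBdd_incr hw hf).2
  exact Measure.integrableOn_of_bounded (M := M) measure_ball_lt_top.ne
    (isBdd_incr hw hf).1.aestronglyMeasurable (Filter.Eventually.of_forall hM)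

theorem ballIncr_nonneg (hw : IsWeight w) (f : Eu d → ℝ) (R : ℝ) : 0 ≤ ballIncr w f R :=
  integral_nonneg fun _ => incr_nonneg hw f _

theorem ballIncr_mono (hw : IsWeight w) (hf : IsBdd f) {r R : ℝ} (h : r ≤ R) :
    ballIncr w f r ≤ ballIncr w f R :=
  setIntegral_mono_set (integrableOn_incr hw hf R)
    (Filter.Eventually.of_forall fun _ => incr_nonneg hw f _)
    (Metric.ball_subset_ball h).eventuallyLE

theorem ballIncr_natCast_mul_le (hw : IsWeight w) (hf : IsBdd f) {N : ℕ} (hN : 0 < N) (R : ℝ) :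
    ballIncr w f (N * R) ≤ (N : ℝ) ^ (d + 2) * ballIncr w f R := by
  have hN' : (0 : ℝ) < N := by exact_mod_cast hN
  unfold ballIncr
  rw [← integral_indicator Metric.isOpen_ball.measurableSet,
    ← integral_indicator Metric.isOpen_ball.measurableSet]
  have h1 := Measure.integral_comp_smul (volume : Measure (Eu d))
    ((Metric.ball (0 : Eu d) (N * R)).indicator (incr w f)) (N : ℝ)
  rw [finrank_euclideanSpace_fin, abs_of_pos (by positivity), smul_eq_mul,
    eq_inv_mul_iff_mul_eq₀ (by positivity)] at h1
  rw [← h1, pow_add, mul_assoc, ← integral_const_mul ((N : ℝ) ^ 2)]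
  refine mul_le_mul_of_nonneg_left ?_ (by positivity)
  refine integral_mono_of_nonneg (Filter.Eventually.of_forall fun h =>
    indicator_nonneg (fun _ _ => incr_nonneg hw f _) _)
    (((integrable_indicator_iff Metric.isOpen_ball.measurableSet).2
      (integrableOn_incr hw hf R)).const_mul _) (Filter.Eventually.of_forall fun h => ?_)
  by_cases hh : ‖h‖ < R
  · have h2 : (N : ℝ) • h ∈ Metric.ball (0 : Eu d) (N * R) := by
      rw [mem_ball_zero_iff, norm_smul, Real.norm_of_nonneg hN'.le]
      exact mul_lt_mul_of_pos_left hh hN'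
    simp only [indicator_of_mem h2, indicator_of_mem (mem_ball_zero_iff.2 hh)]
    exact incr_natCast_smul_le hw hf hN h
  · have h2 : (N : ℝ) • h ∉ Metric.ball (0 : Eu d) (N * R) := by
      rw [mem_ball_zero_iff, norm_smul, Real.norm_of_nonneg hN'.le, not_lt]
      exact mul_le_mul_of_nonneg_left (not_lt.1 hh) hN'.le
    have h3 : h ∉ Metric.ball (0 : Eu d) R := by rwa [mem_ball_zero_iff]
    simp [indicator_of_notMem h2, indicator_of_notMem h3]

theorem ballIncr_le_of_le (hw : IsWeight w) (hf : IsBdd f) {r s : ℝ} (hr : 0 < r) (hrs : r ≤ s) :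
    ballIncr w f s ≤ (2 * s / r) ^ (d + 2) * ballIncr w f r := by
  have h1 : 1 ≤ s / r := (one_le_div hr).2 hrs
  have hN : 0 < ⌈s / r⌉₊ := Nat.ceil_pos.2 (by linarith)
  have h2 : s ≤ (⌈s / r⌉₊ : ℝ) * r := (div_le_iff₀ hr).1 (Nat.le_ceil _)
  have h3 : (⌈s / r⌉₊ : ℝ) ≤ 2 * s / r := by
    have := (Nat.ceil_lt_add_one (by linarith : 0 ≤ s / r)).le
    rw [mul_div_assoc]; linarith
  refine (ballIncr_mono hw hf h2).trans ((ballIncr_natCast_mul_le hw hf hN r).trans ?_)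
  exact mul_le_mul_of_nonneg_right (pow_le_pow_left₀ (by positivity) h3 _)
    (ballIncr_nonneg hw f r)

/-! ### The lower end of the spectrum -/

/-- The stationary flow of `f²` through the proposed moves. -/
noncomputable def sqFlow (w q f : Eu d → ℝ) : ℝ := ∫ h, ∫ x, q h * overlap w x h * f x ^ 2

theorem sqFlow_le (hw : IsWeight w) (hq : IsProposal q) (f : bddMeas d) :
    sqFlow w q f.1 ≤ wInner hw f f := by
  obtain ⟨M, hM0, hM⟩ := (isBdd_coe f).sq.exists_bound
  have i1 := integrable_flow hw hq (F := fun z => f.1 z.1 ^ 2)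
    ((isBdd_coe f).sq.1.comp measurable_fst) (fun z => hM _)
  unfold sqFlow
  rw [← integral_integral_swap (f := fun x h => q h * overlap w x h * f.1 x ^ 2) i1, wInner_apply]
  refine integral_mono i1.integral_prod_left
    (((isBdd_coe f).mul (isBdd_coe f)).integrable_mul hw.integrable) fun x => ?_
  calc ∫ h, q h * overlap w x h * f.1 x ^ 2
      = f.1 x * f.1 x * w x * ∫ h, q h * accept w x h := by
        rw [← integral_const_mul]; congr 1; funext h; rw [← mul_accept hw]; ring
    _ ≤ f.1 x * f.1 x * w x :=
        mul_le_of_le_one_right (mul_nonneg (mul_self_nonneg _) (hw.nonneg x))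
          (integral_rate_le_one hw hq x)

theorem incr_add_coincr (hw : IsWeight w) (hq : IsProposal q) (f : bddMeas d) :
    (∫ h, q h * incr w f.1 h) + ∫ h, q h * coincr w f.1 h = 4 * sqFlow w q f.1 := by
  obtain ⟨M, hM0, hM⟩ := (isBdd_coe f).sq.exists_bound
  have hb := isBdd_coe f
  have i1 := integrable_flow hw hq (F := fun z => f.1 z.1 ^ 2)
    (hb.sq.1.comp measurable_fst) (fun z => hM _)
  have i2 := integrable_flow hw hq (F := fun z => f.1 (z.1 + z.2) ^ 2)
    (measurable_add_fst_snd hb.sq.1) (fun z => hM _)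
  have j1 : Integrable fun h => ∫ x, q h * overlap w x h * f.1 x ^ 2 := i1.integral_prod_right
  have j2 : Integrable fun h => ∫ x, q h * overlap w x h * f.1 (x + h) ^ 2 :=
    i2.integral_prod_right
  have e := integral_flow_swap (w := w) hq (fun a _ => f.1 a ^ 2)
  rw [← integral_add (integrable_proposal_mul hq (isBdd_incr hw hb))
    (integrable_proposal_mul hq (isBdd_coincr hw hb))]
  have : 4 * sqFlow w q f.1 = 2 * (sqFlow w q f.1 +
      ∫ h, ∫ x, q h * overlap w x h * f.1 (x + h) ^ 2) := by
    unfold sqFlow; rw [e]; ring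
  rw [this, sqFlow, ← integral_add j1 j2, ← integral_const_mul]
  congr 1; funext h
  unfold incr coincr
  rw [← mul_add, ← integral_add (integrable_overlap_mul hw _ ((hb.shift _).sub hb).sq)
    (integrable_overlap_mul hw _ ((hb.shift _).add' hb).sq)]
  have e2 : ∀ F : Eu d → ℝ, ∫ x, q h * overlap w x h * F x = q h * ∫ x, overlap w x h * F x := by
    intro F; rw [← integral_const_mul]; congr 1; funext x; ring
  rw [e2, e2 (fun x => f.1 (x + h) ^ 2), ← mul_add,
    ← integral_add (integrable_overlap_mul hw _ hb.sq)
      (integrable_overlap_mul hw _ (hb.shift h).sq), mul_left_comm,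
    ← integral_const_mul (2 : ℝ)]
  congr 2; funext x; ring

/-- The triangle through `x`, `x + h` and their midpoint has odd length, so `f²` is controlled by
the sums of `f` over its three edges. -/
theorem sqFlow_le_coincr (hw : IsWeight w) (hq : IsProposal q) (f : bddMeas d) :
    4 * sqFlow w q f.1 ≤ 3 * (1 + 2 ^ (d + 1)) * ∫ h, q h * coincr w f.1 h := by
  have hb := isBdd_coe f
  have half : ∀ h : Eu d, (1 / 2 : ℝ) • h + (1 / 2 : ℝ) • h = h := fun h => by
    rw [← add_smul]; norm_num
  have p1 : ∀ h, 4 * ∫ x, overlap w x h * f.1 x ^ 2 ≤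
      3 * (coincr w f.1 h + 2 * coincr w f.1 ((1 / 2 : ℝ) • h)) := by
    intro h
    set k := (1 / 2 : ℝ) • h with hk
    have i1 := integrable_overlap_mul hw h ((hb.shift h).add' hb).sq
    have i2 := integrable_overlap_mul hw k ((hb.shift k).add' hb).sq
    have i3 := i2.comp_add_right k
    have e3 : coincr w f.1 k = ∫ x, overlap w (x + k) k * (f.1 (x + k + k) + f.1 (x + k)) ^ 2 :=
      (integral_add_right_eq_self _ k).symm
    have : coincr w f.1 h + 2 * coincr w f.1 k = coincr w f.1 h + coincr w f.1 k +
        ∫ x, overlap w (x + k) k * (f.1 (x + k + k) + f.1 (x + k)) ^ 2 := by rw [← e3]; ring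
    rw [this, coincr, coincr, ← integral_add i1 i2, ← integral_add (i1.fun_add i2) i3,
      ← integral_const_mul, ← integral_const_mul]
    refine integral_mono ((integrable_overlap_mul hw h hb.sq).const_mul _)
      (((i1.fun_add i2).fun_add i3).const_mul _) fun x => ?_
    have o1 : overlap w x h ≤ overlap w x k := by
      have := overlap_le_overlap hw x h (s := 0) (t := 1 / 2) le_rfl (by norm_num) (by norm_num)
      rwa [zero_smul, add_zero] at this
    have o2 : overlap w x h ≤ overlap w (x + k) k :=
      overlap_le_overlap hw x h (s := 1 / 2) (t := 1 / 2) (by norm_num) (by norm_num) (by norm_num)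
    have e4 : x + k + k = x + h := by rw [add_assoc, hk, half]
    simp only [e4]
    have o0 := overlap_nonneg hw x h
    set a := f.1 x; set b := f.1 (x + h); set c := f.1 (x + k)
    have t1 : 4 * a ^ 2 ≤ 3 * ((b + a) ^ 2 + (c + a) ^ 2 + (b + c) ^ 2) := by
      nlinarith [sq_nonneg ((b + a) - (c + a)), sq_nonneg ((b + a) + (b + c)),
        sq_nonneg ((c + a) + (b + c))]
    have t2 := mul_le_mul_of_nonneg_left t1 o0
    have t3 := mul_le_mul_of_nonneg_right o1 (sq_nonneg (c + a))
    have t4 := mul_le_mul_of_nonneg_right o2 (sq_nonneg (b + c))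
    nlinarith
  have hcb := isBdd_coincr hw hb
  have hcb2 : IsBdd fun h => coincr w f.1 ((1 / 2 : ℝ) • h) := by
    obtain ⟨M, hM⟩ := hcb.2
    exact ⟨hcb.1.comp (measurable_const_smul _), M, fun x => hM _⟩
  have p2 : ∫ h, q h * coincr w f.1 ((1 / 2 : ℝ) • h) ≤ 2 ^ d * ∫ h, q h * coincr w f.1 h := by
    have h1 := Measure.integral_comp_smul (volume : Measure (Eu d))
      (fun h => q h * coincr w f.1 ((1 / 2 : ℝ) • h)) (2 : ℝ)
    rw [finrank_euclideanSpace_fin, abs_of_pos (by positivity), smul_eq_mul,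
      eq_inv_mul_iff_mul_eq₀ (by positivity)] at h1
    rw [← h1]
    refine mul_le_mul_of_nonneg_left ?_ (by positivity)
    refine integral_mono_of_nonneg (Filter.Eventually.of_forall fun h =>
      mul_nonneg (hq.nonneg _) (coincr_nonneg hw _ _)) (integrable_proposal_mul hq hcb)
      (Filter.Eventually.of_forall fun h => ?_)
    simp only [smul_smul]
    norm_num
    refine mul_le_mul_of_nonneg_right (hq.antitone _ _ ?_) (coincr_nonneg hw _ _)
    rw [norm_smul]; norm_num; linarith [norm_nonneg h]
  have i1 := integrable_proposal_mul hq hcb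
  have i2 := integrable_proposal_mul hq hcb2
  calc 4 * sqFlow w q f.1 = ∫ h, q h * (4 * ∫ x, overlap w x h * f.1 x ^ 2) := by
        unfold sqFlow; rw [← integral_const_mul]; congr 1; funext h
        rw [← integral_const_mul (4 : ℝ), ← integral_const_mul (4 : ℝ), ← integral_const_mul (q h)]
        congr 1; funext x; ring
    _ ≤ ∫ h, 3 * (q h * coincr w f.1 h + 2 * (q h * coincr w f.1 ((1 / 2 : ℝ) • h))) := by
        refine integral_mono_of_nonneg (Filter.Eventually.of_forall fun h =>
          mul_nonneg (hq.nonneg h) (mul_nonneg (by norm_num) (integral_nonneg fun x =>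
            mul_nonneg (overlap_nonneg hw _ _) (sq_nonneg _))))
          ((i1.add (i2.const_mul 2)).const_mul 3) (Filter.Eventually.of_forall fun h => ?_)
        have := mul_le_mul_of_nonneg_left (p1 h) (hq.nonneg h)
        simp only
        linarith
    _ = 3 * ((∫ h, q h * coincr w f.1 h) +
          2 * ∫ h, q h * coincr w f.1 ((1 / 2 : ℝ) • h)) := by
        rw [integral_const_mul, integral_add i1 (i2.const_mul 2), integral_const_mul]
    _ ≤ _ := by rw [pow_succ]; linarith

/-- The spectrum of the Metropolis-Hastings operator stays away from `-1`. -/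
theorem wInner_add_mhLin_ge (hw : IsWeight w) (hq : IsProposal q) (f : bddMeas d) :
    1 / (6 * 2 ^ d) * wInner hw f f ≤ wInner hw f f + wInner hw f (mhLin hw hq f) := by
  have h1 := sqFlow_le hw hq f
  have h2 := incr_add_coincr hw hq f
  have h3 := sqFlow_le_coincr hw hq f
  have h4 := dirichlet_eq hw hq f
  set S := sqFlow w q f.1
  set I := ∫ h, q h * incr w f.1 h
  set J := ∫ h, q h * coincr w f.1 h with hJ
  have hJ0 : 0 ≤ J := integral_nonneg fun h => mul_nonneg (hq.nonneg _) (coincr_nonneg hw _ _)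
  rw [h4]
  have h2d : (1 : ℝ) ≤ 2 ^ d := one_le_pow₀ (by norm_num)
  rw [div_mul_eq_mul_div, one_mul, div_le_iff₀ (by positivity)]
  rw [pow_succ] at h3
  nlinarith [mul_nonneg (sub_nonneg.2 h2d) (sub_nonneg.2 h1), mul_nonneg (sub_nonneg.2 h2d) hJ0]

end increments

/-! ### Symmetric operators and quadratic forms -/

section abstractForms

variable {V : Type*} [AddCommGroup V] [Module ℝ V] (B : V →ₗ[ℝ] V →ₗ[ℝ] ℝ) (T : V →ₗ[ℝ] V)

/-- A symmetric operator is bounded by the supremum of its quadratic form (polarization). -/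
theorem sq_norm_le_of_abs_form_le (hB : ∀ f g, B f g = B g f) 
    (hT : ∀ f g, B f (T g) = B (T f) g) (W : Submodule ℝ V) (hW : ∀ f ∈ W, T f ∈ W) {c : ℝ}
    (hc : 0 < c) (h : ∀ f ∈ W, |B f (T f)| ≤ c * B f f) {f : V} (hf : f ∈ W) :
    B (T f) (T f) ≤ c ^ 2 * B f f := by
  have hg : c⁻¹ • T f ∈ W := W.smul_mem _ (hW f hf)
  have h1 := (abs_le.1 (h _ (W.add_mem hf hg))).2
  have h2 := (abs_le.1 (h _ (W.sub_mem hf hg))).1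
  have e1 : B f (T (T f)) = B (T f) (T f) := hT f (T f)
  have e2 : B (T f) f = B f (T f) := hB _ _
  simp only [map_add, map_sub, map_smul, LinearMap.add_apply, LinearMap.sub_apply,
    LinearMap.smul_apply, smul_eq_mul, e1, e2] at h1 h2
  set n := B (T f) (T f)
  set m := B f f
  have h3 : 4 * (c⁻¹ * n) ≤ c * (2 * m + 2 * (c⁻¹ * (c⁻¹ * n))) := by nlinarith
  have h4 : c * (2 * m + 2 * (c⁻¹ * (c⁻¹ * n))) = 2 * c * m + 2 * (c⁻¹ * n) := by
    field_simp
  have h5 : c⁻¹ * n ≤ c * m := by linarith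
  rw [inv_mul_le_iff₀ hc] at h5
  linarith

/-- The square norm decreases by a multiple of the Dirichlet form in one step, when the spectrum
of the operator is at distance `γ` from `-1`. -/
theorem sq_norm_le_sub_dirichlet (hB : ∀ f g, B f g = B g f)
    (hT : ∀ f g, B f (T g) = B (T f) g) (hE : ∀ f, 0 ≤ B f f - B f (T f)) {γ : ℝ}
    (hγ : γ ≤ 1) (h : ∀ f, γ * B f f ≤ B f f + B f (T f)) (f : V) :
    B (T f) (T f) ≤ B f f - γ * (B f f - B f (T f)) := by
  have hpos : 0 < 2 - γ := by linarith
  have e1 : B f (T (T f)) = B (T f) (T f) := hT f (T f)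
  have e2 : B (T f) f = B f (T f) := hB _ _
  set A := f - T f with hA
  have h1 := hE (f - (2 - γ)⁻¹ • A)
  have h2 := h A
  simp only [hA, map_sub, map_smul, LinearMap.sub_apply, LinearMap.smul_apply, smul_eq_mul, e1, e2]
    at h1 h2
  set n := B (T f) (T f)
  set m := B f f
  set k := B f (T f)
  set l := B (T f) (T (T f))
  set t := (2 - γ)⁻¹ with ht
  have ht0 : 0 < t := inv_pos.2 hpos
  have ht1 : t * (2 - γ) = 1 := inv_mul_cancel₀ hpos.ne'
  -- `a = ‖f - T f‖²` and `b` is the Dirichlet form of `f - T f`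
  set a := m - 2 * k + n with ha
  have hb : m - 3 * k + 3 * n - l ≤ (2 - γ) * a := by rw [ha]; nlinarith
  have hc : 0 ≤ (m - k) - 2 * t * a + t ^ 2 * (m - 3 * k + 3 * n - l) := by
    rw [ha]; nlinarith
  have hd : t ^ 2 * (m - 3 * k + 3 * n - l) ≤ t * a := by
    calc t ^ 2 * (m - 3 * k + 3 * n - l) ≤ t ^ 2 * ((2 - γ) * a) :=
          mul_le_mul_of_nonneg_left hb (sq_nonneg t)
      _ = t * (t * (2 - γ)) * a := by ring
      _ = t * a := by rw [ht1, mul_one]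
  have he : t * a ≤ m - k := by linarith
  have hf : a ≤ (2 - γ) * (m - k) := by
    calc a = (2 - γ) * (t * a) := by rw [← mul_assoc, mul_comm (2 - γ), ht1, one_mul]
      _ ≤ _ := mul_le_mul_of_nonneg_left he hpos.le
  linarith

end abstractForms

section mhForms

variable {d : ℕ} {w q : Eu d → ℝ}

theorem wInner_comm (hw : IsWeight w) (f g : bddMeas d) : wInner hw f g = wInner hw g f := by
  simp only [wInner_apply]; congr 1; funext x; ring

theorem wInner_self_nonneg (hw : IsWeight w) (f : bddMeas d) : 0 ≤ wInner hw f f :=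
  integral_nonneg fun x => mul_nonneg (mul_self_nonneg _) (hw.nonneg x)

theorem wInner_mhLin_symm (hw : IsWeight w) (hq : IsProposal q) (f g : bddMeas d) :
    wInner hw f (mhLin hw hq g) = wInner hw (mhLin hw hq f) g := by
  rw [wInner_comm hw (mhLin hw hq f) g, wInner_mhLin, wInner_mhLin, wInner_comm hw f g]
  congr 3; funext h; congr 1; funext x; ring

theorem integral_incr_nonneg (hw : IsWeight w) (hq : IsProposal q) (f : Eu d → ℝ) :
    0 ≤ ∫ h, q h * incr w f h :=
  integral_nonneg fun h => mul_nonneg (hq.nonneg h) (incr_nonneg hw f h)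

theorem wInner_mhLin_self_le (hw : IsWeight w) (hq : IsProposal q) (f : bddMeas d) :
    wInner hw (mhLin hw hq f) (mhLin hw hq f) ≤
      wInner hw f f - 1 / (12 * 2 ^ d) * ∫ h, q h * incr w f.1 h := by
  have h2d : (1 : ℝ) ≤ 2 ^ d := one_le_pow₀ (by norm_num)
  have := sq_norm_le_sub_dirichlet (wInner hw) (mhLin hw hq) (wInner_comm hw)
    (wInner_mhLin_symm hw hq)
    (fun f => by have := integral_incr_nonneg hw hq f.1; rw [dirichlet_eq hw hq]; linarith)
    (γ := 1 / (6 * 2 ^ d)) ((div_le_one (by positivity)).2 (by linarith))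
    (wInner_add_mhLin_ge hw hq) f
  rw [dirichlet_eq hw hq] at this
  refine this.trans (le_of_eq ?_)
  field_simp
  ring

/-- `w dx` is stationary. -/
theorem integral_mhOp_mul (hw : IsWeight w) (hq : IsProposal q) {f : Eu d → ℝ} (hf : IsBdd f) :
    ∫ x, mhOp w q f x * w x = ∫ x, f x * w x := by
  have := wInner_mhLin hw hq ⟨fun _ => 1, IsBdd.const 1⟩ ⟨f, hf⟩
  simpa [wInner_apply, mhLin_apply] using this

theorem wInner_sq_le (hw : IsWeight w) (f g : bddMeas d) :
    wInner hw f g ^ 2 ≤ wInner hw f f * wInner hw g g := by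
  have key : ∀ t : ℝ, 0 ≤ wInner hw g g * (t * t) + (2 * wInner hw f g) * t + wInner hw f f := by
    intro t
    have := wInner_self_nonneg hw (f + t • g)
    simp only [map_add, map_smul, LinearMap.add_apply, LinearMap.smul_apply, smul_eq_mul,
      wInner_comm hw g f] at this
    linarith
  have := discrim_le_zero key
  unfold discrim at this
  nlinarith

end mhForms

/-! ### Radially decreasing functions as mixtures of balls -/

section layercake

variable {d : ℕ} [NeZero d] {q : Eu d → ℝ}

theorem volume_closedBall_diff_ball (x : Eu d) (r : ℝ) :
    volume (Metric.closedBall x r \ Metric.ball x r) = 0 := by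
  rw [Metric.closedBall_sdiff_ball]
  exact Measure.addHaar_sphere _ _ _

/-- An inequality between two measures of the balls around `0` passes to the integrals of a
radially decreasing function. -/
theorem lintegral_mul_le_of_ball (hq : IsProposal q) {ρ : ℝ} (hρ : ∀ x, ρ < ‖x‖ → q x = 0)
    {F G : Eu d → ℝ≥0∞} (hF : Measurable F) (hG : Measurable G)
    (h : ∀ R, 0 < R → R ≤ ρ → ∫⁻ x in Metric.ball 0 R, F x ≤ ∫⁻ x in Metric.ball 0 R, G x) :
    ∫⁻ x, ENNReal.ofReal (q x) * F x ≤ ∫⁻ x, ENNReal.ofReal (q x) * G x := by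
  have e : ∀ F : Eu d → ℝ≥0∞, Measurable F → ∫⁻ x, ENNReal.ofReal (q x) * F x =
      ∫⁻ t in Ioi (0 : ℝ), (volume.withDensity F) {x | t < q x} := by
    intro F hF
    rw [← lintegral_eq_lintegral_meas_lt (volume.withDensity F)
      (Filter.Eventually.of_forall hq.nonneg) hq.measurable.aemeasurable,
      lintegral_withDensity_eq_lintegral_mul _ hF hq.measurable.ennreal_ofReal]
    simp only [Pi.mul_apply, mul_comm]
  rw [e F hF, e G hG]
  refine lintegral_mono_ae ((ae_restrict_iff' measurableSet_Ioi).2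
    (Filter.Eventually.of_forall fun t ht => ?_))
  set S := {x | t < q x} with hS
  rcases S.eq_empty_or_nonempty with h0 | ⟨x0, hx0⟩
  · rw [h0]; simp
  have hbd : ∀ x ∈ S, ‖x‖ ≤ ρ := by
    intro x hx
    by_contra hc
    have h1 : t < q x := hx
    rw [hρ x (not_le.1 hc)] at h1
    exact absurd ht (not_lt.2 h1.le)
  set r := sSup (norm '' S) with hr
  have hBA : BddAbove (norm '' S) := ⟨ρ, by rintro _ ⟨x, hx, rfl⟩; exact hbd x hx⟩
  have hle : S ⊆ Metric.closedBall 0 r := fun x hx => by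
    rw [mem_closedBall_zero_iff]; exact le_csSup hBA ⟨x, hx, rfl⟩
  have hge : Metric.ball 0 r ⊆ S := by
    intro x hx
    rw [mem_ball_zero_iff] at hx
    obtain ⟨_, ⟨y, hy, rfl⟩, hxy⟩ := exists_lt_of_lt_csSup (Set.Nonempty.image _ ⟨x0, hx0⟩) hx
    exact lt_of_lt_of_le hy (hq.antitone _ _ hxy.le)
  have hrρ : r ≤ ρ := csSup_le (Set.Nonempty.image _ ⟨x0, hx0⟩)
    (by rintro _ ⟨x, hx, rfl⟩; exact hbd x hx)
  have hnull : (volume.withDensity F) (Metric.closedBall 0 r \ Metric.ball 0 r) = 0 :=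
    withDensity_absolutelyContinuous _ _ (volume_closedBall_diff_ball 0 r)
  calc (volume.withDensity F) S ≤ (volume.withDensity F) (Metric.closedBall 0 r) :=
        measure_mono hle
    _ ≤ (volume.withDensity F) (Metric.ball 0 r) := by
        have := measure_le_inter_add_sdiff (volume.withDensity F) (Metric.closedBall 0 r)
          (Metric.ball 0 r)
        rw [hnull, add_zero] at this
        exact this.trans (measure_mono inter_subset_right)
    _ ≤ (volume.withDensity G) (Metric.ball 0 r) := by
        rw [withDensity_apply _ Metric.isOpen_ball.measurableSet,
          withDensity_apply _ Metric.isOpen_ball.measurableSet]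
        rcases le_or_gt r 0 with hr0 | hr0
        · rw [Metric.ball_eq_empty.2 hr0]; simp
        · exact h r hr0 hrρ
    _ ≤ (volume.withDensity G) S := measure_mono hge

theorem integral_mul_le_of_ball (hq : IsProposal q) {ρ : ℝ} (hρ : ∀ x, ρ < ‖x‖ → q x = 0)
    {F G : Eu d → ℝ} (hF : Measurable F) (hG : Measurable G) (hF0 : ∀ x, 0 ≤ F x)
    (hG0 : ∀ x, 0 ≤ G x) (hFi : ∀ R, IntegrableOn F (Metric.ball 0 R))
    (hGi : ∀ R, IntegrableOn G (Metric.ball 0 R)) (hqG : Integrable fun x => q x * G x)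
    (h : ∀ R, 0 < R → R ≤ ρ → ∫ x in Metric.ball 0 R, F x ≤ ∫ x in Metric.ball 0 R, G x) :
    ∫ x, q x * F x ≤ ∫ x, q x * G x := by
  have key := lintegral_mul_le_of_ball hq hρ hF.ennreal_ofReal hG.ennreal_ofReal
    fun R hR hRρ => by
      rw [← ofReal_integral_eq_lintegral_ofReal (hFi R) (Filter.Eventually.of_forall hF0),
        ← ofReal_integral_eq_lintegral_ofReal (hGi R) (Filter.Eventually.of_forall hG0)]
      exact ENNReal.ofReal_le_ofReal (h R hR hRρ)
  simp only [← ENNReal.ofReal_mul (hq.nonneg _)] at key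
  rw [integral_eq_lintegral_of_nonneg_ae
      (Filter.Eventually.of_forall fun x => mul_nonneg (hq.nonneg x) (hF0 x))
      (hq.measurable.mul hF).aestronglyMeasurable,
    integral_eq_lintegral_of_nonneg_ae
      (Filter.Eventually.of_forall fun x => mul_nonneg (hq.nonneg x) (hG0 x))
      (hq.measurable.mul hG).aestronglyMeasurable]
  refine ENNReal.toReal_mono ?_ key
  rw [← ofReal_integral_eq_lintegral_ofReal hqG
    (Filter.Eventually.of_forall fun x => mul_nonneg (hq.nonneg x) (hG0 x))]
  exact ENNReal.ofReal_ne_top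

end layercake

/-! ### The drift of a quasi-concave target towards its mode -/

section drift

variable {d : ℕ}

/-- The volume of the unit ball. -/
noncomputable def unitVol (d : ℕ) : ℝ := (volume : Measure (Eu d)).real (Metric.ball 0 1)

theorem unitVol_pos (d : ℕ) : 0 < unitVol d :=
  ENNReal.toReal_pos (Metric.measure_ball_pos _ _ one_pos).ne' measure_ball_lt_top.ne

theorem volume_real_ball (x : Eu d) {r : ℝ} (hr : 0 < r) :
    (volume : Measure (Eu d)).real (Metric.ball x r) = r ^ d * unitVol d := by
  have := Measure.addHaar_ball_mul_of_pos (volume : Measure (Eu d)) x hr 1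
  rw [mul_one, finrank_euclideanSpace_fin] at this
  rw [unitVol, Measure.real, Measure.real, this, ENNReal.toReal_mul,
    ENNReal.toReal_ofReal (by positivity)]

theorem integrableOn_ball_of_le {F : Eu d → ℝ} (hF : Measurable F) (x : Eu d) (R M : ℝ)
    (hM : ∀ h ∈ Metric.ball x R, |F h| ≤ M) : IntegrableOn F (Metric.ball x R) :=
  Measure.integrableOn_of_bounded (M := M) measure_ball_lt_top.ne hF.aestronglyMeasurable
    ((ae_restrict_iff' Metric.isOpen_ball.measurableSet).2 (Filter.Eventually.of_forall hM))

theorem second_moment_ball (hd : 0 < d) {R : ℝ} (hR : 0 < R) :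
    R ^ 2 * (R ^ d * unitVol d) ≤ 8 * ∫ h in Metric.ball (0 : Eu d) R, ‖h‖ ^ 2 := by
  set A := Metric.ball (0 : Eu d) R
  set A' := Metric.ball (0 : Eu d) (R / 2)
  have hsub : A' ⊆ A := Metric.ball_subset_ball (by linarith)
  have hint : IntegrableOn (fun h : Eu d => ‖h‖ ^ 2) A :=
    integrableOn_ball_of_le (by fun_prop) 0 R (R ^ 2) fun h hh => by
      rw [abs_of_nonneg (by positivity)]
      exact pow_le_pow_left₀ (norm_nonneg _) (mem_ball_zero_iff.1 hh).le 2
  have h1 : (R / 2) ^ 2 * (volume : Measure (Eu d)).real (A \ A') ≤ ∫ h in A, ‖h‖ ^ 2 := by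
    calc (R / 2) ^ 2 * (volume : Measure (Eu d)).real (A \ A')
        = ∫ h in A \ A', (R / 2) ^ 2 := by simp [mul_comm]
      _ ≤ ∫ h in A \ A', ‖h‖ ^ 2 := by
          refine setIntegral_mono_on (integrableOn_const
            ((measure_mono sdiff_subset).trans_lt measure_ball_lt_top).ne)
            (hint.mono_set sdiff_subset)
            (Metric.isOpen_ball.measurableSet.diff Metric.isOpen_ball.measurableSet) ?_
          rintro h ⟨-, hh⟩
          rw [mem_ball_zero_iff, not_lt] at hh
          exact pow_le_pow_left₀ (by positivity) hh 2
      _ ≤ ∫ h in A, ‖h‖ ^ 2 := setIntegral_mono_set hint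
          (Filter.Eventually.of_forall fun h => by positivity) sdiff_subset.eventuallyLE
  have h2 : (volume : Measure (Eu d)).real (A \ A') =
      R ^ d * unitVol d - (R / 2) ^ d * unitVol d := by
    rw [measureReal_sdiff hsub Metric.isOpen_ball.measurableSet measure_ball_lt_top.ne,
      volume_real_ball _ hR, volume_real_ball _ (half_pos hR)]
  rw [h2, div_pow, div_pow] at h1
  have h3 : (2 : ℝ) ≤ 2 ^ d := le_self_pow₀ (by norm_num) hd.ne'
  have h4 : R ^ d / 2 ^ d ≤ R ^ d / 2 := div_le_div_of_nonneg_left (by positivity) (by norm_num) h3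
  have h5 : R ^ d / 2 ^ d * unitVol d ≤ R ^ d / 2 * unitVol d :=
    mul_le_mul_of_nonneg_right h4 (unitVol_pos d).le
  nlinarith [sq_nonneg R]

/-- A function that increases along the segments to `e` does not push away from `e`, up to a second
moment. The function `(R² - |h|²)₊ / 2` has gradient `-h` on the ball; its integral against `α` does
not decrease when the space is contracted towards `e`, and the derivative of this comparison at the
identity is the claim. -/
theorem drift_ball {α : Eu d → ℝ} (hα : Measurable α) (h0 : ∀ h, 0 ≤ α h) (h1 : ∀ h, α h ≤ 1)
    (e : Eu d) (hmono : ∀ h : Eu d, ∀ t : ℝ, 0 ≤ t → t ≤ 1 → α h ≤ α (h + t • (e - h)))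
    {R : ℝ} (hR : 0 < R) :
    -(d * R ^ 2 * (R ^ d * unitVol d)) / 2 ≤
      ∫ h in Metric.ball 0 R, α h * inner ℝ h (e - h) := by
  set A := Metric.ball (0 : Eu d) R with hA
  have hAm : MeasurableSet A := Metric.isOpen_ball.measurableSet
  set k : Eu d → ℝ := fun h => (R ^ 2 - ‖h‖ ^ 2) / 2 with hk
  have bd : ∀ {F : Eu d → ℝ} {M : ℝ}, Measurable F → (∀ h ∈ A, |F h| ≤ M) →
      IntegrableOn (fun h => α h * F h) A := by
    intro F M hF hM
    refine integrableOn_ball_of_le (F := fun h => α h * F h) (hα.mul hF) 0 R M fun h hh => ?_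
    rw [abs_mul, abs_of_nonneg (h0 h)]
    exact (mul_le_of_le_one_left (abs_nonneg _) (h1 h)).trans (hM h hh)
  have hnorm : ∀ h ∈ A, ‖h‖ < R := fun h hh => mem_ball_zero_iff.1 hh
  have hesub : ∀ h ∈ A, ‖e - h‖ ≤ ‖e‖ + R := fun h hh =>
    (norm_sub_le _ _).trans (by linarith [hnorm h hh])
  have hk0 : ∀ h ∈ A, 0 ≤ k h ∧ k h ≤ R ^ 2 / 2 := by
    intro h hh
    have := hnorm h hh
    have h2 : ‖h‖ ^ 2 ≤ R ^ 2 := pow_le_pow_left₀ (norm_nonneg _) this.le 2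
    simp only [hk]
    constructor <;> nlinarith [sq_nonneg ‖h‖]
  have ik : IntegrableOn (fun h => α h * k h) A := bd (M := R ^ 2 / 2) (by fun_prop) fun h hh => by
    rw [abs_of_nonneg (hk0 h hh).1]; exact (hk0 h hh).2
  have iJ : IntegrableOn (fun h => α h * inner ℝ h (e - h)) A :=
    bd (M := R * (‖e‖ + R)) (by fun_prop) fun h hh =>
      (abs_real_inner_le_norm _ _).trans (mul_le_mul (hnorm h hh).le (hesub h hh)
        (norm_nonneg _) hR.le)
  have iQ : IntegrableOn (fun h => α h * (‖e - h‖ ^ 2 / 2)) A :=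
    bd (M := (‖e‖ + R) ^ 2 / 2) (by fun_prop) fun h hh => by
      rw [abs_of_nonneg (by positivity)]
      have := pow_le_pow_left₀ (norm_nonneg _) (hesub h hh) 2
      linarith
  set K := ∫ h in A, α h * k h with hKdef
  set J := ∫ h in A, α h * inner ℝ h (e - h) with hJdef
  set Q := ∫ h in A, α h * (‖e - h‖ ^ 2 / 2) with hQdef
  have hK0 : 0 ≤ K := setIntegral_nonneg hAm fun h hh => mul_nonneg (h0 h) (hk0 h hh).1
  have hQ0 : 0 ≤ Q := setIntegral_nonneg hAm fun h hh => mul_nonneg (h0 h) (by positivity)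
  have hKle : K ≤ R ^ 2 / 2 * (R ^ d * unitVol d) := by
    rw [← volume_real_ball (0 : Eu d) hR]
    calc K ≤ ∫ h in A, R ^ 2 / 2 := setIntegral_mono_on ik
          (integrableOn_const measure_ball_lt_top.ne) hAm fun h hh =>
            (mul_le_of_le_one_left (hk0 h hh).1 (h1 h)).trans (hk0 h hh).2
      _ = _ := by simp [hA, mul_comm]
  -- contraction by the factor `1 - t` towards `e`
  have main : ∀ t : ℝ, 0 < t → t < 1 → (1 - t) ^ d * (K - t * J - t ^ 2 * Q) ≤ K := by
    intro t ht0 ht1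
    have hpos : 0 < 1 - t := by linarith
    set φ : Eu d → ℝ := A.indicator fun h => α h * k h with hφ
    have hφ0 : ∀ h, 0 ≤ φ h := fun h =>
      indicator_nonneg (fun h hh => mul_nonneg (h0 h) (hk0 h hh).1) h
    have hφi : Integrable φ := (integrable_indicator_iff hAm).2 ik
    have cv : (1 - t) ^ d * ∫ h, φ ((1 - t) • h + t • e) = K := by
      have h2 := Measure.integral_comp_smul (volume : Measure (Eu d))
        (fun h => φ (h + t • e)) (1 - t)
      rw [finrank_euclideanSpace_fin, abs_of_pos (by positivity), smul_eq_mul,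
        eq_inv_mul_iff_mul_eq₀ (by positivity), integral_add_right_eq_self] at h2
      rw [h2, hKdef, hφ, integral_indicator hAm]
    have hφi2 : Integrable fun h => φ ((1 - t) • h + t • e) :=
      (hφi.comp_add_right (t • e)).comp_smul hpos.ne'
    refine le_trans (mul_le_mul_of_nonneg_left ?_ (by positivity)) cv.le
    have i2 : IntegrableOn (fun h => α h * k h - t * (α h * inner ℝ h (e - h)) -
        t ^ 2 * (α h * (‖e - h‖ ^ 2 / 2))) A := (Integrable.sub ik (iJ.const_mul t)).sub
        (iQ.const_mul _)
    have e1 : K - t * J - t ^ 2 * Q = ∫ h in A, (α h * k h - t * (α h * inner ℝ h (e - h)) -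
        t ^ 2 * (α h * (‖e - h‖ ^ 2 / 2))) := by
      rw [integral_sub (f := fun h => α h * k h - t * (α h * inner ℝ h (e - h)))
          (Integrable.sub ik (iJ.const_mul t)) (iQ.const_mul _),
        integral_sub ik (iJ.const_mul t), integral_const_mul, integral_const_mul]
    rw [e1, ← integral_indicator hAm]
    refine integral_mono ((integrable_indicator_iff hAm).2 i2) hφi2 fun h => ?_
    by_cases hh : h ∈ A
    · rw [indicator_of_mem hh]
      have e2 : (1 - t) • h + t • e = h + t • (e - h) := by
        rw [sub_smul, one_smul, smul_sub]; abel
      have e3 : α h * k h - t * (α h * inner ℝ h (e - h)) - t ^ 2 * (α h * (‖e - h‖ ^ 2 / 2)) =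
          α h * k (h + t • (e - h)) := by
        simp only [hk]
        rw [norm_add_sq_real, inner_smul_right, norm_smul, Real.norm_of_nonneg ht0.le]
        ring
      rw [e2, e3]
      by_cases hz : h + t • (e - h) ∈ A
      · rw [hφ, indicator_of_mem hz]
        exact mul_le_mul_of_nonneg_right (hmono h t ht0.le ht1.le) (hk0 _ hz).1
      · refine le_trans ?_ (hφ0 _)
        refine mul_nonpos_of_nonneg_of_nonpos (h0 h) ?_
        rw [hA, mem_ball_zero_iff, not_lt] at hz
        have := pow_le_pow_left₀ hR.le hz 2
        simp only [hk]; linarith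
    · rw [indicator_of_notMem hh]; exact hφ0 _
  -- let `t → 0`
  have fin : -J ≤ d * K := by
    by_contra hcon
    rw [not_le] at hcon
    set u := -J - d * K with hu
    have hu0 : 0 < u := by linarith
    have hdK : 0 ≤ (d : ℝ) * K := by positivity
    set D := Q + d * |J| + 1 with hD
    have hD0 : 0 < D := by positivity
    set t := min (1 / 2) (u / (2 * D)) with ht
    have ht0 : 0 < t := lt_min (by norm_num) (by positivity)
    have ht1 : t < 1 := (min_le_left _ _).trans_lt (by norm_num)
    have htu : t * D ≤ u / 2 := by
      calc t * D ≤ u / (2 * D) * D := mul_le_mul_of_nonneg_right (min_le_right _ _) hD0.le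
        _ = u / 2 := by field_simp
    have hm := main t ht0 ht1
    have hdJ : 0 ≤ (d : ℝ) * |J| := by positivity
    have hbr : 0 ≤ K - t * J - t ^ 2 * Q := by
      have : 0 ≤ t * (-J - t * Q) := mul_nonneg ht0.le (by nlinarith)
      nlinarith
    have hb : 1 - d * t ≤ (1 - t) ^ d := by
      have := one_add_mul_le_pow (a := -t) (by linarith) d
      rw [← sub_eq_add_neg] at this
      linarith
    have h3 := (mul_le_mul_of_nonneg_right hb hbr).trans hm
    have h4 : t * (-J - d * K) ≤ t * (t * (Q - d * J - d * t * Q)) := by nlinarith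
    have h5 := le_of_mul_le_mul_left h4 ht0
    have h6 : Q - d * J - d * t * Q ≤ D := by
      have : -(d * J) ≤ d * |J| := by
        rw [← mul_neg]; exact mul_le_mul_of_nonneg_left (neg_le_abs J) (by positivity)
      have : 0 ≤ d * t * Q := by positivity
      linarith
    have h7 := mul_le_mul_of_nonneg_left h6 ht0.le
    linarith
  have : (d : ℝ) * K ≤ d * (R ^ 2 / 2 * (R ^ d * unitVol d)) :=
    mul_le_mul_of_nonneg_left hKle (by positivity)
  linarith

/-- The mean accepted displacement towards the mode is at least minus a second moment. -/
theorem drift_ge [NeZero d] {q : Eu d → ℝ} (hq : IsProposal q) {ρ : ℝ}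
    (hρ : ∀ x, ρ < ‖x‖ → q x = 0) {α : Eu d → ℝ} (hα : Measurable α) (h0 : ∀ h, 0 ≤ α h)
    (h1 : ∀ h, α h ≤ 1) (e : Eu d)
    (hmono : ∀ h : Eu d, ∀ t : ℝ, 0 ≤ t → t ≤ 1 → α h ≤ α (h + t • (e - h))) :
    -(4 * d * ∫ h, q h * ‖h‖ ^ 2) ≤ ∫ h, q h * (α h * inner ℝ h e) := by
  have hd : 0 < d := Nat.pos_of_ne_zero (NeZero.ne d)
  have hqi : ∀ {F : Eu d → ℝ} {M : ℝ}, Measurable F → (∀ h, ‖h‖ ≤ ρ → |F h| ≤ M) →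
      Integrable fun h => q h * F h := by
    intro F M hF hM
    refine (hq.integrable.const_mul M).mono' (hq.measurable.mul hF).aestronglyMeasurable
      (Filter.Eventually.of_forall fun h => ?_)
    by_cases hh : ‖h‖ ≤ ρ
    · rw [norm_mul, Real.norm_of_nonneg (hq.nonneg h), mul_comm]
      exact mul_le_mul_of_nonneg_right (hM h hh) (hq.nonneg h)
    · rw [hρ h (not_le.1 hh)]; simp
  have hin : ∀ h, |α h * inner ℝ h e| ≤ ‖h‖ * ‖e‖ := fun h => by
    rw [abs_mul, abs_of_nonneg (h0 h)]
    exact (mul_le_of_le_one_left (abs_nonneg _) (h1 h)).trans (abs_real_inner_le_norm _ _)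
  have hFm : Measurable fun h => α h * inner ℝ h e := hα.mul (by fun_prop)
  have hin' : ∀ {r : ℝ} h, ‖h‖ ≤ r → |α h * inner ℝ h e| ≤ r * ‖e‖ := fun h hh =>
    (hin h).trans (mul_le_mul_of_nonneg_right hh (norm_nonneg _))
  have i1 : Integrable fun h => q h * (α h * inner ℝ h e) := hqi hFm fun h hh => hin' h hh
  have i2 : Integrable fun h => q h * ‖h‖ ^ 2 := hqi (M := ρ ^ 2) (by fun_prop) fun h hh => by
    rw [abs_of_nonneg (by positivity)]; exact pow_le_pow_left₀ (norm_nonneg _) hh 2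
  have isq : ∀ R, IntegrableOn (fun h : Eu d => ‖h‖ ^ 2) (Metric.ball 0 R) := fun R =>
    integrableOn_ball_of_le (by fun_prop) 0 R (R ^ 2) fun h hh => by
      rw [abs_of_nonneg (by positivity)]
      exact pow_le_pow_left₀ (norm_nonneg _) (mem_ball_zero_iff.1 hh).le 2
  have iin : ∀ R, IntegrableOn (fun h => α h * inner ℝ h e) (Metric.ball 0 R) := fun R =>
    integrableOn_ball_of_le hFm 0 R (R * ‖e‖) fun h hh => hin' h (mem_ball_zero_iff.1 hh).le
  -- compare the negative part with the positive part plus a multiple of the second moment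
  have key := integral_mul_le_of_ball hq hρ
    (F := fun h => |α h * inner ℝ h e| - α h * inner ℝ h e)
    (G := fun h => 8 * d * ‖h‖ ^ 2 + (|α h * inner ℝ h e| + α h * inner ℝ h e))
    (by fun_prop) (by fun_prop)
    (fun h => by linarith [le_abs_self (α h * inner ℝ h e)])
    (fun h => by
      have : (0 : ℝ) ≤ 8 * d * ‖h‖ ^ 2 := by positivity
      linarith [neg_le_abs (α h * inner ℝ h e)])
    (fun R => (iin R).abs.sub (iin R))
    (fun R => ((isq R).const_mul _).fun_add ((iin R).abs.fun_add (iin R)))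
    (by
      have := ((i2.const_mul (8 * d)).add (i1.abs.add i1))
      refine this.congr (Filter.Eventually.of_forall fun h => ?_)
      simp only [Pi.add_apply, abs_mul (q h), abs_of_nonneg (hq.nonneg h)]
      ring)
    fun R hR _ => by
      rw [integral_sub (iin R).abs (iin R),
        integral_add ((isq R).const_mul _) ((iin R).abs.fun_add (iin R)),
        integral_add (iin R).abs (iin R), integral_const_mul]
      have h2 := drift_ball hα h0 h1 e hmono hR
      have h3 := second_moment_ball hd hR
      have h4 : ∫ h in Metric.ball 0 R, α h * inner ℝ h (e - h) ≤
          ∫ h in Metric.ball 0 R, α h * inner ℝ h e := by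
        refine integral_mono ?_ (iin R) fun h => ?_
        · refine integrableOn_ball_of_le (F := fun h => α h * inner ℝ h (e - h))
            (hα.mul (by fun_prop)) 0 R (R * (‖e‖ + R)) fun h hh => ?_
          have hh' := (mem_ball_zero_iff.1 hh).le
          rw [abs_mul, abs_of_nonneg (h0 h)]
          refine (mul_le_of_le_one_left (abs_nonneg _) (h1 h)).trans
            ((abs_real_inner_le_norm _ _).trans (mul_le_mul hh'
              ((norm_sub_le _ _).trans (by linarith)) (norm_nonneg _) hR.le))
        · simp only [inner_sub_right]
          refine mul_le_mul_of_nonneg_left ?_ (h0 h)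
          linarith [real_inner_self_nonneg (x := h)]
      have hd' : (0 : ℝ) ≤ d := by positivity
      nlinarith [mul_le_mul_of_nonneg_left h3 hd']
  have e1 : ∫ h, q h * (|α h * inner ℝ h e| - α h * inner ℝ h e) =
      (∫ h, |q h * (α h * inner ℝ h e)|) - ∫ h, q h * (α h * inner ℝ h e) := by
    rw [← integral_sub i1.abs i1]
    congr 1; funext h
    rw [abs_mul (q h), abs_of_nonneg (hq.nonneg h)]; ring
  have e2 : ∫ h, q h * (8 * d * ‖h‖ ^ 2 + (|α h * inner ℝ h e| + α h * inner ℝ h e)) =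
      8 * d * (∫ h, q h * ‖h‖ ^ 2) + ((∫ h, |q h * (α h * inner ℝ h e)|) +
        ∫ h, q h * (α h * inner ℝ h e)) := by
    rw [← integral_const_mul, ← integral_add i1.abs i1,
      ← integral_add (i2.const_mul _) (i1.abs.fun_add i1)]
    congr 1; funext h
    simp only [abs_mul (q h), abs_of_nonneg (hq.nonneg h)]; ring
  rw [e1, e2] at key
  linarith

end drift

/-! ### The chain near the mode -/

/-- The target near its mode `m`: `w` is a weight supported on the convex set `Θ`, at most `P`, and
at least `15 / 16 P` on the part of `Θ` within distance `2 ε` of `m`, where `Θ` contains the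
`ε`-ball. -/
structure FlatMode {d : ℕ} (w : Eu d → ℝ) (Θ : Set (Eu d)) (m : Eu d) (ε P : ℝ) : Prop where
  weight : IsWeight w
  convex : Convex ℝ Θ
  eps_pos : 0 < ε
  max_pos : 0 < P
  ball_subset : Metric.closedBall m ε ⊆ Θ
  zero_off : ∀ x, x ∉ Θ → w x = 0
  le_max : ∀ x, w x ≤ P
  flat : ∀ x ∈ Θ, ‖x - m‖ ≤ 2 * ε → 15 / 16 * P ≤ w x

/-- The flat region: the part of `Θ` within distance `3 / 2 ε` of the mode. -/
def flatRegion {d : ℕ} (Θ : Set (Eu d)) (m : Eu d) (ε : ℝ) : Set (Eu d) :=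
  Θ ∩ Metric.closedBall m (3 / 2 * ε)

/-- The target cut off to the flat region. -/
noncomputable def flatWeight {d : ℕ} (w : Eu d → ℝ) (m : Eu d) (ε : ℝ) : Eu d → ℝ :=
  (Metric.closedBall m (3 / 2 * ε)).indicator w

section flat

variable {d : ℕ} {w : Eu d → ℝ} {Θ : Set (Eu d)} {m : Eu d} {ε P : ℝ}

theorem isWeight_flatWeight (hw : IsWeight w) (m : Eu d) (ε : ℝ) :
    IsWeight (flatWeight w m ε) where
  measurable := hw.measurable.indicator Metric.isClosed_closedBall.measurableSet
  nonneg x := indicator_nonneg (fun x _ => hw.nonneg x) x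
  integrable := hw.integrable.indicator Metric.isClosed_closedBall.measurableSet
  quasiconcave x y t ht0 ht1 := by
    unfold flatWeight
    by_cases hx : x ∈ Metric.closedBall m (3 / 2 * ε)
    · by_cases hy : y ∈ Metric.closedBall m (3 / 2 * ε)
      · have hz : x + t • (y - x) ∈ Metric.closedBall m (3 / 2 * ε) :=
          (convex_closedBall m _).add_smul_sub_mem hx hy ⟨ht0, ht1⟩
        rw [indicator_of_mem hx, indicator_of_mem hy, indicator_of_mem hz]
        exact hw.quasiconcave x y t ht0 ht1
      · rw [indicator_of_notMem hy]
        exact (min_le_right _ _).trans (indicator_nonneg (fun x _ => hw.nonneg x) _)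
    · rw [indicator_of_notMem hx]
      exact (min_le_left _ _).trans (indicator_nonneg (fun x _ => hw.nonneg x) _)

theorem flatWeight_eq {x : Eu d} (hx : x ∈ flatRegion Θ m ε) : flatWeight w m ε x = w x :=
  indicator_of_mem hx.2 _

namespace FlatMode

theorem flatWeight_zero (h : FlatMode w Θ m ε P) {x : Eu d} (hx : x ∉ flatRegion Θ m ε) :
    flatWeight w m ε x = 0 := by
  unfold flatWeight
  by_cases h1 : x ∈ Metric.closedBall m (3 / 2 * ε)
  · rw [indicator_of_mem h1]
    exact h.zero_off x fun h2 => hx ⟨h2, h1⟩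
  · exact indicator_of_notMem h1 _

theorem le_weight (h : FlatMode w Θ m ε P) {x : Eu d} (hx : x ∈ flatRegion Θ m ε) :
    15 / 16 * P ≤ w x := by
  refine h.flat x hx.1 ?_
  have := hx.2
  rw [mem_closedBall_iff_norm] at this
  linarith [h.eps_pos]

theorem le_flatWeight (h : FlatMode w Θ m ε P) {x : Eu d} (hx : x ∈ flatRegion Θ m ε) :
    15 / 16 * P ≤ flatWeight w m ε x := by
  rw [flatWeight_eq hx]; exact h.le_weight hx

theorem flatWeight_le (h : FlatMode w Θ m ε P) (x : Eu d) : flatWeight w m ε x ≤ P := by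
  by_cases hx : x ∈ flatRegion Θ m ε
  · rw [flatWeight_eq hx]; exact h.le_max x
  · rw [h.flatWeight_zero hx]; exact h.max_pos.le

theorem mem_of_accept_ne_zero (h : FlatMode w Θ m ε P) {y k : Eu d}
    (hy : accept (flatWeight w m ε) y k ≠ 0) : y + k ∈ flatRegion Θ m ε := by
  by_contra hc
  refine hy ?_
  rw [accept, h.flatWeight_zero hc, zero_div]
  exact min_eq_right zero_le_one

/-- The part of the flat region within distance `R` of one of its points contains a ball of radius
`2 / 5 R`: shrink the `ε`-ball around the mode towards the point. -/
theorem exists_ball (h : FlatMode w Θ m ε P) {y : Eu d} (hy : y ∈ flatRegion Θ m ε) {R : ℝ}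
    (hR : 0 < R) (hRε : R ≤ 5 / 2 * ε) :
    ∃ c : Eu d, Metric.ball c (2 / 5 * R) ⊆ Metric.ball 0 R ∧
      ∀ k ∈ Metric.ball c (2 / 5 * R), y + k ∈ flatRegion Θ m ε := by
  have hε := h.eps_pos
  set l := R / (5 / 2 * ε) with hl
  have hl0 : 0 < l := by positivity
  have hl1 : l ≤ 1 := (div_le_one (by positivity)).2 hRε
  have hlε : l * ε = 2 / 5 * R := by rw [hl]; field_simp
  have hym : ‖y - m‖ ≤ 3 / 2 * ε := mem_closedBall_iff_norm.1 hy.2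
  refine ⟨l • (m - y), fun k hk => ?_, fun k hk => ?_⟩
  · rw [mem_ball_iff_norm] at hk
    rw [mem_ball_zero_iff]
    have h1 : ‖l • (m - y)‖ ≤ 3 / 5 * R := by
      rw [norm_smul, Real.norm_of_nonneg hl0.le, norm_sub_rev]
      have := mul_le_mul_of_nonneg_left hym hl0.le
      linarith
    have h2 := norm_add_le (k - l • (m - y)) (l • (m - y))
    rw [sub_add_cancel] at h2
    linarith
  · rw [mem_ball_iff_norm] at hk
    set u := m + l⁻¹ • (k - l • (m - y)) with hu
    have hum : ‖u - m‖ ≤ ε := by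
      rw [hu, add_sub_cancel_left, norm_smul, norm_inv, Real.norm_of_nonneg hl0.le,
        inv_mul_le_iff₀ hl0]
      linarith
    have hyk : y + k = y + l • (u - y) := by
      rw [hu, add_sub_right_comm, smul_add, smul_smul, mul_inv_cancel₀ hl0.ne', one_smul]
      abel
    rw [hyk]
    refine ⟨h.convex.add_smul_sub_mem hy.1 (h.ball_subset (mem_closedBall_iff_norm.2 hum))
      ⟨hl0.le, hl1⟩, (convex_closedBall m _).add_smul_sub_mem hy.2
      (mem_closedBall_iff_norm.2 (by linarith)) ⟨hl0.le, hl1⟩⟩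

theorem le_accept (h : FlatMode w Θ m ε P) {y k : Eu d} (hy : y ∈ flatRegion Θ m ε)
    (hk : y + k ∈ flatRegion Θ m ε) : 15 / 16 ≤ accept (flatWeight w m ε) y k := by
  have h1 := h.le_flatWeight hy
  have h2 := h.le_flatWeight hk
  have h3 := h.flatWeight_le y
  have hP := h.max_pos
  refine le_min (by norm_num) ?_
  rw [le_div_iff₀ (by linarith)]
  nlinarith

/-- From a point of the flat region, a proposal of scale at most `ε` is accepted with probability
at least `15 / 16 (2 / 5) ^ d`. -/
theorem acceptance_ge [NeZero d] (h : FlatMode w Θ m ε P) {q : Eu d → ℝ} (hq : IsProposal q)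
    {ρ : ℝ} (hρ : ∀ x, ρ < ‖x‖ → q x = 0) (hρε : ρ ≤ 5 / 2 * ε) {y : Eu d}
    (hy : y ∈ flatRegion Θ m ε) :
    15 / 16 * (2 / 5) ^ d * ∫ k, q k ≤ ∫ k, q k * accept (flatWeight w m ε) y k := by
  have hw := isWeight_flatWeight h.weight m ε
  have hacc : ∀ R, IntegrableOn (fun k => accept (flatWeight w m ε) y k) (Metric.ball 0 R) :=
    fun R => integrableOn_ball_of_le (measurable_accept_right hw y) 0 R 1 fun k _ => by
      rw [abs_of_nonneg (accept_nonneg hw y k)]; exact accept_le_one y k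
  rw [← integral_const_mul]
  simp only [mul_comm _ (q _)]
  refine integral_mul_le_of_ball hq hρ measurable_const (measurable_accept_right hw y)
    (fun _ => by positivity) (accept_nonneg hw y)
    (fun R => integrableOn_const measure_ball_lt_top.ne) hacc (integrable_rate hw hq y) ?_
  intro R hR hRρ
  obtain ⟨c, hc1, hc2⟩ := h.exists_ball hy hR (hRρ.trans hρε)
  calc ∫ _ in Metric.ball (0 : Eu d) R, (15 / 16 * (2 / 5) ^ d : ℝ)
      = ∫ _ in Metric.ball c (2 / 5 * R), (15 / 16 : ℝ) := by
        simp only [setIntegral_const, smul_eq_mul]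
        rw [volume_real_ball _ hR, volume_real_ball _ (by positivity), mul_pow]; ring
    _ ≤ ∫ k in Metric.ball c (2 / 5 * R), accept (flatWeight w m ε) y k :=
        setIntegral_mono_on (integrableOn_const measure_ball_lt_top.ne) ((hacc R).mono_set hc1)
          Metric.isOpen_ball.measurableSet fun k hk => h.le_accept hy (hc2 k hk)
    _ ≤ _ := setIntegral_mono_set (hacc R)
        (Filter.Eventually.of_forall fun k => accept_nonneg hw y k) hc1.eventuallyLE

end FlatMode

/-! ### A Nash inequality on the flat region -/

/-- `ballIncr` with the order of integration exchanged. -/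
theorem integral_overlap_ball {f : Eu d → ℝ} (hw : IsWeight w) (hf : IsBdd f) (R : ℝ) :
    Integrable (fun x => ∫ h in Metric.ball 0 R, overlap w x h * (f (x + h) - f x) ^ 2) ∧
    ∫ x, ∫ h in Metric.ball 0 R, overlap w x h * (f (x + h) - f x) ^ 2 = ballIncr w f R := by
  obtain ⟨M, hM0, hM⟩ := hf.exists_bound
  have i0 : Integrable (fun z : Eu d × Eu d => w z.1 * (2 * M) ^ 2)
      (volume.prod (volume.restrict (Metric.ball 0 R))) := by
    have : IsFiniteMeasure (volume.restrict (Metric.ball (0 : Eu d) R)) :=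
      ⟨by rw [Measure.restrict_apply_univ]; exact measure_ball_lt_top⟩
    exact hw.integrable.mul_prod (integrable_const _)
  have i1 : Integrable (fun z : Eu d × Eu d => overlap w z.1 z.2 * (f (z.1 + z.2) - f z.1) ^ 2)
      (volume.prod (volume.restrict (Metric.ball 0 R))) := by
    refine i0.mono' (hw.measurable_overlap.mul (((measurable_add_fst_snd hf.1).sub
      (hf.1.comp measurable_fst)).pow_const 2)).aestronglyMeasurable
      (Filter.Eventually.of_forall fun z => ?_)
    rw [Real.norm_of_nonneg (mul_nonneg (overlap_nonneg hw _ _) (sq_nonneg _))]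
    refine mul_le_mul (overlap_le _ _) ?_ (sq_nonneg _) (hw.nonneg _)
    rw [← sq_abs]
    exact pow_le_pow_left₀ (abs_nonneg _) ((abs_sub _ _).trans (by linarith [hM (z.1 + z.2), hM z.1])) 2
  exact ⟨i1.integral_prod_left, integral_integral_swap i1⟩

/-- Nash inequality: on the flat region, the square norm of a function of mass at most `1` is
bounded by its increments at a scale `s` and by the inverse volume of a ball of radius
`2 / 5 s`: each point `x` is compared with the average over such a ball within distance `s` of it. -/
theorem FlatMode.nash (h : FlatMode w Θ m ε P) {f : Eu d → ℝ} (hf : IsBdd f)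
    (hf0 : ∀ x, 0 ≤ f x) (hf1 : ∫ x, f x * flatWeight w m ε x ≤ 1) {s : ℝ} (hs : 0 < s)
    (hsε : s ≤ 5 / 2 * ε) :
    (2 / 5 * s) ^ d * unitVol d * ∫ x, f x * f x * flatWeight w m ε x ≤
      16 / 15 * ballIncr (flatWeight w m ε) f s + 32 / 15 / P := by
  set wF := flatWeight w m ε with hwF
  have hw : IsWeight wF := isWeight_flatWeight h.weight m ε
  have hP := h.max_pos
  obtain ⟨M, hM0, hM⟩ := hf.exists_bound
  obtain ⟨i1, e1⟩ := integral_overlap_ball hw hf s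
  have ifw : Integrable fun x => f x * wF x := hf.integrable_mul hw.integrable
  have pt : ∀ x, (2 / 5 * s) ^ d * unitVol d * (f x * f x * wF x) ≤
      16 / 15 * (∫ h in Metric.ball 0 s, overlap wF x h * (f (x + h) - f x) ^ 2) +
        32 / 15 / P * (f x * wF x) := by
    intro x
    by_cases hx : x ∈ flatRegion Θ m ε
    swap
    · rw [hwF, h.flatWeight_zero hx, mul_zero, mul_zero, mul_zero, mul_zero, add_zero]
      exact mul_nonneg (by norm_num) (integral_nonneg fun k =>
        mul_nonneg (overlap_nonneg hw _ _) (sq_nonneg _))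
    obtain ⟨c, hc1, hc2⟩ := h.exists_ball hx hs hsε
    set A := Metric.ball c (2 / 5 * s) with hA
    have hAm : MeasurableSet A := Metric.isOpen_ball.measurableSet
    have j1 : IntegrableOn (fun k => overlap wF x k * (f (x + k) - f x) ^ 2) (Metric.ball 0 s) := by
      refine integrableOn_ball_of_le ((hw.measurable_overlap.comp measurable_prodMk_left).mul
        (((hf.shift_left x).1.sub_const _).pow_const 2)) 0 s (P * (2 * M) ^ 2) fun k _ => ?_
      change |overlap wF x k * (f (x + k) - f x) ^ 2| ≤ _
      rw [abs_of_nonneg (mul_nonneg (overlap_nonneg hw _ _) (sq_nonneg _))]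
      refine mul_le_mul ((overlap_le _ _).trans (h.flatWeight_le x)) ?_ (sq_nonneg _) hP.le
      rw [← sq_abs]
      exact pow_le_pow_left₀ (abs_nonneg _)
        ((abs_sub _ _).trans (by linarith [hM (x + k), hM x])) 2
    have j2 : Integrable fun k => f (x + k) * wF (x + k) := ifw.comp_add_left x
    have e2 : ∫ k, f (x + k) * wF (x + k) = ∫ y, f y * wF y :=
      integral_add_left_eq_self (fun y => f y * wF y) x
    calc (2 / 5 * s) ^ d * unitVol d * (f x * f x * wF x)
        = ∫ k in A, f x * f x * wF x := by
          rw [setIntegral_const, smul_eq_mul, hA, volume_real_ball _ (by positivity)]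
      _ ≤ ∫ k in A, (16 / 15 * (overlap wF x k * (f (x + k) - f x) ^ 2) +
            32 / 15 / P * (f x * wF x) * (f (x + k) * wF (x + k))) := by
          refine setIntegral_mono_on (integrableOn_const measure_ball_lt_top.ne)
            (((j1.mono_set hc1).const_mul _).add ((j2.const_mul _).integrableOn)) hAm
            fun k hk => ?_
          have hk' := hc2 k hk
          have w1 := h.le_flatWeight hx
          have w2 := h.le_flatWeight hk'
          have w3 := h.flatWeight_le x
          have w4 := h.flatWeight_le (x + k)
          rw [← hwF] at w1 w2 w3 w4
          have o1 : wF x ≤ 16 / 15 * overlap wF x k := by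
            have : 15 / 16 * wF x ≤ overlap wF x k := le_min (by linarith) (by linarith)
            linarith
          have o2 : 1 ≤ 16 / 15 / P * wF (x + k) := by
            rw [div_mul_eq_mul_div, le_div_iff₀ hP]; linarith
          have hx0 : 0 ≤ f x * wF x * f (x + k) :=
            mul_nonneg (mul_nonneg (hf0 x) (hw.nonneg x)) (hf0 _)
          calc f x * f x * wF x ≤ wF x * (f (x + k) - f x) ^ 2 + 2 * (f x * wF x * f (x + k)) := by
                nlinarith [mul_nonneg (hw.nonneg x) (sq_nonneg (f (x + k)))]
            _ ≤ 16 / 15 * overlap wF x k * (f (x + k) - f x) ^ 2 +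
                2 * ((f x * wF x * f (x + k)) * (16 / 15 / P * wF (x + k))) :=
                add_le_add (mul_le_mul_of_nonneg_right o1 (sq_nonneg _))
                  (mul_le_mul_of_nonneg_left (le_mul_of_one_le_right hx0 o2) (by norm_num))
            _ = _ := by ring
      _ = 16 / 15 * (∫ k in A, overlap wF x k * (f (x + k) - f x) ^ 2) +
            32 / 15 / P * (f x * wF x) * ∫ k in A, f (x + k) * wF (x + k) := by
          rw [integral_add ((j1.mono_set hc1).const_mul _) ((j2.const_mul _).integrableOn),
            integral_const_mul, integral_const_mul]
      _ ≤ _ := by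
          refine add_le_add (mul_le_mul_of_nonneg_left ?_ (by norm_num)) ?_
          · exact setIntegral_mono_set j1 (Filter.Eventually.of_forall fun k =>
              mul_nonneg (overlap_nonneg hw _ _) (sq_nonneg _)) hc1.eventuallyLE
          · have h2 : ∫ k in A, f (x + k) * wF (x + k) ≤ 1 := by
              refine (setIntegral_le_integral j2 (Filter.Eventually.of_forall fun k =>
                mul_nonneg (hf0 _) (hw.nonneg _))).trans ?_
              rw [e2]; exact hf1
            exact mul_le_of_le_one_right (mul_nonneg (by positivity)
              (mul_nonneg (hf0 x) (hw.nonneg x))) h2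
  have := integral_mono (((hf.mul hf).integrable_mul hw.integrable).const_mul
    ((2 / 5 * s) ^ d * unitVol d)) ((i1.const_mul (16 / 15)).fun_add (ifw.const_mul (32 / 15 / P))) pt
  rw [integral_const_mul, integral_add (i1.const_mul _) (ifw.const_mul _), integral_const_mul,
    integral_const_mul, e1] at this
  refine this.trans (add_le_add le_rfl (mul_le_of_le_one_right (by positivity) hf1))

/-- A proposal of second moment `v` and scale at most `s` has a Dirichlet form at least `v / s²`
times the one of the uniform proposal on the `s`-ball, up to constants. -/
theorem second_moment_mul_ballIncr_le [NeZero d] (hw : IsWeight w) {q f : Eu d → ℝ}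
    (hq : IsProposal q) (hf : IsBdd f) {s : ℝ} (hs : 0 < s) (hqs : ∀ x, s < ‖x‖ → q x = 0) :
    (∫ h, q h * ‖h‖ ^ 2) * ballIncr w f s ≤
      unitVol d * (2 * s) ^ (d + 2) * ∫ h, q h * incr w f h := by
  have hω := unitVol_pos d
  have hb0 := ballIncr_nonneg hw f s
  set c := ballIncr w f s / (unitVol d * (2 * s) ^ (d + 2)) with hc
  have hc0 : 0 ≤ c := by positivity
  have key := integral_mul_le_of_ball hq hqs (F := fun h => c * ‖h‖ ^ 2) (G := incr w f)
    (by fun_prop) (isBdd_incr hw hf).1 (fun h => by positivity) (incr_nonneg hw f)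
    (fun R => integrableOn_ball_of_le (by fun_prop) 0 R (c * R ^ 2) fun h hh => by
      rw [abs_of_nonneg (by positivity)]
      exact mul_le_mul_of_nonneg_left
        (pow_le_pow_left₀ (norm_nonneg _) (mem_ball_zero_iff.1 hh).le 2) hc0)
    (integrableOn_incr hw hf) (integrable_proposal_mul hq (isBdd_incr hw hf)) fun R hR hRs => by
      calc ∫ h in Metric.ball (0 : Eu d) R, c * ‖h‖ ^ 2
          ≤ ∫ h in Metric.ball (0 : Eu d) R, c * R ^ 2 := by
            refine setIntegral_mono_on (integrableOn_ball_of_le (by fun_prop) 0 R (c * R ^ 2)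
              fun h hh => ?_) (integrableOn_const measure_ball_lt_top.ne)
              Metric.isOpen_ball.measurableSet fun h hh => ?_
            · rw [abs_of_nonneg (by positivity)]
              exact mul_le_mul_of_nonneg_left
                (pow_le_pow_left₀ (norm_nonneg _) (mem_ball_zero_iff.1 hh).le 2) hc0
            · exact mul_le_mul_of_nonneg_left
                (pow_le_pow_left₀ (norm_nonneg _) (mem_ball_zero_iff.1 hh).le 2) hc0
        _ = (R / (2 * s)) ^ (d + 2) * ballIncr w f s := by
            rw [setIntegral_const, smul_eq_mul, volume_real_ball _ hR, hc, div_pow]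
            field_simp
            ring
        _ ≤ (R / (2 * s)) ^ (d + 2) * ((2 * s / R) ^ (d + 2) * ballIncr w f R) :=
            mul_le_mul_of_nonneg_left (ballIncr_le_of_le hw hf hR hRs) (by positivity)
        _ = ballIncr w f R := by
            rw [← mul_assoc, ← mul_pow]
            have : R / (2 * s) * (2 * s / R) = 1 := by field_simp
            rw [this, one_pow, one_mul]
  have e : ∫ h, q h * (c * ‖h‖ ^ 2) = c * ∫ h, q h * ‖h‖ ^ 2 := by
    rw [← integral_const_mul]; congr 1; funext h; ring
  rw [e, hc, div_mul_eq_mul_div, div_le_iff₀ (by positivity)] at key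
  linarith

end flat

/-! ### Decay of the square norm from small scales -/

section iterate

variable {d : ℕ} {w q : Eu d → ℝ}

theorem isBdd_iterate (hw : IsWeight w) (hq : IsProposal q) {g : Eu d → ℝ} (hg : IsBdd g) (n : ℕ) :
    IsBdd ((mhOp w q)^[n] g) := by
  induction n with
  | zero => exact hg
  | succ n ih => rw [Function.iterate_succ_apply']; exact mhOp_mem hw hq ih

theorem coe_mhLin_pow (hw : IsWeight w) (hq : IsProposal q) (f : bddMeas d) (n : ℕ) :
    ((mhLin hw hq ^ n) f).1 = (mhOp w q)^[n] f.1 := by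
  induction n with
  | zero => rfl
  | succ n ih =>
    rw [Function.iterate_succ_apply', ← ih, pow_succ']
    rfl

theorem mhOp_nonneg (hw : IsWeight w) (hq : IsProposal q) {g : Eu d → ℝ} (hg : IsBdd g)
    (h0 : ∀ x, 0 ≤ g x) (x : Eu d) : 0 ≤ mhOp w q g x := by
  have := mhOp_mono hw hq (IsBdd.const 0) hg x h0
  rwa [mhOp_const] at this

theorem mhOp_le_const (hw : IsWeight w) (hq : IsProposal q) {g : Eu d → ℝ} (hg : IsBdd g) {c : ℝ}
    (h0 : ∀ x, g x ≤ c) (x : Eu d) : mhOp w q g x ≤ c := by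
  have := mhOp_mono hw hq hg (IsBdd.const c) x h0
  rwa [mhOp_const] at this

theorem iterate_nonneg (hw : IsWeight w) (hq : IsProposal q) {g : Eu d → ℝ} (hg : IsBdd g)
    (h0 : ∀ x, 0 ≤ g x) (n : ℕ) : ∀ x, 0 ≤ (mhOp w q)^[n] g x := by
  induction n with
  | zero => exact h0
  | succ n ih =>
    intro x
    rw [Function.iterate_succ_apply']
    exact mhOp_nonneg hw hq (isBdd_iterate hw hq hg n) ih x

theorem iterate_le (hw : IsWeight w) (hq : IsProposal q) {g : Eu d → ℝ} (hg : IsBdd g) {c : ℝ}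
    (h0 : ∀ x, g x ≤ c) (n : ℕ) : ∀ x, (mhOp w q)^[n] g x ≤ c := by
  induction n with
  | zero => exact h0
  | succ n ih =>
    intro x
    rw [Function.iterate_succ_apply']
    exact mhOp_le_const hw hq (isBdd_iterate hw hq hg n) ih x

theorem integral_iterate_mul (hw : IsWeight w) (hq : IsProposal q) {g : Eu d → ℝ} (hg : IsBdd g)
    (n : ℕ) : ∫ x, (mhOp w q)^[n] g x * w x = ∫ x, g x * w x := by
  induction n with
  | zero => rfl
  | succ n ih =>
    rw [Function.iterate_succ_apply', integral_mhOp_mul hw hq (isBdd_iterate hw hq hg n), ih]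

theorem wInner_pow_symm (hw : IsWeight w) (hq : IsProposal q) (f g : bddMeas d) (n : ℕ) :
    wInner hw f ((mhLin hw hq ^ n) g) = wInner hw ((mhLin hw hq ^ n) f) g := by
  induction n generalizing f with
  | zero => rfl
  | succ n ih =>
    have e1 : (mhLin hw hq ^ (n + 1)) g = mhLin hw hq ((mhLin hw hq ^ n) g) := by
      rw [pow_succ']; rfl
    have e2 : (mhLin hw hq ^ (n + 1)) f = (mhLin hw hq ^ n) (mhLin hw hq f) := by
      rw [pow_succ]; rfl
    rw [e1, e2, wInner_mhLin_symm, ih]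

end iterate

/-- `(1 + k / S) ^ (d / 2) (1 - k d / (S + k)) ≤ 1`, the comparison of one step of the decay with the
solution `S ^ (- d / 2)` of the differential inequality. -/
theorem sqrt_pow_step {d : ℕ} {S k : ℝ} (hS : 0 < S) (hk : 0 ≤ k) (hkS : k ≤ S) :
    Real.sqrt (S + k) ^ d * (1 - d * k / (S + k)) ≤ Real.sqrt S ^ d := by
  have h1 : Real.sqrt (S + k) ≤ Real.sqrt S * Real.exp (k / (2 * S)) := by
    refine Real.sqrt_le_iff.2 ⟨by positivity, ?_⟩
    rw [mul_pow, Real.sq_sqrt hS.le, ← Real.exp_nat_mul]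
    have := Real.add_one_le_exp (k / S)
    have e : ((2 : ℕ) : ℝ) * (k / (2 * S)) = k / S := by push_cast; field_simp
    rw [e]
    calc S + k = S * (k / S + 1) := by field_simp; ring
      _ ≤ _ := mul_le_mul_of_nonneg_left this hS.le
  have h2 : 1 - d * k / (S + k) ≤ Real.exp (-(d * k / (S + k))) := by
    have := Real.add_one_le_exp (-(d * k / (S + k))); linarith
  have h3 : (d : ℝ) * (k / (2 * S)) ≤ d * k / (S + k) := by
    rw [← mul_div_assoc]
    exact div_le_div_of_nonneg_left (by positivity) (by linarith) (by linarith)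
  calc Real.sqrt (S + k) ^ d * (1 - d * k / (S + k))
      ≤ Real.sqrt (S + k) ^ d * Real.exp (-(d * k / (S + k))) :=
        mul_le_mul_of_nonneg_left h2 (by positivity)
    _ ≤ (Real.sqrt S * Real.exp (k / (2 * S))) ^ d * Real.exp (-(d * k / (S + k))) :=
        mul_le_mul_of_nonneg_right (pow_le_pow_left₀ (Real.sqrt_nonneg _) h1 _) (Real.exp_pos _).le
    _ = Real.sqrt S ^ d * Real.exp (d * (k / (2 * S)) - d * k / (S + k)) := by
        rw [mul_pow, ← Real.exp_nat_mul, mul_assoc, ← Real.exp_add, sub_eq_add_neg]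
    _ ≤ Real.sqrt S ^ d * 1 := by
        refine mul_le_mul_of_nonneg_left (Real.exp_le_one_iff.2 (by linarith)) (by positivity)
    _ = _ := mul_one _

section nash

variable {d : ℕ} {w : Eu d → ℝ} {Θ : Set (Eu d)} {m : Eu d} {ε P : ℝ}

/-- The constant of the bound `nashConst * s ^ (-d)` for the square norm of a density that is spread
out at scale `s`. -/
noncomputable def nashConst (d : ℕ) (P : ℝ) : ℝ := 5 * (5 / 2) ^ d / (unitVol d * P)

/-- One step of the decay of the square norm, as long as it exceeds `nashConst * s ^ (-d)`. The
moves `q₄` of length at most `s`, a part of the proposal, already cause it. -/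
theorem FlatMode.sq_norm_step [NeZero d] (h : FlatMode w Θ m ε P)
    {q q₄ : Eu d → ℝ} (hq : IsProposal q) (hq₄ : IsProposal q₄) (hle : ∀ x, q₄ x ≤ q x)
    {v s : ℝ} (hv : v ≤ 2 * ∫ k, q₄ k * ‖k‖ ^ 2) (hs : 0 < s) (hsε : s ≤ 5 / 2 * ε)
    (hsupp : ∀ x, s < ‖x‖ → q₄ x = 0) (f : bddMeas d) (hf0 : ∀ x, 0 ≤ f.1 x)
    (hf1 : ∫ x, f.1 x * flatWeight w m ε x ≤ 1)
    (hbig : nashConst d P ≤ wInner (isWeight_flatWeight h.weight m ε) f f * s ^ d) :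
    wInner (isWeight_flatWeight h.weight m ε)
        (mhLin (isWeight_flatWeight h.weight m ε) hq f)
        (mhLin (isWeight_flatWeight h.weight m ε) hq f) ≤
      wInner (isWeight_flatWeight h.weight m ε) f f * (1 - v / (192 * 10 ^ d * s ^ 2)) := by
  set hw := isWeight_flatWeight h.weight m ε with hhw
  set N := wInner hw f f with hN
  have hω := unitVol_pos d
  have hP := h.max_pos
  have hN0 : 0 ≤ N := wInner_self_nonneg hw f
  have h1 := h.nash (isBdd_coe f) hf0 hf1 hs hsε
  have h2 := second_moment_mul_ballIncr_le hw hq₄ (isBdd_coe f) hs hsupp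
  have h3 := wInner_mhLin_self_le hw hq f
  have h4 : ∫ k, q₄ k * incr (flatWeight w m ε) f.1 k ≤ ∫ k, q k * incr (flatWeight w m ε) f.1 k :=
    integral_mono (integrable_proposal_mul hq₄ (isBdd_incr hw (isBdd_coe f)))
      (integrable_proposal_mul hq (isBdd_incr hw (isBdd_coe f))) fun k =>
        mul_le_mul_of_nonneg_right (hle k) (incr_nonneg hw _ k)
  set b := ballIncr (flatWeight w m ε) f.1 s with hb
  set D := ∫ k, q k * incr (flatWeight w m ε) f.1 k with hD
  have hb0 : 0 ≤ b := ballIncr_nonneg hw _ _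
  have e1 : (∫ x, f.1 x * f.1 x * flatWeight w m ε x) = N := rfl
  rw [e1] at h1
  -- the `L¹` term in the Nash inequality is absorbed
  have h5 : 32 / 15 / P ≤ 32 / 75 * ((2 / 5 * s) ^ d * unitVol d * N) := by
    have : 5 / P ≤ (2 / 5 * s) ^ d * unitVol d * N := by
      have h6 := mul_le_mul_of_nonneg_left hbig (by positivity : 0 ≤ (2 / 5 : ℝ) ^ d * unitVol d)
      have e2 : (2 / 5 : ℝ) ^ d * unitVol d * nashConst d P = 5 / P := by
        rw [nashConst]
        have : (2 / 5 : ℝ) ^ d * (5 / 2) ^ d = 1 := by rw [← mul_pow]; norm_num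
        calc (2 / 5 : ℝ) ^ d * unitVol d * (5 * (5 / 2) ^ d / (unitVol d * P))
            = ((2 / 5 : ℝ) ^ d * (5 / 2) ^ d) * (5 / P) := by field_simp
          _ = 5 / P := by rw [this, one_mul]
      rw [e2] at h6
      refine h6.trans (le_of_eq ?_)
      rw [mul_pow]; ring
    have e3 : 32 / 15 / P = 32 / 75 * (5 / P) := by ring
    rw [e3]
    exact mul_le_mul_of_nonneg_left this (by norm_num)
  have h6 : (2 / 5 * s) ^ d * unitVol d * N ≤ 2 * b := by
    have : 0 ≤ (2 / 5 * s) ^ d * unitVol d * N := by positivity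
    linarith
  have h7 : v * b ≤ 2 * (unitVol d * (2 * s) ^ (d + 2) * D) := by
    have h8 := mul_le_mul_of_nonneg_right hv hb0
    have h9 := mul_le_mul_of_nonneg_left h4
      (by positivity : 0 ≤ unitVol d * (2 * s) ^ (d + 2))
    linarith
  rcases le_or_gt v 0 with hv0 | hv0
  · have hD0 : 0 ≤ D := integral_incr_nonneg hw hq _
    have : 0 ≤ 1 / (12 * 2 ^ d) * D := by positivity
    have : v / (192 * 10 ^ d * s ^ 2) ≤ 0 := div_nonpos_of_nonpos_of_nonneg hv0 (by positivity)
    nlinarith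
  have h8 : v * N ≤ 16 * 5 ^ d * s ^ 2 * D := by
    have h9 : v * ((2 / 5 * s) ^ d * unitVol d * N) ≤
        2 * (2 * (unitVol d * (2 * s) ^ (d + 2) * D)) := by
      have := mul_le_mul_of_nonneg_left h6 hv0.le
      linarith
    have hpos : 0 < (2 / 5 * s) ^ d * unitVol d := by positivity
    refine le_of_mul_le_mul_left ?_ hpos
    calc (2 / 5 * s) ^ d * unitVol d * (v * N) = v * ((2 / 5 * s) ^ d * unitVol d * N) := by ring
      _ ≤ _ := h9
      _ = 16 * (2 * s) ^ d * unitVol d * s ^ 2 * D := by rw [pow_add]; ring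
      _ = (2 / 5 * s) ^ d * unitVol d * (16 * 5 ^ d * s ^ 2 * D) := by
          have : (2 * s) ^ d = (2 / 5 * s) ^ d * 5 ^ d := by rw [← mul_pow]; congr 1; ring
          rw [this]; ring
  refine h3.trans ?_
  have h9 : N * (v / (192 * 10 ^ d * s ^ 2)) ≤ 1 / (12 * 2 ^ d) * D := by
    have e10 : (10 : ℝ) ^ d = 2 ^ d * 5 ^ d := by rw [← mul_pow]; norm_num
    rw [e10, mul_div_assoc', div_le_iff₀ (by positivity)]
    calc N * v = v * N := mul_comm _ _
      _ ≤ _ := h8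
      _ = 1 / (12 * 2 ^ d) * D * (192 * (2 ^ d * 5 ^ d) * s ^ 2) := by field_simp; ring
  linarith

/-- Decay of the square norm: after `t` steps a density that is initially spread out at scale `s₁`
is spread out at scale `√(s₁² + k t)`. -/
theorem FlatMode.sq_norm_decay [NeZero d] (h : FlatMode w Θ m ε P)
    {q q₄ : Eu d → ℝ} (hq : IsProposal q) (hq₄ : IsProposal q₄) (hle : ∀ x, q₄ x ≤ q x)
    {v s₁ : ℝ} (hv0 : 0 ≤ v) (hv : v ≤ 2 * ∫ k, q₄ k * ‖k‖ ^ 2) (hs : 0 < s₁)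
    (hsupp : ∀ x, s₁ < ‖x‖ → q₄ x = 0) (f : bddMeas d) (hf0 : ∀ x, 0 ≤ f.1 x)
    (hf1 : ∫ x, f.1 x * flatWeight w m ε x ≤ 1)
    (hbig : wInner (isWeight_flatWeight h.weight m ε) f f * s₁ ^ d ≤ nashConst d P) (t : ℕ)
    (ht : s₁ ^ 2 + v / (192 * 10 ^ d * d) * t ≤ (5 / 2 * ε) ^ 2) :
    wInner (isWeight_flatWeight h.weight m ε)
        ((mhLin (isWeight_flatWeight h.weight m ε) hq ^ t) f)
        ((mhLin (isWeight_flatWeight h.weight m ε) hq ^ t) f) *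
      Real.sqrt (s₁ ^ 2 + v / (192 * 10 ^ d * d) * t) ^ d ≤ nashConst d P := by
  set hw := isWeight_flatWeight h.weight m ε with hhw
  have hd : 0 < (d : ℝ) := by exact_mod_cast Nat.pos_of_ne_zero (NeZero.ne d)
  have hε := h.eps_pos
  set κ := v / (192 * 10 ^ d * d) with hκ
  have hκ0 : 0 ≤ κ := by positivity
  have hκs : κ ≤ s₁ ^ 2 := by
    have h1 : ∫ k, q₄ k * ‖k‖ ^ 2 ≤ s₁ ^ 2 := by
      calc ∫ k, q₄ k * ‖k‖ ^ 2 ≤ ∫ k, q₄ k * s₁ ^ 2 := by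
            refine integral_mono_of_nonneg (Filter.Eventually.of_forall fun k =>
              mul_nonneg (hq₄.nonneg k) (sq_nonneg _)) (hq₄.integrable.mul_const _)
              (Filter.Eventually.of_forall fun k => ?_)
            by_cases hk : ‖k‖ ≤ s₁
            · exact mul_le_mul_of_nonneg_left (pow_le_pow_left₀ (norm_nonneg _) hk 2)
                (hq₄.nonneg k)
            · simp [hsupp k (not_le.1 hk)]
        _ = (∫ k, q₄ k) * s₁ ^ 2 := integral_mul_const _ _
        _ ≤ 1 * s₁ ^ 2 := mul_le_mul_of_nonneg_right hq₄.integral_le_one (sq_nonneg _)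
        _ = s₁ ^ 2 := one_mul _
    rw [hκ, div_le_iff₀ (by positivity)]
    have h2 : (1 : ℝ) ≤ 10 ^ d := one_le_pow₀ (by norm_num)
    have h3 : (1 : ℝ) ≤ d := by exact_mod_cast Nat.pos_of_ne_zero (NeZero.ne d)
    have h4 : (1 : ℝ) ≤ 10 ^ d * d := one_le_mul_of_one_le_of_one_le h2 h3
    nlinarith [sq_nonneg s₁]
  induction t with
  | zero =>
    simp only [Nat.cast_zero, mul_zero, add_zero]
    rw [Real.sqrt_sq hs.le]
    exact hbig
  | succ t ih =>
    push_cast at ht ⊢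
    set S := s₁ ^ 2 + κ * t with hS
    have hSs : s₁ ^ 2 ≤ S := by
      have : 0 ≤ κ * t := by positivity
      linarith
    have hS0 : 0 < S := lt_of_lt_of_le (by positivity) hSs
    have eS : s₁ ^ 2 + κ * (t + 1) = S + κ := by rw [hS]; ring
    rw [eS] at ht ⊢
    have ih' := ih (by linarith)
    set u := (mhLin hw hq ^ t) f with hu
    have eu : (mhLin hw hq ^ (t + 1)) f = mhLin hw hq u := by rw [pow_succ']; rfl
    rw [eu]
    have eut : u.1 = (mhOp (flatWeight w m ε) q)^[t] f.1 := coe_mhLin_pow hw hq f t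
    have hu0 : ∀ x, 0 ≤ u.1 x := by
      rw [eut]; exact iterate_nonneg hw hq (isBdd_coe f) hf0 t
    have hu1 : ∫ x, u.1 x * flatWeight w m ε x ≤ 1 := by
      rw [eut, integral_iterate_mul hw hq (isBdd_coe f)]; exact hf1
    set s := Real.sqrt (S + κ) with hs_def
    have hs2 : s ^ 2 = S + κ := Real.sq_sqrt (by linarith)
    have hs0 : 0 < s := Real.sqrt_pos.2 (by linarith)
    have hdec : wInner hw (mhLin hw hq u) (mhLin hw hq u) ≤ wInner hw u u := by
      refine (wInner_mhLin_self_le hw hq u).trans ?_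
      have := integral_incr_nonneg hw hq u.1
      have : 0 ≤ 1 / (12 * 2 ^ d) * ∫ k, q k * incr (flatWeight w m ε) u.1 k := by positivity
      linarith
    rcases le_or_gt (wInner hw u u * s ^ d) (nashConst d P) with hc | hc
    · exact (mul_le_mul_of_nonneg_right hdec (by positivity)).trans hc
    · have hsε : s ≤ 5 / 2 * ε := Real.sqrt_le_iff.2 ⟨by positivity, ht⟩
      have hs1 : s₁ ≤ s := Real.le_sqrt_of_sq_le (by linarith)
      have step := h.sq_norm_step hq hq₄ hle hv hs0 hsε
        (fun x hx => hsupp x (lt_of_le_of_lt hs1 hx)) u hu0 hu1 hc.le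
      have e3 : v / (192 * 10 ^ d * s ^ 2) = d * κ / (S + κ) := by
        rw [hs2, hκ]; field_simp
      rw [e3] at step
      have h5 := sqrt_pow_step (d := d) hS0 hκ0 (hκs.trans hSs)
      calc wInner hw (mhLin hw hq u) (mhLin hw hq u) * s ^ d
          ≤ wInner hw u u * (1 - d * κ / (S + κ)) * s ^ d :=
            mul_le_mul_of_nonneg_right step (by positivity)
        _ = wInner hw u u * (s ^ d * (1 - d * κ / (S + κ))) := by ring
        _ ≤ wInner hw u u * Real.sqrt S ^ d :=
            mul_le_mul_of_nonneg_left h5 (wInner_self_nonneg hw u)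
        _ ≤ _ := ih'

end nash

/-! ### Smoothing by moves of small scale -/

section split

variable {d : ℕ} {q : Eu d → ℝ}

theorem IsProposal.of_le (hq : IsProposal q) {r : Eu d → ℝ} (hm : Measurable r)
    (h0 : ∀ x, 0 ≤ r x) (hle : ∀ x, r x ≤ q x) (ha : ∀ x y : Eu d, ‖x‖ ≤ ‖y‖ → r y ≤ r x) :
    IsProposal r := by
  have hi : Integrable r := hq.integrable.mono' hm.aestronglyMeasurable
    (Filter.Eventually.of_forall fun x => by rw [Real.norm_of_nonneg (h0 x)]; exact hle x)
  exact ⟨hm, h0, hi, ha, (integral_mono hi hq.integrable hle).trans hq.integral_le_one⟩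

/-- The excess of a proposal over the height `τ`. -/
theorem IsProposal.excess (hq : IsProposal q) {τ : ℝ} (hτ : 0 ≤ τ) :
    IsProposal fun x => max (q x - τ) 0 :=
  hq.of_le ((hq.measurable.sub_const τ).max measurable_const) (fun _ => le_max_right _ _)
    (fun x => max_le (by linarith) (hq.nonneg x))
    fun x y hxy => max_le_max (sub_le_sub_right (hq.antitone x y hxy) τ) le_rfl

/-- A proposal cut off at the height `τ`. -/
theorem IsProposal.trunc (hq : IsProposal q) {τ : ℝ} (hτ : 0 ≤ τ) :
    IsProposal fun x => min (q x) τ :=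
  hq.of_le (hq.measurable.min measurable_const) (fun x => le_min (hq.nonneg x) hτ)
    (fun _ => min_le_left _ _) fun x y hxy => min_le_min (hq.antitone x y hxy) le_rfl

/-- The moves of length at most `σ` of a proposal. -/
theorem IsProposal.near (hq : IsProposal q) (σ : ℝ) :
    IsProposal ((Metric.closedBall 0 σ).indicator q) :=
  hq.of_le (hq.measurable.indicator Metric.isClosed_closedBall.measurableSet)
    (fun x => indicator_nonneg (fun x _ => hq.nonneg x) x)
    (fun x => indicator_le_self' (fun x _ => hq.nonneg x) x) fun x y hxy => by
      by_cases hy : y ∈ Metric.closedBall (0 : Eu d) σ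
      · have hx : x ∈ Metric.closedBall (0 : Eu d) σ := by
          rw [mem_closedBall_zero_iff] at hy ⊢; exact hxy.trans hy
        rw [indicator_of_mem hx, indicator_of_mem hy]; exact hq.antitone x y hxy
      · rw [indicator_of_notMem hy]; exact indicator_nonneg (fun x _ => hq.nonneg x) x

theorem integrable_mul_norm_sq (hq : IsProposal q) {σ : ℝ} (hσ : ∀ x, σ < ‖x‖ → q x = 0) :
    Integrable fun x => q x * ‖x‖ ^ 2 := by
  refine (hq.integrable.mul_const (σ ^ 2)).mono' (hq.measurable.mul
    (by fun_prop)).aestronglyMeasurable (Filter.Eventually.of_forall fun x => ?_)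
  rw [Real.norm_of_nonneg (mul_nonneg (hq.nonneg x) (by positivity))]
  by_cases hx : ‖x‖ ≤ σ
  · exact mul_le_mul_of_nonneg_left (pow_le_pow_left₀ (norm_nonneg _) hx 2) (hq.nonneg x)
  · simp [hσ x (not_le.1 hx)]

theorem second_moment_nonneg (hq : IsProposal q) : 0 ≤ ∫ x, q x * ‖x‖ ^ 2 :=
  integral_nonneg fun x => mul_nonneg (hq.nonneg x) (by positivity)

theorem second_moment_le (hq : IsProposal q) {σ : ℝ} (hσ : ∀ x, σ < ‖x‖ → q x = 0) :
    ∫ x, q x * ‖x‖ ^ 2 ≤ σ ^ 2 * ∫ x, q x := by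
  rw [← integral_const_mul]
  refine integral_mono (integrable_mul_norm_sq hq hσ) (hq.integrable.const_mul _) fun x => ?_
  change q x * ‖x‖ ^ 2 ≤ σ ^ 2 * q x
  rw [mul_comm (σ ^ 2)]
  by_cases hx : ‖x‖ ≤ σ
  · exact mul_le_mul_of_nonneg_left (pow_le_pow_left₀ (norm_nonneg _) hx 2) (hq.nonneg x)
  · simp [hσ x (not_le.1 hx)]

/-- A height `τ` that halves the second moment, up to a factor in the height: the part of the
proposal above `τ`, of scales at most `s₁`, and the part below `2 τ` both carry at least half of
the second moment. -/
theorem exists_split [NeZero d] (hq : IsProposal q) {σ c : ℝ} (hσ0 : 0 < σ)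
    (hσ : ∀ x, σ < ‖x‖ → q x = 0) (hc : ∀ x, q x ≤ c) (hv : 0 < ∫ x, q x * ‖x‖ ^ 2) :
    ∃ τ s₁ : ℝ, 0 < τ ∧ 0 < s₁ ∧ s₁ ≤ σ ∧ (∀ x, s₁ < ‖x‖ → max (q x - τ) 0 = 0) ∧
      (∀ x, ‖x‖ < s₁ → τ ≤ q x) ∧
      (∫ x, q x * ‖x‖ ^ 2) ≤ 2 * ∫ x, max (q x - τ) 0 * ‖x‖ ^ 2 ∧
      (∫ x, q x * ‖x‖ ^ 2) ≤ 2 * ∫ x, min (q x) (2 * τ) * ‖x‖ ^ 2 := by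
  have hω := unitVol_pos d
  set v := ∫ x, q x * ‖x‖ ^ 2 with hvdef
  set V : ℝ → ℝ := fun τ => ∫ x, max (q x - τ) 0 * ‖x‖ ^ 2 with hV
  have hsuppE : ∀ τ, 0 ≤ τ → ∀ x, σ < ‖x‖ → max (q x - τ) 0 = 0 := fun τ hτ x hx => by
    rw [hσ x hx]; exact max_eq_right (by linarith)
  have hsuppT : ∀ τ, 0 ≤ τ → ∀ x, σ < ‖x‖ → min (q x) τ = 0 := fun τ hτ x hx => by
    rw [hσ x hx]; exact min_eq_left hτ
  have hsum : ∀ τ, 0 ≤ τ → V τ + ∫ x, min (q x) τ * ‖x‖ ^ 2 = v := by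
    intro τ hτ
    rw [hV, hvdef]
    simp only
    rw [← integral_add (integrable_mul_norm_sq (hq.excess hτ) (hsuppE τ hτ))
      (integrable_mul_norm_sq (hq.trunc hτ) (hsuppT τ hτ))]
    congr 1; funext x
    rw [← add_mul]
    congr 1
    rcases le_total (q x) τ with h | h
    · rw [max_eq_right (by linarith), min_eq_left h, zero_add]
    · rw [max_eq_left (by linarith), min_eq_right h, sub_add_cancel]
  set τ₀ := v / (2 * unitVol d * σ ^ (d + 2)) with hτ₀
  have hτ₀0 : 0 < τ₀ := by positivity
  have hstart : v ≤ 2 * V τ₀ := by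
    have h1 : ∫ x, min (q x) τ₀ * ‖x‖ ^ 2 ≤ v / 2 := by
      have h2 := second_moment_le (hq.trunc hτ₀0.le) (hsuppT τ₀ hτ₀0.le)
      have h3 : ∫ x, min (q x) τ₀ ≤ τ₀ * (σ ^ d * unitVol d) := by
        calc ∫ x, min (q x) τ₀ ≤ ∫ x, (Metric.closedBall (0 : Eu d) σ).indicator
              (fun _ => τ₀) x := by
              refine integral_mono (hq.trunc hτ₀0.le).integrable ((integrable_indicator_iff
                Metric.isClosed_closedBall.measurableSet).2
                (integrableOn_const measure_closedBall_lt_top.ne)) fun x => ?_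
              by_cases hx : ‖x‖ ≤ σ
              · rw [indicator_of_mem (mem_closedBall_zero_iff.2 hx)]; exact min_le_right _ _
              · change min (q x) τ₀ ≤ _
                rw [hsuppT τ₀ hτ₀0.le x (not_le.1 hx)]
                exact indicator_nonneg (fun _ _ => hτ₀0.le) _
          _ = τ₀ * (σ ^ d * unitVol d) := by
              rw [integral_indicator Metric.isClosed_closedBall.measurableSet, setIntegral_const,
                smul_eq_mul, Measure.addHaar_real_closedBall _ _ hσ0.le,
                finrank_euclideanSpace_fin, mul_comm]
              rfl
      have h4 := h2.trans (mul_le_mul_of_nonneg_left h3 (sq_nonneg σ))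
      refine h4.trans (le_of_eq ?_)
      rw [hτ₀]; field_simp; ring
    have := hsum τ₀ hτ₀0.le
    linarith
  have hex : ∃ j : ℕ, 2 * V (2 ^ (j + 1) * τ₀) < v := by
    obtain ⟨j, hj⟩ := pow_unbounded_of_one_lt (c / τ₀) (one_lt_two)
    refine ⟨j, ?_⟩
    have hj' : c ≤ 2 ^ (j + 1) * τ₀ := by
      rw [div_lt_iff₀ hτ₀0] at hj
      rw [pow_succ]
      have : 0 < 2 ^ j * τ₀ := by positivity
      linarith
    have : V (2 ^ (j + 1) * τ₀) = 0 := by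
      rw [hV]
      simp only
      refine (integral_congr_ae (Filter.Eventually.of_forall fun x => ?_)).trans
        (integral_zero (Eu d) ℝ)
      change max (q x - _) 0 * _ = 0
      rw [max_eq_right (by linarith [hc x]), zero_mul]
    rw [this]; linarith
  classical
  set j := Nat.find hex with hj
  have hj1 : 2 * V (2 ^ (j + 1) * τ₀) < v := Nat.find_spec hex
  have hj2 : v ≤ 2 * V (2 ^ j * τ₀) := by
    rcases Nat.eq_zero_or_pos j with h0 | h0
    · rw [h0, pow_zero, one_mul]; exact hstart
    · have := Nat.find_min hex (m := j - 1) (by omega)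
      rw [not_lt, Nat.sub_add_cancel h0] at this
      exact this
  set τ := 2 ^ j * τ₀ with hτ
  have hτ0 : 0 < τ := by positivity
  have e2 : 2 ^ (j + 1) * τ₀ = 2 * τ := by rw [hτ, pow_succ]; ring
  rw [e2] at hj1
  set S := {x : Eu d | τ < q x} with hS
  have hbd : ∀ x ∈ S, ‖x‖ ≤ σ := by
    intro x hx
    by_contra hcon
    have h1 : τ < q x := hx
    rw [hσ x (not_le.1 hcon)] at h1
    linarith
  have hBA : BddAbove (norm '' S) := ⟨σ, by rintro _ ⟨x, hx, rfl⟩; exact hbd x hx⟩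
  have hne : ∃ x ∈ S, 0 < ‖x‖ := by
    by_contra hcon
    push Not at hcon
    have : V τ = 0 := by
      rw [hV]
      simp only
      refine (integral_congr_ae (Filter.Eventually.of_forall fun x => ?_)).trans
        (integral_zero (Eu d) ℝ)
      change max (q x - _) 0 * ‖x‖ ^ 2 = 0
      by_cases hx : x ∈ S
      · have : ‖x‖ = 0 := le_antisymm (hcon x hx) (norm_nonneg _)
        rw [this]; ring
      · have : q x ≤ τ := not_lt.1 hx
        rw [max_eq_right (by linarith), zero_mul]
    rw [this] at hj2
    linarith
  obtain ⟨x₀, hx₀, hx₀'⟩ := hne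
  refine ⟨τ, sSup (norm '' S), hτ0, lt_of_lt_of_le hx₀' (le_csSup hBA ⟨x₀, hx₀, rfl⟩),
    csSup_le ⟨_, x₀, hx₀, rfl⟩ (by rintro _ ⟨x, hx, rfl⟩; exact hbd x hx), fun x hx => ?_,
    fun x hx => ?_, hj2, ?_⟩
  · refine max_eq_right ?_
    by_contra hcon
    exact absurd (le_csSup hBA ⟨x, (by change τ < q x; linarith), rfl⟩)
      (not_le.2 hx)
  · obtain ⟨_, ⟨y, hy, rfl⟩, hxy⟩ := exists_lt_of_lt_csSup (Set.Nonempty.image _ ⟨x₀, hx₀⟩) hx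
    exact (le_of_lt hy).trans (hq.antitone _ _ hxy.le)
  · have := hsum (2 * τ) (by positivity)
    linarith

end split

section smoothing

variable {d : ℕ} {w : Eu d → ℝ} {Θ : Set (Eu d)} {m : Eu d} {ε P : ℝ}

theorem wInner_mhLin_pow_antitone {q : Eu d → ℝ} (hw : IsWeight w) (hq : IsProposal q)
    (f : bddMeas d) : Antitone fun n : ℕ =>
      wInner hw ((mhLin hw hq ^ n) f) ((mhLin hw hq ^ n) f) := by
  refine antitone_nat_of_succ_le fun n => ?_
  have e : (mhLin hw hq ^ (n + 1)) f = mhLin hw hq ((mhLin hw hq ^ n) f) := by rw [pow_succ']; rfl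
  rw [e]
  refine (wInner_mhLin_self_le hw hq _).trans ?_
  have := integral_incr_nonneg (w := w) hw hq ((mhLin hw hq ^ n) f).1
  have : 0 ≤ 1 / (12 * 2 ^ d) * ∫ k, q k * incr w ((mhLin hw hq ^ n) f).1 k := by positivity
  linarith

/-- A proposal that is a mixture makes big moves by one part and small moves by the other. -/
theorem mhOp_eq_of_add {q q₁ q₂ : Eu d → ℝ} (hw : IsWeight w)
    (hq₁ : IsProposal q₁) (hq₂ : IsProposal q₂) (hadd : ∀ x, q x = q₁ x + q₂ x) {g : Eu d → ℝ}
    (hg : IsBdd g) (x : Eu d) :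
    mhOp w q g x = (∫ h, q₁ h * accept w x h * g (x + h)) +
      (∫ h, q₂ h * accept w x h * (g (x + h) - g x)) +
      (1 - ∫ h, q₁ h * accept w x h) * g x := by
  have e : mhOp w q g x = mhOp w q₁ g x + ∫ h, q₂ h * accept w x h * (g (x + h) - g x) := by
    unfold mhOp
    rw [add_assoc, ← integral_add (integrable_mhOp hw hq₁ hg x) (integrable_mhOp hw hq₂ hg x)]
    congr 2; funext h
    rw [hadd h]; ring
  rw [e, mhOp_eq hw hq₁ hg]; ring

/-- The law of an accepted move of height at most `2 τ` and mass `b` has a density with square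
norm at most `32 / 15 τ / (b P)`; propagating it instead of `g` bounds the effect of such a move
followed by `t` steps. -/
theorem FlatMode.integral_move_le (h : FlatMode w Θ m ε P) {q q₃ : Eu d → ℝ}
    (hq : IsProposal q) (hq₃ : IsProposal q₃) {τ b : ℝ} (hτ : ∀ x, q₃ x ≤ 2 * τ)
    (hb0 : 0 < b) (hb : b = ∫ x, q₃ x) {D : ℝ} (hD0 : 0 ≤ D) (t : ℕ)
    (hD : ∀ f : bddMeas d, (∀ x, 0 ≤ f.1 x) → (∫ x, f.1 x * flatWeight w m ε x ≤ 1) →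
      wInner (isWeight_flatWeight h.weight m ε) f f ≤ 32 / 15 * τ / (b * P) →
      wInner (isWeight_flatWeight h.weight m ε)
        ((mhLin (isWeight_flatWeight h.weight m ε) hq ^ t) f)
        ((mhLin (isWeight_flatWeight h.weight m ε) hq ^ t) f) ≤ D ^ 2)
    (g : bddMeas d) (y : Eu d) :
    ∫ k, q₃ k * accept (flatWeight w m ε) y k * (mhOp (flatWeight w m ε) q)^[t] g.1 (y + k) ≤
      b * (D * Real.sqrt (wInner (isWeight_flatWeight h.weight m ε) g g)) := by
  set wF := flatWeight w m ε with hwF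
  set hw : IsWeight wF := isWeight_flatWeight h.weight m ε with hhw
  have hP := h.max_pos
  have hτ0 : 0 ≤ 2 * τ := (hq₃.nonneg 0).trans (hτ 0)
  set φ : Eu d → ℝ := fun z => b⁻¹ * (q₃ (z - y) * accept wF y (z - y) * (wF z)⁻¹) with hφ
  have hφw : ∀ z, φ z * wF z = b⁻¹ * (q₃ (z - y) * accept wF y (z - y)) := by
    intro z
    simp only [hφ]
    by_cases hz : z ∈ flatRegion Θ m ε
    · have := h.le_flatWeight hz
      rw [← hwF] at this
      have : wF z ≠ 0 := by linarith
      field_simp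
    · have h1 : accept wF y (z - y) = 0 := by
        by_contra hc
        have := h.mem_of_accept_ne_zero hc
        rw [add_sub_cancel] at this
        exact hz this
      rw [h1]; ring
  have hφ0 : ∀ z, 0 ≤ φ z := fun z => mul_nonneg (inv_nonneg.2 hb0.le)
    (mul_nonneg (mul_nonneg (hq₃.nonneg _) (accept_nonneg hw _ _)) (inv_nonneg.2 (hw.nonneg z)))
  have hφle : ∀ z, φ z ≤ 32 / 15 * τ / (b * P) := by
    intro z
    by_cases hz : z ∈ flatRegion Θ m ε
    · have h1 := h.le_flatWeight hz
      rw [← hwF] at h1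
      have h2 : (wF z)⁻¹ ≤ 16 / 15 / P := by
        rw [inv_le_comm₀ (by linarith) (by positivity)]
        refine le_trans (le_of_eq ?_) h1
        field_simp
      calc φ z ≤ b⁻¹ * (2 * τ * 1 * (16 / 15 / P)) := by
            refine mul_le_mul_of_nonneg_left ?_ (inv_nonneg.2 hb0.le)
            refine mul_le_mul (mul_le_mul (hτ _) (accept_le_one _ _) (accept_nonneg hw _ _) hτ0) h2
              (inv_nonneg.2 (hw.nonneg z)) (by linarith)
        _ = _ := by field_simp; ring
    · have : φ z = 0 := by
        have h0 : wF z = 0 := h.flatWeight_zero hz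
        simp only [hφ, h0, inv_zero, mul_zero]
      rw [this]
      have : 0 ≤ τ := by linarith
      positivity
  have hφm : Measurable φ := by
    have m1 : Measurable fun z : Eu d => z - y := measurable_id.sub_const y
    exact ((((hq₃.measurable.comp m1)).mul
      ((measurable_accept_right hw y).comp m1)).mul hw.measurable.inv).const_mul _
  have hφb : IsBdd φ := IsBdd.of_nonneg_le hφm hφ0 hφle
  have hsub : ∀ F : Eu d → ℝ, ∫ z, F (z - y) = ∫ k, F k := fun F => integral_sub_right_eq_self F y
  have hmass : ∫ z, φ z * wF z ≤ 1 := by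
    simp only [hφw]
    rw [hsub fun k => b⁻¹ * (q₃ k * accept wF y k), integral_const_mul, inv_mul_le_iff₀ hb0, mul_one,
      hb]
    exact integral_mono (integrable_rate hw hq₃ y) hq₃.integrable fun k =>
      mul_le_of_le_one_right (hq₃.nonneg k) (accept_le_one _ _)
  have hsq : wInner hw ⟨φ, hφb⟩ ⟨φ, hφb⟩ ≤ 32 / 15 * τ / (b * P) := by
    rw [wInner_apply]
    calc ∫ x, φ x * φ x * wF x ≤ ∫ x, 32 / 15 * τ / (b * P) * (φ x * wF x) := by
          refine integral_mono ((hφb.mul hφb).integrable_mul hw.integrable)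
            ((hφb.integrable_mul hw.integrable).const_mul _) fun x => ?_
          change φ x * φ x * wF x ≤ 32 / 15 * τ / (b * P) * (φ x * wF x)
          rw [mul_assoc]
          exact mul_le_mul_of_nonneg_right (hφle x) (mul_nonneg (hφ0 x) (hw.nonneg x))
      _ ≤ _ := by
          rw [integral_const_mul]
          have : 0 ≤ τ := by linarith
          exact mul_le_of_le_one_right (by positivity) hmass
  have hDφ := hD ⟨φ, hφb⟩ hφ0 hmass hsq
  have e1 : ∫ k, q₃ k * accept wF y k * (mhOp wF q)^[t] g.1 (y + k) =
      b * wInner hw ⟨φ, hφb⟩ ((mhLin hw hq ^ t) g) := by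
    rw [wInner_apply, coe_mhLin_pow, ← integral_const_mul,
      ← hsub fun k => q₃ k * accept wF y k * (mhOp wF q)^[t] g.1 (y + k)]
    congr 1; funext z
    change q₃ (z - y) * accept wF y (z - y) * (mhOp wF q)^[t] g.1 (y + (z - y)) =
      b * (φ z * (mhOp wF q)^[t] g.1 z * wF z)
    have e : b * (φ z * (mhOp wF q)^[t] g.1 z * wF z) =
        b * (φ z * wF z) * (mhOp wF q)^[t] g.1 z := by ring
    rw [add_sub_cancel, e, hφw]
    field_simp
  rw [e1, wInner_pow_symm]
  refine mul_le_mul_of_nonneg_left ?_ hb0.le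
  have cs := wInner_sq_le hw ((mhLin hw hq ^ t) ⟨φ, hφb⟩) g
  refine le_of_abs_le (abs_le_of_sq_le_sq ?_ (by positivity))
  rw [mul_pow, Real.sq_sqrt (wInner_self_nonneg hw g)]
  exact cs.trans (mul_le_mul_of_nonneg_right hDφ (wInner_self_nonneg hw g))

/-- Smoothing of the chain with moves of scale at most `σ` on the flat region, in `n + k` steps: the
first `k` steps are likely to contain a move of height at most `2 τ`, with `τ` from `exists_split`,
and the other `n` steps, by the Nash inequality, spread out the bounded density that this move
leaves. -/
theorem FlatMode.smoothing [NeZero d] (h : FlatMode w Θ m ε P) {q : Eu d → ℝ}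
    (hq : IsProposal q) {σ c : ℝ} (hσ0 : 0 < σ) (hσε : σ ≤ 5 / 2 * ε)
    (hσ : ∀ x, σ < ‖x‖ → q x = 0) (hc : ∀ x, q x ≤ c) (hv : 0 < ∫ x, q x * ‖x‖ ^ 2) {n : ℕ}
    (hn : σ ^ 2 + (∫ x, q x * ‖x‖ ^ 2) / (192 * 10 ^ d * d) * n ≤ (5 / 2 * ε) ^ 2)
    (hn0 : 0 < n) (g : bddMeas d) (hg1 : ∀ x, g.1 x ≤ 1) (k : ℕ) :
    ∀ y ∈ flatRegion Θ m ε, (mhOp (flatWeight w m ε) q)^[n + k] g.1 y ≤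
      16 / 15 * (5 / 2) ^ d * (Real.sqrt (nashConst d P /
        Real.sqrt ((∫ x, q x * ‖x‖ ^ 2) / (192 * 10 ^ d * d) * n) ^ d) *
        Real.sqrt (wInner (isWeight_flatWeight h.weight m ε) g g)) +
      (1 - 15 / 16 * (2 / 5) ^ d * ((∫ x, q x * ‖x‖ ^ 2) / (2 * σ ^ 2))) ^ k := by
  have hω := unitVol_pos d
  have hP := h.max_pos
  have hd : 0 < (d : ℝ) := by exact_mod_cast Nat.pos_of_ne_zero (NeZero.ne d)
  set wF := flatWeight w m ε with hwF
  set hw : IsWeight wF := isWeight_flatWeight h.weight m ε with hhw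
  set v := ∫ x, q x * ‖x‖ ^ 2 with hvdef
  obtain ⟨τ, s₁, hτ0, hs₁0, hs₁σ, hs₁a, hs₁b, hv4, hv3⟩ := exists_split hq hσ0 hσ hc hv
  rw [← hvdef] at hv4 hv3
  set q₃ : Eu d → ℝ := fun x => min (q x) (2 * τ) with hq₃def
  have hq₃ : IsProposal q₃ := hq.trunc (by positivity)
  have hq₄ : IsProposal fun x => max (q x - τ) 0 := hq.excess hτ0.le
  have hq₃σ : ∀ x, σ < ‖x‖ → q₃ x = 0 := fun x hx => by
    rw [hq₃def]; simp only; rw [hσ x hx]; exact min_eq_left (by positivity)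
  set b := ∫ x, q₃ x with hb
  have hbτ : τ * (s₁ ^ d * unitVol d) ≤ b := by
    calc τ * (s₁ ^ d * unitVol d) = ∫ x in Metric.ball (0 : Eu d) s₁, τ := by
          rw [setIntegral_const, smul_eq_mul, volume_real_ball _ hs₁0, mul_comm]
      _ ≤ ∫ x in Metric.ball (0 : Eu d) s₁, q₃ x :=
          setIntegral_mono_on (integrableOn_const measure_ball_lt_top.ne)
            hq₃.integrable.integrableOn Metric.isOpen_ball.measurableSet fun x hx =>
            le_min (hs₁b x (mem_ball_zero_iff.1 hx)) (by linarith)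
      _ ≤ b := setIntegral_le_integral hq₃.integrable (Filter.Eventually.of_forall hq₃.nonneg)
  have hb0 : 0 < b := lt_of_lt_of_le (by positivity) hbτ
  have hbv : v / (2 * σ ^ 2) ≤ b := by
    have := second_moment_le hq₃ hq₃σ
    rw [div_le_iff₀ (by positivity)]
    have : ∫ x, q₃ x * ‖x‖ ^ 2 ≤ σ ^ 2 * b := this
    have h3 : v ≤ 2 * ∫ x, q₃ x * ‖x‖ ^ 2 := hv3
    linarith
  set K := v / (192 * 10 ^ d * d) with hK
  have hK0 : 0 < K := by positivity
  set D := Real.sqrt (nashConst d P / Real.sqrt (K * n) ^ d) with hD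
  have hn0' : (0 : ℝ) < n := by exact_mod_cast hn0
  have hKn : 0 < Real.sqrt (K * n) ^ d := by positivity
  have hB0 : 0 ≤ nashConst d P := by unfold nashConst; positivity
  set a : ℝ := 15 / 16 * (2 / 5) ^ d with ha
  have ha0 : 0 < a := by positivity
  have ha1 : a * b ≤ 1 := by
    have h1 : a ≤ 1 := by
      have : (2 / 5 : ℝ) ^ d ≤ 1 := pow_le_one₀ (by norm_num) (by norm_num)
      rw [ha]; linarith
    exact mul_le_one₀ h1 hb0.le hq₃.integral_le_one
  set G := Real.sqrt (wInner hw g g) with hG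
  have hDG : 0 ≤ D * G := by positivity
  have hDmono : ∀ t, n ≤ t → ∀ f : bddMeas d, (∀ x, 0 ≤ f.1 x) → (∫ x, f.1 x * wF x ≤ 1) →
      wInner hw f f ≤ 32 / 15 * τ / (b * P) →
      wInner hw ((mhLin hw hq ^ t) f) ((mhLin hw hq ^ t) f) ≤ D ^ 2 := by
    intro t ht f hf0 hf1 hf2
    have hinit : wInner hw f f * s₁ ^ d ≤ nashConst d P := by
      calc wInner hw f f * s₁ ^ d ≤ 32 / 15 * τ / (b * P) * s₁ ^ d :=
            mul_le_mul_of_nonneg_right hf2 (by positivity)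
        _ = 32 / 15 / (unitVol d * P) * (τ * (s₁ ^ d * unitVol d) / b) := by field_simp
        _ ≤ 32 / 15 / (unitVol d * P) * 1 :=
            mul_le_mul_of_nonneg_left ((div_le_one hb0).2 hbτ) (by positivity)
        _ ≤ nashConst d P := by
            rw [mul_one, nashConst]
            refine div_le_div_of_nonneg_right ?_ (by positivity)
            have : (1 : ℝ) ≤ (5 / 2) ^ d := one_le_pow₀ (by norm_num)
            linarith
    have hs₁sq : s₁ ^ 2 ≤ σ ^ 2 := pow_le_pow_left₀ hs₁0.le hs₁σ 2
    have h1 := h.sq_norm_decay hq hq₄ (fun x => max_le (by linarith) (hq.nonneg x)) hv.le hv4 hs₁0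
      hs₁a f hf0 hf1 hinit n (by linarith)
    have h2 : Real.sqrt (K * n) ^ d ≤ Real.sqrt (s₁ ^ 2 + K * n) ^ d :=
      pow_le_pow_left₀ (Real.sqrt_nonneg _) (Real.sqrt_le_sqrt (by nlinarith)) d
    refine (wInner_mhLin_pow_antitone hw hq f ht).trans ?_
    rw [hD, Real.sq_sqrt (by positivity), le_div_iff₀ hKn]
    exact (mul_le_mul_of_nonneg_left h2 (wInner_self_nonneg hw _)).trans h1
  have hq₅ : IsProposal fun x => max (q x - 2 * τ) 0 := hq.excess (by positivity)
  have hsplit : ∀ x, q x = q₃ x + max (q x - 2 * τ) 0 := fun x => by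
    rw [hq₃def]
    rcases le_total (q x) (2 * τ) with h' | h'
    · simp only [min_eq_left h', max_eq_right (sub_nonpos.2 h'), add_zero]
    · simp only [min_eq_right h', max_eq_left (sub_nonneg.2 h')]; ring
  have hC0 : ∀ k : ℕ, 0 ≤ D * G / a + (1 - a * b) ^ k := fun k =>
    add_nonneg (by positivity) (pow_nonneg (by linarith) k)
  have main : ∀ k : ℕ, ∀ y ∈ flatRegion Θ m ε, (mhOp wF q)^[n + k] g.1 y ≤
      D * G / a + (1 - a * b) ^ k := by
    intro k
    induction k with
    | zero =>
      intro y _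
      have : 0 ≤ D * G / a := by positivity
      rw [pow_zero]
      exact (iterate_le hw hq (isBdd_coe g) hg1 _ y).trans (by linarith)
    | succ k ih =>
      intro y hy
      have hu := isBdd_iterate hw hq (isBdd_coe g) (n + k)
      rw [← add_assoc, Function.iterate_succ_apply',
        mhOp_eq_of_add hw hq₃ hq₅ hsplit hu y]
      set u := (mhOp wF q)^[n + k] g.1 with hu'
      set ck := D * G / a + (1 - a * b) ^ k with hck
      have h1 : ∫ k, q₃ k * accept wF y k * u (y + k) ≤ b * (D * G) :=
        h.integral_move_le hq hq₃ (fun x => min_le_right _ _) hb0 hb (Real.sqrt_nonneg _) _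
          (hDmono (n + k) (by omega)) g y
      have h2 : ∫ k, max (q k - 2 * τ) 0 * accept wF y k * (u (y + k) - u y) ≤
          (∫ k, max (q k - 2 * τ) 0 * accept wF y k) * (ck - u y) := by
        rw [← integral_mul_const]
        refine integral_mono (integrable_mhOp hw hq₅ hu y)
          ((integrable_rate hw hq₅ y).mul_const _) fun k => ?_
        by_cases hk : accept wF y k = 0
        · simp [hk]
        · exact mul_le_mul_of_nonneg_left
            (sub_le_sub_right (ih _ (h.mem_of_accept_ne_zero hk)) _)
            (mul_nonneg (hq₅.nonneg k) (accept_nonneg hw _ _))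
      have h3 := h.acceptance_ge hq₃ hq₃σ hσε hy
      have h4 : (∫ k, q₃ k * accept wF y k) + ∫ k, max (q k - 2 * τ) 0 * accept wF y k ≤ 1 := by
        rw [← integral_add (integrable_rate hw hq₃ y) (integrable_rate hw hq₅ y)]
        refine le_trans (le_of_eq ?_) (integral_rate_le_one hw hq y)
        congr 1; funext k
        rw [← add_mul, ← hsplit k]
      have h5 := ih y hy
      set r₃ := ∫ k, q₃ k * accept wF y k
      set r₅ := ∫ k, max (q k - 2 * τ) 0 * accept wF y k
      have h6 : a * b * ck ≤ r₃ * ck := mul_le_mul_of_nonneg_right h3 (hC0 k)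
      have h7 : (1 - r₃ - r₅) * u y ≤ (1 - r₃ - r₅) * ck :=
        mul_le_mul_of_nonneg_left h5 (by linarith)
      have e1 : D * G / a + (1 - a * b) ^ (k + 1) = b * (D * G) + (1 - a * b) * ck := by
        rw [hck, pow_succ]; field_simp; ring
      rw [e1]
      linarith
  intro y hy
  refine (main k y hy).trans (add_le_add (le_of_eq ?_) (pow_le_pow_left₀ (by linarith)
    (sub_le_sub_left (mul_le_mul_of_nonneg_left hbv ha0.le) 1) k))
  have e1 : (2 / 5 : ℝ) ^ d * (5 / 2) ^ d = 1 := by rw [← mul_pow]; norm_num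
  rw [div_eq_iff ha0.ne', ha]
  calc D * G = D * G * ((2 / 5 : ℝ) ^ d * (5 / 2) ^ d) := by rw [e1, mul_one]
    _ = _ := by ring

end smoothing

/-! ### Staying near the mode -/

section barrier

variable {d : ℕ} {w : Eu d → ℝ} {Θ : Set (Eu d)} {m : Eu d} {ε P : ℝ}

/-- The barrier `((‖y - m‖² - ε²)₊)²`, cut off far from `m` to make it bounded. -/
noncomputable def barrier (m : Eu d) (ε : ℝ) (y : Eu d) : ℝ :=
  max (min (‖y - m‖ ^ 2) (4 * ε ^ 2) - ε ^ 2) 0 ^ 2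

theorem measurable_barrier (m : Eu d) (ε : ℝ) : Measurable (barrier m ε) := by
  unfold barrier
  fun_prop

theorem barrier_nonneg (m : Eu d) (ε : ℝ) (y : Eu d) : 0 ≤ barrier m ε y := sq_nonneg _

theorem isBdd_barrier (m : Eu d) (ε : ℝ) : IsBdd (barrier m ε) :=
  IsBdd.of_nonneg_le (M := (4 * ε ^ 2) ^ 2) (measurable_barrier m ε) (barrier_nonneg m ε) fun y => by
    refine pow_le_pow_left₀ (le_max_right _ _) (max_le ?_ (by positivity)) 2
    linarith [min_le_right (‖y - m‖ ^ 2) (4 * ε ^ 2), sq_nonneg ε]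

theorem barrier_eq_zero {y : Eu d} (hy : ‖y - m‖ ≤ ε) : barrier m ε y = 0 := by
  have h1 : ‖y - m‖ ^ 2 ≤ ε ^ 2 := pow_le_pow_left₀ (norm_nonneg _) hy 2
  rw [barrier, max_eq_right (by linarith [min_le_left (‖y - m‖ ^ 2) (4 * ε ^ 2)])]
  norm_num

theorem le_barrier (hε : 0 < ε) {y : Eu d} (hy : 11 / 10 * ε < ‖y - m‖) :
    ε ^ 4 ≤ 25 * barrier m ε y := by
  have h1 : (11 / 10 * ε) ^ 2 ≤ ‖y - m‖ ^ 2 := pow_le_pow_left₀ (by positivity) hy.le 2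
  have h2 : 21 / 100 * ε ^ 2 ≤ max (min (‖y - m‖ ^ 2) (4 * ε ^ 2) - ε ^ 2) 0 := by
    refine le_max_of_le_left ?_
    have : 121 / 100 * ε ^ 2 ≤ min (‖y - m‖ ^ 2) (4 * ε ^ 2) :=
      le_min (by linarith) (by nlinarith [sq_nonneg ε])
    linarith
  have h3 := pow_le_pow_left₀ (by positivity) h2 2
  rw [barrier]
  nlinarith [sq_nonneg (ε ^ 2)]

theorem sq_max_add_le (u δ : ℝ) :
    max (u + δ) 0 ^ 2 ≤ max u 0 ^ 2 + 2 * max u 0 * δ + δ ^ 2 := by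
  rcases le_total (u + δ) 0 with h1 | h1 <;> rcases le_total u 0 with h2 | h2
  · rw [max_eq_right h1, max_eq_right h2]; nlinarith [sq_nonneg δ]
  · rw [max_eq_right h1, max_eq_left h2]; nlinarith [sq_nonneg (u + δ)]
  · rw [max_eq_left h1, max_eq_right h2]; nlinarith
  · rw [max_eq_left h1, max_eq_left h2]; nlinarith

/-- The barrier grows slowly in mean under moves of small scale: towards the mode the acceptance
probability increases, so that up to the second moment the moves do not drift outwards. -/
theorem FlatMode.barrier_drift [NeZero d] (h : FlatMode w Θ m ε P) (hmode : ∀ x, w x ≤ w m)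
    {q : Eu d → ℝ} (hq : IsProposal q) {σ : ℝ} (hσ : ∀ x, σ < ‖x‖ → q x = 0)
    (hσε : σ ≤ 2 / 5 * ε) {y : Eu d} (hy : ‖y - m‖ ≤ 11 / 10 * ε) :
    ∫ k, q k * accept w y k * (barrier m ε (y + k) - barrier m ε y) ≤
      11 * d * ε ^ 2 * ∫ k, q k * ‖k‖ ^ 2 := by
  have hε := h.eps_pos
  have hw := h.weight
  have hd : (1 : ℝ) ≤ d := by exact_mod_cast Nat.pos_of_ne_zero (NeZero.ne d)
  set v := ∫ k, q k * ‖k‖ ^ 2 with hv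
  have hv0 : 0 ≤ v := second_moment_nonneg hq
  have hvi := integrable_mul_norm_sq hq hσ
  have hdrift := drift_ge hq hσ (measurable_accept_right hw y) (accept_nonneg hw y)
    (accept_le_one y) (m - y) fun k t ht0 ht1 => by
      refine min_le_min le_rfl (div_le_div_of_nonneg_right ?_ (hw.nonneg y))
      have := hw.quasiconcave (y + k) m t ht0 ht1
      rw [min_eq_left (hmode _)] at this
      refine this.trans (le_of_eq ?_)
      congr 1
      rw [← sub_sub, add_assoc]
  rw [← hv] at hdrift
  set u := max (‖y - m‖ ^ 2 - ε ^ 2) 0 with hu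
  have hy2 : ‖y - m‖ ^ 2 ≤ 121 / 100 * ε ^ 2 := by
    have := pow_le_pow_left₀ (norm_nonneg _) hy 2
    linarith
  have hu0 : 0 ≤ u := le_max_right _ _
  have hu1 : u ≤ 21 / 100 * ε ^ 2 := max_le (by linarith) (by positivity)
  have by_eq : barrier m ε y = u ^ 2 := by
    rw [barrier, min_eq_left (by nlinarith [sq_nonneg ε])]
  have pt : ∀ k, q k * accept w y k * (barrier m ε (y + k) - barrier m ε y) ≤
      -(4 * u) * (q k * (accept w y k * inner ℝ k (m - y))) +
        (2 * u + 7 * ε ^ 2) * (q k * ‖k‖ ^ 2) := by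
    intro k
    by_cases hk : ‖k‖ ≤ σ
    swap
    · rw [hσ k (not_le.1 hk)]; simp
    have hα0 := accept_nonneg hw y k
    have hα1 := accept_le_one (w := w) y k
    have hq0 := hq.nonneg k
    set i := inner ℝ k (m - y) with hi
    set δ := ‖k‖ ^ 2 - 2 * i with hδ
    have e1 : ‖y + k - m‖ ^ 2 = ‖y - m‖ ^ 2 + δ := by
      have : y + k - m = k - (m - y) := by abel
      rw [this, norm_sub_sq_real, norm_sub_rev y m]
      ring
    have h1 : barrier m ε (y + k) - barrier m ε y ≤ 2 * u * δ + δ ^ 2 := by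
      have h2 : barrier m ε (y + k) ≤ max ((‖y - m‖ ^ 2 - ε ^ 2) + δ) 0 ^ 2 := by
        refine pow_le_pow_left₀ (le_max_right _ _) (max_le_max ?_ le_rfl) 2
        linarith [min_le_left (‖y + k - m‖ ^ 2) (4 * ε ^ 2)]
      have h3 := sq_max_add_le (‖y - m‖ ^ 2 - ε ^ 2) δ
      rw [by_eq]
      linarith
    have h2 : δ ^ 2 ≤ 7 * ε ^ 2 * ‖k‖ ^ 2 := by
      have h3 : |i| ≤ ‖k‖ * (11 / 10 * ε) :=
        (abs_real_inner_le_norm _ _).trans (mul_le_mul_of_nonneg_left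
          (by rwa [norm_sub_rev]) (norm_nonneg _))
      have h4 : |δ| ≤ 13 / 5 * ε * ‖k‖ := by
        have h5 : ‖k‖ ^ 2 ≤ 2 / 5 * ε * ‖k‖ := by
          rw [pow_two]; exact mul_le_mul_of_nonneg_right (hk.trans hσε) (norm_nonneg _)
        rw [abs_le] at h3 ⊢
        constructor <;> nlinarith [sq_nonneg ‖k‖]
      have h5 := pow_le_pow_left₀ (abs_nonneg _) h4 2
      rw [sq_abs] at h5
      nlinarith [sq_nonneg (ε * ‖k‖)]
    have h3 : accept w y k * (barrier m ε (y + k) - barrier m ε y) ≤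
        -(4 * u) * (accept w y k * i) + (2 * u + 7 * ε ^ 2) * ‖k‖ ^ 2 := by
      calc accept w y k * (barrier m ε (y + k) - barrier m ε y)
          ≤ accept w y k * (2 * u * δ + 7 * ε ^ 2 * ‖k‖ ^ 2) :=
            mul_le_mul_of_nonneg_left (by linarith) hα0
        _ = -(4 * u) * (accept w y k * i) +
            accept w y k * ((2 * u + 7 * ε ^ 2) * ‖k‖ ^ 2) := by rw [hδ]; ring
        _ ≤ _ := add_le_add le_rfl (mul_le_of_le_one_left (by positivity) hα1)
    calc q k * accept w y k * (barrier m ε (y + k) - barrier m ε y)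
        = q k * (accept w y k * (barrier m ε (y + k) - barrier m ε y)) := by ring
      _ ≤ q k * (-(4 * u) * (accept w y k * i) + (2 * u + 7 * ε ^ 2) * ‖k‖ ^ 2) :=
          mul_le_mul_of_nonneg_left h3 hq0
      _ = _ := by ring
  have hii : Integrable fun k => q k * (accept w y k * inner ℝ k (m - y)) := by
    refine (hq.integrable.mul_const (σ * ‖m - y‖)).mono' (hq.measurable.mul
      ((measurable_accept_right hw y).mul (by fun_prop))).aestronglyMeasurable
      (Filter.Eventually.of_forall fun k => ?_)
    by_cases hk : ‖k‖ ≤ σ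
    swap
    · rw [hσ k (not_le.1 hk)]; simp
    rw [norm_mul, Real.norm_of_nonneg (hq.nonneg k), norm_mul, Real.norm_of_nonneg
      (accept_nonneg hw y k)]
    refine mul_le_mul_of_nonneg_left ?_ (hq.nonneg k)
    refine (mul_le_of_le_one_left (norm_nonneg _) (accept_le_one y k)).trans ?_
    exact (abs_real_inner_le_norm _ _).trans (mul_le_mul_of_nonneg_right hk (norm_nonneg _))
  have := integral_mono (integrable_mhOp hw hq (isBdd_barrier m ε) y)
    ((hii.const_mul (-(4 * u))).fun_add (hvi.const_mul (2 * u + 7 * ε ^ 2))) pt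
  rw [integral_add (hii.const_mul _) (hvi.const_mul _), integral_const_mul, integral_const_mul,
    ← hv] at this
  refine this.trans ?_
  set I := ∫ k, q k * (accept w y k * inner ℝ k (m - y)) with hI
  have h1 : -(4 * u) * I ≤ 4 * u * (4 * d * v) := by nlinarith
  have h2 : u * (16 * d * v) ≤ 21 / 100 * ε ^ 2 * (16 * d * v) :=
    mul_le_mul_of_nonneg_right hu1 (by positivity)
  have h3 : u * v ≤ 21 / 100 * ε ^ 2 * v := mul_le_mul_of_nonneg_right hu1 hv0
  have h4 : ε ^ 2 * v ≤ d * (ε ^ 2 * v) := le_mul_of_one_le_left (by positivity) hd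
  nlinarith

/-- A barrier argument for the chain started near the mode: `G` controls the chain of the moves
`q₂` of small scale that are killed at a move `q₁` of bounded height, as long as it stays near the
mode; the effect of the moves `q₁` is bounded by stationarity. -/
theorem FlatMode.iterate_le_of_barrier [NeZero d] (h : FlatMode w Θ m ε P)
    (hmode : ∀ x, w x ≤ w m) {q q₁ q₂ : Eu d → ℝ} (hq : IsProposal q) (hq₁ : IsProposal q₁)
    (hq₂ : IsProposal q₂) (hadd : ∀ x, q x = q₁ x + q₂ x) {σ κ : ℝ}
    (hσ : ∀ x, σ < ‖x‖ → q₂ x = 0) (hσε : σ ≤ 2 / 5 * ε) (hκ : ∀ x, q₁ x ≤ κ)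
    {g : Eu d → ℝ} (hg : IsBdd g) (hg0 : ∀ x, 0 ≤ g x) (hg1 : ∀ x, g x ≤ 1)
    {G : ℕ → Eu d → ℝ} (hG : ∀ k, IsBdd (G k)) (hG0 : ∀ k x, 0 ≤ G k x)
    (hstart : ∀ x, g x ≤ G 0 x)
    (hstep : ∀ k, ∀ y ∈ Θ, ‖y - m‖ ≤ 11 / 10 * ε →
      16 / 15 * κ / P * (∫ x, g x * w x) +
        (∫ z, q₂ z * accept w y z * (G k (y + z) - G k y)) +
        (1 - ∫ z, q₁ z * accept w y z) * G k y ≤ G (k + 1) y) (k : ℕ) :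
    ∀ y ∈ Θ, (mhOp w q)^[k] g y ≤ G k y +
      25 / ε ^ 4 * (barrier m ε y + 11 * d * ε ^ 2 * (∫ z, q₂ z * ‖z‖ ^ 2) * k) := by
  have hε := h.eps_pos
  have hP := h.max_pos
  have hw := h.weight
  set v := ∫ z, q₂ z * ‖z‖ ^ 2 with hv
  have hv0 : 0 ≤ v := second_moment_nonneg hq₂
  set B := 11 * d * ε ^ 2 * v with hB
  have hB0 : 0 ≤ B := by positivity
  have hκ0 : 0 ≤ κ := (hq₁.nonneg 0).trans (hκ 0)
  induction k with
  | zero =>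
    intro y _
    have := barrier_nonneg m ε y
    have : 0 ≤ 25 / ε ^ 4 * (barrier m ε y + B * (0 : ℕ)) := by
      simp only [Nat.cast_zero, mul_zero, add_zero]; positivity
    exact (hstart y).trans (by linarith)
  | succ k ih =>
    intro y hy
    rcases lt_or_ge (11 / 10 * ε) ‖y - m‖ with hfar | hnear
    · have h1 := iterate_le hw hq hg hg1 (k + 1) y
      have h2 : 1 ≤ 25 / ε ^ 4 * (barrier m ε y + B * (k + 1 : ℕ)) := by
        rw [div_mul_eq_mul_div, one_le_div (by positivity)]
        have : 0 ≤ B * (k + 1 : ℕ) := by positivity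
        linarith [le_barrier (m := m) hε hfar]
      linarith [hG0 (k + 1) y]
    · have hf := isBdd_iterate hw hq hg k
      rw [Function.iterate_succ_apply', mhOp_eq_of_add hw hq₁ hq₂ hadd hf y]
      set f := (mhOp w q)^[k] g with hfdef
      have hf0 : ∀ x, 0 ≤ f x := iterate_nonneg hw hq hg hg0 k
      have hstat : ∫ x, f x * w x = ∫ x, g x * w x := integral_iterate_mul hw hq hg k
      have hwy : 15 / 16 * P ≤ w y := h.flat y hy (by linarith)
      have hwy0 : 0 < w y := by linarith
      -- moves of bounded height
      have h1 : ∫ z, q₁ z * accept w y z * f (y + z) ≤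
          16 / 15 * κ / P * ∫ x, g x * w x := by
        have i1 : Integrable fun z => f (y + z) * w (y + z) :=
          (hf.integrable_mul hw.integrable).comp_add_left y
        have e1 : ∫ z, f (y + z) * w (y + z) = ∫ x, g x * w x := by
          rw [← hstat]; exact integral_add_left_eq_self (fun x => f x * w x) y
        rw [← e1, ← integral_const_mul]
        refine integral_mono (integrable_rate_mul hw hq₁ y (hf.shift_left y)) (i1.const_mul _)
          fun z => ?_
        have h2 : accept w y z ≤ 16 / 15 / P * w (y + z) := by
          refine (min_le_right _ _).trans ?_
          rw [div_le_iff₀ hwy0]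
          calc w (y + z) = 16 / 15 / P * w (y + z) * (15 / 16 * P) := by field_simp
            _ ≤ _ := mul_le_mul_of_nonneg_left hwy
              (mul_nonneg (by positivity) (hw.nonneg _))
        calc q₁ z * accept w y z * f (y + z) ≤ κ * (16 / 15 / P * w (y + z)) * f (y + z) :=
              mul_le_mul_of_nonneg_right (mul_le_mul (hκ z) h2 (accept_nonneg hw _ _) hκ0) (hf0 _)
          _ = 16 / 15 * κ / P * (f (y + z) * w (y + z)) := by ring
      set U : Eu d → ℝ := fun x => G k x + 25 / ε ^ 4 * (barrier m ε x + B * k) with hU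
      have hbb := isBdd_barrier m ε
      have h2 : ∫ z, q₂ z * accept w y z * (f (y + z) - f y) ≤
          (∫ z, q₂ z * accept w y z * (G k (y + z) - G k y)) +
          25 / ε ^ 4 * (∫ z, q₂ z * accept w y z * (barrier m ε (y + z) - barrier m ε y)) +
          (∫ z, q₂ z * accept w y z) * (U y - f y) := by
        have i1 := integrable_mhOp hw hq₂ (hG k) y
        have i2 := (integrable_mhOp hw hq₂ hbb y).const_mul (25 / ε ^ 4)
        have i3 := (integrable_rate hw hq₂ y).mul_const (U y - f y)
        rw [← integral_const_mul, ← integral_mul_const, ← integral_add i1 i2,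
          ← integral_add (i1.fun_add i2) i3]
        refine integral_mono (integrable_mhOp hw hq₂ hf y) ((i1.fun_add i2).fun_add i3) fun z => ?_
        by_cases hz : accept w y z = 0
        · simp [hz]
        · have hzΘ : y + z ∈ Θ := by
            by_contra hc
            refine hz ?_
            rw [accept, h.zero_off _ hc, zero_div]
            exact min_eq_right zero_le_one
          have h3 := ih _ hzΘ
          have h4 : f (y + z) - f y ≤ (G k (y + z) - G k y) +
              25 / ε ^ 4 * (barrier m ε (y + z) - barrier m ε y) + (U y - f y) := by
            simp only [hU]; linarith
          calc q₂ z * accept w y z * (f (y + z) - f y) ≤ q₂ z * accept w y z * _ :=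
                mul_le_mul_of_nonneg_left h4 (mul_nonneg (hq₂.nonneg z) (accept_nonneg hw _ _))
            _ = _ := by ring
      have h3 := h.barrier_drift hmode hq₂ hσ hσε hnear
      have h4 := hstep k y hy hnear
      have h5 : (∫ z, q₁ z * accept w y z) + ∫ z, q₂ z * accept w y z ≤ 1 := by
        rw [← integral_add (integrable_rate hw hq₁ y) (integrable_rate hw hq₂ y)]
        refine le_trans (le_of_eq ?_) (integral_rate_le_one hw hq y)
        congr 1; funext z
        rw [← add_mul, ← hadd z]
      have h6 : f y ≤ U y := ih y hy
      set r₁ := ∫ z, q₁ z * accept w y z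
      set r₂ := ∫ z, q₂ z * accept w y z
      have hr₁ : 0 ≤ r₁ := integral_rate_nonneg hw hq₁ y
      have h7 : (1 - r₁ - r₂) * f y ≤ (1 - r₁ - r₂) * U y :=
        mul_le_mul_of_nonneg_left h6 (by linarith)
      have hUG : (1 - r₁) * U y ≤ (1 - r₁) * G k y + 25 / ε ^ 4 * (barrier m ε y + B * k) := by
        have : 0 ≤ 25 / ε ^ 4 * (barrier m ε y + B * k) := by
          have := barrier_nonneg m ε y; positivity
        have := mul_nonneg hr₁ this
        simp only [hU]; linarith
      have h8 := mul_le_mul_of_nonneg_left h3 (by positivity : 0 ≤ 25 / ε ^ 4)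
      rw [← hv, ← hB] at h8
      push_cast
      linarith

end barrier

/-! ### Smoothing of the chain started near the mode -/

section localSmoothing

variable {d : ℕ} {w : Eu d → ℝ} {Θ : Set (Eu d)} {m : Eu d} {ε P : ℝ}

theorem natCast_mul_le_pow {c : ℝ} (hc : 1 ≤ c) (d : ℕ) : (d : ℝ) * (c - 1) ≤ c ^ d := by
  have := one_add_mul_le_pow (by linarith : (-2 : ℝ) ≤ c - 1) d
  rw [add_sub_cancel] at this
  linarith

/-- The constants of smoothing by small moves and by moves of height at most `κ`, together. Both
are exponential in `d ^ 2`. -/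
theorem smoothConst_bound {d : ℕ} (hd : 0 < d) :
    16 / 15 * (5 / 2) ^ d * (16 / 15 * (5 * (5 / 2) ^ d * (3400 * 10 ^ d * d) ^ d)) +
      6 * (16 / 15) ^ 2 * (5 / 2) ^ d * 1000 ^ (d ^ 2) ≤ ((10 : ℝ) ^ 8) ^ (d ^ 2) := by
  have hD : d ≤ d ^ 2 := Nat.le_self_pow two_ne_zero d
  set D := d ^ 2 with hDdef
  have hD0 : D ≠ 0 := by positivity
  have h1 : (5 / 2 : ℝ) ^ d ≤ (5 / 2) ^ D := pow_le_pow_right₀ (by norm_num) hD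
  have h2 : (3400 * 10 ^ d * d : ℝ) ^ d ≤ 340000 ^ D := by
    have h3 : (d : ℝ) ≤ 10 ^ d := by
      have := natCast_mul_le_pow (c := 10) (by norm_num) d
      have : (0 : ℝ) ≤ d := Nat.cast_nonneg d
      linarith
    have h4 : (3400 : ℝ) ≤ 3400 ^ d := le_self_pow₀ (by norm_num) hd.ne'
    calc (3400 * 10 ^ d * d : ℝ) ^ d ≤ (3400 ^ d * 10 ^ d * 10 ^ d) ^ d := by
          gcongr
      _ = 340000 ^ D := by
          rw [← mul_pow, ← mul_pow, ← pow_mul, hDdef, pow_two]; norm_num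
  have h3 : (13 : ℝ) ≤ 13 ^ D := le_self_pow₀ (by norm_num) hD0
  have h4 : (2500 : ℝ) ^ D ≤ 2125000 ^ D := pow_le_pow_left₀ (by norm_num) (by norm_num) D
  calc 16 / 15 * (5 / 2 : ℝ) ^ d * (16 / 15 * (5 * (5 / 2) ^ d * (3400 * 10 ^ d * d) ^ d)) +
      6 * (16 / 15) ^ 2 * (5 / 2) ^ d * 1000 ^ D
      ≤ 16 / 15 * (5 / 2) ^ D * (16 / 15 * (5 * (5 / 2) ^ D * 340000 ^ D)) +
        6 * (16 / 15) ^ 2 * (5 / 2) ^ D * 1000 ^ D := by gcongr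
    _ = 256 / 45 * 2125000 ^ D + 512 / 75 * 2500 ^ D := by
        have e1 : (2125000 : ℝ) ^ D = (5 / 2) ^ D * (5 / 2) ^ D * 340000 ^ D := by
          rw [← mul_pow, ← mul_pow]; norm_num
        have e2 : (2500 : ℝ) ^ D = (5 / 2) ^ D * 1000 ^ D := by rw [← mul_pow]; norm_num
        rw [e1, e2]; ring
    _ ≤ 13 * 2125000 ^ D := by
        have : (0 : ℝ) ≤ 2125000 ^ D := by positivity
        linarith
    _ ≤ 13 ^ D * 2125000 ^ D := by gcongr
    _ ≤ _ := by
        rw [← mul_pow]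
        exact pow_le_pow_left₀ (by norm_num) (by norm_num) D

/-- The bound left by the Nash inequality once the small moves have added up to a second moment
`V` of order `ε ^ 2 / d`. -/
theorem sqrt_nash_le {d : ℕ} (hd1 : (1 : ℝ) ≤ d) {P ε V : ℝ} (hP : 0 < P) (hε : 0 < ε)
    (hV : 48 / 100 * ε ^ 2 ≤ V * (10 ^ 4 * d)) (hA1 : unitVol d * ε ^ d * P ≤ 16 / 15) :
    Real.sqrt (nashConst d P / Real.sqrt (V / (192 * 10 ^ d * d)) ^ d) ≤
      16 / 15 * (5 * (5 / 2) ^ d * (3400 * 10 ^ d * d) ^ d) / (unitVol d * ε ^ d * P) := by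
  have hω := unitVol_pos d
  have hd : 0 < (d : ℝ) := by linarith
  have h10 : (1 : ℝ) ≤ 10 ^ d := one_le_pow₀ (by norm_num)
  have h6 : ε / (3400 * 10 ^ d * d) ≤ Real.sqrt (V / (192 * 10 ^ d * d)) := by
    refine Real.le_sqrt_of_sq_le ?_
    have h8 : V / (192 * 10 ^ d * d) =
        (V * (10 ^ 4 * d)) / (192 * 10 ^ 4 * 10 ^ d * d ^ 2) := by field_simp
    rw [h8, div_pow, div_le_div_iff₀ (by positivity) (by positivity)]
    have h9 : (10 : ℝ) ^ d ≤ (10 ^ d) ^ 2 := by nlinarith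
    calc ε ^ 2 * (192 * 10 ^ 4 * 10 ^ d * d ^ 2)
        ≤ ε ^ 2 * (48 / 100 * 3400 ^ 2 * (10 ^ d) ^ 2 * d ^ 2) := by
          refine mul_le_mul_of_nonneg_left ?_ (sq_nonneg ε)
          refine mul_le_mul_of_nonneg_right ?_ (sq_nonneg _)
          linarith
      _ = 48 / 100 * ε ^ 2 * (3400 * 10 ^ d * d) ^ 2 := by ring
      _ ≤ _ := mul_le_mul_of_nonneg_right hV (by positivity)
  obtain ⟨Y, hY⟩ : ∃ Y : ℝ, Y = 5 * (5 / 2) ^ d * (3400 * 10 ^ d * d) ^ d := ⟨_, rfl⟩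
  have hY1 : 1 ≤ Y := by
    have h5 : (1 : ℝ) ≤ (5 / 2) ^ d := one_le_pow₀ (by norm_num)
    have h7 : (1 : ℝ) ≤ 3400 * 10 ^ d * d :=
      one_le_mul_of_one_le_of_one_le (by linarith) hd1
    rw [hY]
    exact one_le_mul_of_one_le_of_one_le (by linarith) (one_le_pow₀ h7)
  rw [← hY]
  have hA0 : 0 < unitVol d * ε ^ d * P := by positivity
  refine Real.sqrt_le_iff.2 ⟨by positivity, ?_⟩
  calc nashConst d P / Real.sqrt (V / (192 * 10 ^ d * d)) ^ d
      ≤ nashConst d P / (ε / (3400 * 10 ^ d * d)) ^ d :=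
        div_le_div_of_nonneg_left (by unfold nashConst; positivity) (by positivity)
          (pow_le_pow_left₀ (by positivity) h6 d)
    _ = Y / (unitVol d * ε ^ d * P) := by
        rw [nashConst, hY, div_pow ε (3400 * 10 ^ d * (d : ℝ)) d]
        obtain ⟨y, hy0, hy⟩ : ∃ y : ℝ, 0 < y ∧ y = (3400 * 10 ^ d * d) ^ d :=
          ⟨_, by positivity, rfl⟩
        rw [← hy]
        field_simp
    _ ≤ 16 / 15 * Y / (unitVol d * ε ^ d * P) := div_le_div_of_nonneg_right (by linarith) hA0.le
    _ ≤ (16 / 15 * Y / (unitVol d * ε ^ d * P)) ^ 2 :=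
        le_self_pow₀ ((one_le_div hA0).2 (by linarith)) two_ne_zero

/-- In the time `X` that small moves of second moment `v` take to spread out by a multiple of `ε`,
a move of height at most `2 τ`, with `τ` from `exists_split`, becomes likely. Such moves have mass at
least `v / (2 σ ^ 2)`, where `σ = ε / 1000 ^ d`, and are accepted at rate `15 / 16 (2 / 5) ^ d`. -/
theorem rate_exponent_ge {d : ℕ} (hd : 0 < d) {X v σ ε k : ℝ} (hσ0 : 0 < σ) (hv0 : 0 < v)
    (hσsq : σ ^ 2 * (10 ^ 6) ^ d = ε ^ 2) (hX : X * v * (10 ^ 4 * d) = ε ^ 2)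
    (hk : 49 / 100 * X ≤ k) : 4 ≤ k * (15 / 16 * (2 / 5) ^ d * (v / (2 * σ ^ 2))) := by
  have hd' : (0 : ℝ) < d := by exact_mod_cast hd
  have h5 := natCast_mul_le_pow (c := 400000) (by norm_num) d
  have e2 : (2 / 5 : ℝ) ^ d * (10 ^ 6) ^ d = 400000 ^ d := by rw [← mul_pow]; norm_num
  have eX : X = σ ^ 2 * (10 ^ 6) ^ d / (v * (10 ^ 4 * d)) := by
    rw [hσsq, ← hX]; field_simp
  calc (4 : ℝ) ≤ 49 / 100 * (15 / 16) * (399999 / (2 * 10 ^ 4)) := by norm_num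
    _ ≤ 49 / 100 * (15 / 16) * (400000 ^ d / (2 * 10 ^ 4 * d)) := by
        refine mul_le_mul_of_nonneg_left ?_ (by norm_num)
        rw [div_le_div_iff₀ (by norm_num) (by positivity)]
        nlinarith
    _ = 49 / 100 * X * (15 / 16 * (2 / 5) ^ d * (v / (2 * σ ^ 2))) := by
        rw [← e2, eX]; field_simp
    _ ≤ k * (15 / 16 * (2 / 5) ^ d * (v / (2 * σ ^ 2))) :=
        mul_le_mul_of_nonneg_right hk (by positivity)

theorem exists_nat_mul_between {v B : ℝ} (hv : 0 < v) (hB : 0 ≤ B) :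
    ∃ n : ℕ, n * v ≤ B ∧ B ≤ (n + 1) * v := by
  refine ⟨⌊B / v⌋₊, ?_, ?_⟩
  · rw [← le_div_iff₀ hv]; exact Nat.floor_le (by positivity)
  · rw [← div_le_iff₀ hv]; exact (Nat.lt_floor_add_one (B / v)).le

theorem pow_one_sub_le {x : ℝ} (hx : x ≤ 1) (n : ℕ) (h : 4 ≤ n * x) : (1 - x) ^ n ≤ 1 / 32 := by
  calc (1 - x) ^ n ≤ Real.exp (-x) ^ n :=
        pow_le_pow_left₀ (by linarith) (by linarith [Real.add_one_le_exp (-x)]) n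
    _ = Real.exp (-(n * x)) := by rw [← Real.exp_nat_mul]; congr 1; ring
    _ ≤ Real.exp (-4) := Real.exp_le_exp.2 (by linarith)
    _ ≤ 1 / 32 := by
        rw [Real.exp_neg, ← one_div]
        refine one_div_le_one_div_of_le (by norm_num) ?_
        have h1 : (2.7 : ℝ) ≤ Real.exp 1 := by linarith [Real.exp_one_gt_d9]
        have h2 : Real.exp 4 = Real.exp 1 ^ 4 := by rw [← Real.exp_nat_mul]; norm_num
        rw [h2]
        calc (32 : ℝ) ≤ 2.7 ^ 4 := by norm_num
          _ ≤ _ := pow_le_pow_left₀ (by norm_num) h1 4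

namespace FlatMode

theorem accept_flatWeight_le (h : FlatMode w Θ m ε P) {y : Eu d} (hy : y ∈ flatRegion Θ m ε)
    (z : Eu d) : accept (flatWeight w m ε) y z ≤ accept w y z := by
  refine min_le_min le_rfl ?_
  rw [flatWeight_eq hy]
  exact div_le_div_of_nonneg_right (indicator_le_self' (fun x _ => h.weight.nonneg x) _)
    (h.weight.nonneg y)

theorem accept_flatWeight_eq (h : FlatMode w Θ m ε P) {y z : Eu d}
    (hy : ‖y - m‖ ≤ 11 / 10 * ε) (hz : ‖z‖ ≤ 2 / 5 * ε) :
    accept (flatWeight w m ε) y z = accept w y z := by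
  have hε := h.eps_pos
  have h1 : ‖y + z - m‖ ≤ 3 / 2 * ε := by
    have : y + z - m = (y - m) + z := by abel
    rw [this]
    exact (norm_add_le _ _).trans (by linarith)
  unfold accept flatWeight
  rw [indicator_of_mem (mem_closedBall_iff_norm.2 h1),
    indicator_of_mem (mem_closedBall_iff_norm.2 (by linarith))]

/-- The target mass bounds the volume of the `ε`-ball around the mode. -/
theorem unitVol_mul_le [NeZero d] (h : FlatMode w Θ m ε P) (hw1 : ∫ x, w x ≤ 1) :
    15 / 16 * (unitVol d * ε ^ d * P) ≤ 1 := by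
  have hε := h.eps_pos
  calc 15 / 16 * (unitVol d * ε ^ d * P) = ∫ _ in Metric.ball m ε, 15 / 16 * P := by
        rw [setIntegral_const, smul_eq_mul, volume_real_ball _ hε]; ring
    _ ≤ ∫ x in Metric.ball m ε, w x :=
        setIntegral_mono_on (integrableOn_const measure_ball_lt_top.ne)
          h.weight.integrable.integrableOn Metric.isOpen_ball.measurableSet fun x hx => by
            have hx' := mem_ball_iff_norm.1 hx
            exact h.flat x (h.ball_subset (Metric.ball_subset_closedBall hx)) (by linarith)
    _ ≤ ∫ x, w x := setIntegral_le_integral h.weight.integrable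
        (Filter.Eventually.of_forall h.weight.nonneg)
    _ ≤ 1 := hw1

theorem integral_mul_le_sqrt (hw : IsWeight w) (hw1 : ∫ x, w x ≤ 1) (g : bddMeas d) :
    ∫ x, g.1 x * w x ≤ Real.sqrt (wInner hw g g) := by
  refine Real.le_sqrt_of_sq_le ?_
  have h1 := wInner_sq_le hw ⟨fun _ => 1, IsBdd.const 1⟩ g
  have e1 : wInner hw ⟨fun _ => 1, IsBdd.const 1⟩ g = ∫ x, g.1 x * w x := by
    rw [wInner_apply]; simp
  have e2 : wInner hw ⟨fun _ => 1, IsBdd.const 1⟩ ⟨fun _ => 1, IsBdd.const 1⟩ = ∫ x, w x := by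
    rw [wInner_apply]; simp
  rw [e1, e2] at h1
  exact h1.trans (mul_le_of_le_one_left (wInner_self_nonneg hw g) hw1)

theorem sqrt_wInner_flat_le (h : FlatMode w Θ m ε P) (g : bddMeas d) :
    Real.sqrt (wInner (isWeight_flatWeight h.weight m ε) g g) ≤
      Real.sqrt (wInner h.weight g g) := by
  refine Real.sqrt_le_sqrt ?_
  rw [wInner_apply, wInner_apply]
  have hb := (isBdd_coe g).mul (isBdd_coe g)
  refine integral_mono (hb.integrable_mul (isWeight_flatWeight h.weight m ε).integrable)
    (hb.integrable_mul h.weight.integrable) fun x => ?_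
  exact mul_le_mul_of_nonneg_left (indicator_le_self' (fun x _ => h.weight.nonneg x) _)
    (mul_self_nonneg _)

/-- The growth of the barrier over `n` small moves of second moment `v`, relative to its value off
the ball of radius `11 / 10 ε`, which is at least `ε ^ 4 / 25`. The factor `10 ^ 4` in the bound on
`n * v` makes this small. -/
theorem drift_error_le {ε D v n : ℝ} (hε : 0 < ε) (hD : 0 < D)
    (hv : n * v ≤ ε ^ 2 / (10 ^ 4 * D)) :
    25 / ε ^ 4 * (11 * D * ε ^ 2 * v * n) ≤ 1 / 32 := by
  calc 25 / ε ^ 4 * (11 * D * ε ^ 2 * v * n) = 275 * D / ε ^ 2 * (n * v) := by field_simp; ring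
    _ ≤ 275 * D / ε ^ 2 * (ε ^ 2 / (10 ^ 4 * D)) := mul_le_mul_of_nonneg_left hv (by positivity)
    _ = 275 / 10 ^ 4 := by field_simp
    _ ≤ 1 / 32 := by norm_num

/-- Proposals of height at most `κ` are frequent: the chain is regenerated before its small moves
spread it out by `ε`. -/
theorem smoothing_of_frequent [NeZero d] (h : FlatMode w Θ m ε P) (hmode : ∀ x, w x ≤ w m)
    {q : Eu d → ℝ} (hq : IsProposal q) {σ κ : ℝ} (hσε : σ ≤ 2 / 5 * ε) (hκ0 : 0 ≤ κ)
    (hκ : ∀ x, σ < ‖x‖ → q x ≤ κ) {b : ℝ} (hb0 : 0 < b)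
    (hb : b = ∫ x, (Metric.closedBall 0 ε).indicator (fun x => min (q x) κ) x) {n : ℕ}
    (hn : 5 / (15 / 16 * (2 / 5) ^ d * b) ≤ n)
    (hv : n * (∫ x, max (q x - κ) 0 * ‖x‖ ^ 2) ≤ ε ^ 2 / (10 ^ 4 * d))
    (g : bddMeas d) (hg0 : ∀ x, 0 ≤ g.1 x) (hg1 : ∀ x, g.1 x ≤ 1) {x : Eu d}
    (hx : ‖x - m‖ ≤ ε) :
    (mhOp w q)^[n] g.1 x ≤
      1 / 16 + 16 / 15 * κ / P * (∫ x, g.1 x * w x) / (15 / 16 * (2 / 5) ^ d * b) := by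
  have hε := h.eps_pos
  have hP := h.max_pos
  have hw := h.weight
  have hd : 0 < (d : ℝ) := by exact_mod_cast Nat.pos_of_ne_zero (NeZero.ne d)
  set a : ℝ := 15 / 16 * (2 / 5) ^ d with ha
  have ha0 : 0 < a := by positivity
  set c := 16 / 15 * κ / P * ∫ x, g.1 x * w x with hc
  have hc0 : 0 ≤ c := mul_nonneg (by positivity)
    (integral_nonneg fun x => mul_nonneg (hg0 x) (hw.nonneg x))
  have hq₁ : IsProposal fun x => min (q x) κ := hq.trunc hκ0
  have hq₂ : IsProposal fun x => max (q x - κ) 0 := hq.excess hκ0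
  have hq₃ := hq₁.near ε
  have hsupp : ∀ x, σ < ‖x‖ → max (q x - κ) 0 = 0 := fun x hx =>
    max_eq_right (by linarith [hκ x hx])
  have hab : a * b ≤ 1 := by
    have h1 : a ≤ 1 := by
      have : (2 / 5 : ℝ) ^ d ≤ 1 := pow_le_one₀ (by norm_num) (by norm_num)
      rw [ha]; linarith
    exact mul_le_one₀ h1 hb0.le (hb ▸ hq₃.integral_le_one)
  have hab0 : 0 < a * b := by positivity
  have hC0 : ∀ k : ℕ, 0 ≤ c / (a * b) + (1 - a * b) ^ k := fun k =>
    add_nonneg (by positivity) (pow_nonneg (by linarith) k)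
  have key := h.iterate_le_of_barrier hmode hq hq₁ hq₂ (fun x => by
      rcases le_total (q x) κ with h' | h'
      · rw [min_eq_left h', max_eq_right (sub_nonpos.2 h'), add_zero]
      · rw [min_eq_right h', max_eq_left (sub_nonneg.2 h')]; ring)
    hsupp hσε (κ := κ) (fun x => min_le_right _ _) (isBdd_coe g) hg0 hg1
    (G := fun k _ => c / (a * b) + (1 - a * b) ^ k) (fun k => IsBdd.const _) (fun k _ => hC0 k)
    (fun x => by
      have : 0 ≤ c / (a * b) := by positivity
      rw [pow_zero]; linarith [hg1 x])
    (fun k y hy hym => by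
      have hyF : y ∈ flatRegion Θ m ε := ⟨hy, mem_closedBall_iff_norm.2 (by linarith)⟩
      have h1 : a * b ≤ ∫ z, min (q z) κ * accept w y z := by
        have h2 := h.acceptance_ge hq₃ (ρ := ε) (fun x hx => indicator_of_notMem
          (fun hc => absurd (mem_closedBall_zero_iff.1 hc) (not_le.2 hx)) _) (by linarith) hyF
        rw [← hb] at h2
        refine h2.trans (integral_mono (integrable_rate (isWeight_flatWeight hw m ε) hq₃ y)
          (integrable_rate hw hq₁ y) fun z => mul_le_mul
            (indicator_le_self' (fun x _ => hq₁.nonneg x) _) (h.accept_flatWeight_le hyF z)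
            (accept_nonneg (isWeight_flatWeight hw m ε) _ _) (hq₁.nonneg z))
      simp only [sub_self, mul_zero, integral_zero, add_zero]
      have h3 := mul_le_mul_of_nonneg_right h1 (hC0 k)
      have e1 : c / (a * b) + (1 - a * b) ^ (k + 1) =
          c + (1 - a * b) * (c / (a * b) + (1 - a * b) ^ k) := by
        rw [pow_succ]; field_simp; ring
      rw [e1]
      linarith) n x (h.ball_subset (mem_closedBall_iff_norm.2 hx))
  rw [barrier_eq_zero hx, zero_add] at key
  have h1 : (1 - a * b) ^ n ≤ 1 / 32 := by
    refine pow_one_sub_le hab n ?_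
    rw [div_le_iff₀ hab0] at hn
    linarith
  have h3 := drift_error_le hε hd hv
  linarith

/-- Up to the effect of the proposals of height at most `κ`, and as long as it is not spread out by
`ε`, the chain started near the mode is the chain of the small moves on the flat region. -/
theorem iterate_le_small_moves [NeZero d] (h : FlatMode w Θ m ε P) (hmode : ∀ x, w x ≤ w m)
    {q : Eu d → ℝ} (hq : IsProposal q) {σ κ : ℝ} (hσε : σ ≤ 2 / 5 * ε) (hκ0 : 0 ≤ κ)
    (hκ : ∀ x, σ < ‖x‖ → q x ≤ κ) {n : ℕ}
    (hn : n * (∫ x, max (q x - κ) 0 * ‖x‖ ^ 2) ≤ ε ^ 2 / (10 ^ 4 * d))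
    (g : bddMeas d) (hg0 : ∀ x, 0 ≤ g.1 x) (hg1 : ∀ x, g.1 x ≤ 1) {x : Eu d}
    (hx : ‖x - m‖ ≤ ε) :
    (mhOp w q)^[n] g.1 x ≤
      (mhOp (flatWeight w m ε) fun x => max (q x - κ) 0)^[n] g.1 x +
        n * (16 / 15 * κ / P * ∫ x, g.1 x * w x) + 1 / 32 := by
  have hε := h.eps_pos
  have hP := h.max_pos
  have hw := h.weight
  have hd : 0 < (d : ℝ) := by exact_mod_cast Nat.pos_of_ne_zero (NeZero.ne d)
  set c := 16 / 15 * κ / P * ∫ x, g.1 x * w x with hc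
  have hc0 : 0 ≤ c := mul_nonneg (by positivity)
    (integral_nonneg fun x => mul_nonneg (hg0 x) (hw.nonneg x))
  set q₂ : Eu d → ℝ := fun x => max (q x - κ) 0 with hq₂def
  have hq₁ : IsProposal fun x => min (q x) κ := hq.trunc hκ0
  have hq₂ : IsProposal q₂ := hq.excess hκ0
  have hsupp : ∀ x, σ < ‖x‖ → q₂ x = 0 := fun x hx =>
    max_eq_right (by linarith [hκ x hx])
  set wF := flatWeight w m ε with hwF
  have hwf : IsWeight wF := isWeight_flatWeight hw m ε
  have key := h.iterate_le_of_barrier hmode hq hq₁ hq₂ (fun x => by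
      rcases le_total (q x) κ with h' | h'
      · simp only [hq₂def, min_eq_left h', max_eq_right (sub_nonpos.2 h'), add_zero]
      · simp only [hq₂def, min_eq_right h', max_eq_left (sub_nonneg.2 h')]; ring)
    hsupp hσε (κ := κ) (fun x => min_le_right _ _) (isBdd_coe g) hg0 hg1
    (G := fun k x => (mhOp wF q₂)^[k] g.1 x + k * c)
    (fun k => (isBdd_iterate hwf hq₂ (isBdd_coe g) k).add' (IsBdd.const _))
    (fun k x => add_nonneg (iterate_nonneg hwf hq₂ (isBdd_coe g) hg0 k x) (by positivity))
    (fun x => by simp)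
    (fun k y hy hym => by
      have h0 := iterate_nonneg hwf hq₂ (isBdd_coe g) hg0 k y
      have h1 := integral_rate_nonneg hw hq₁ y
      have e1 : ∀ z, q₂ z * accept w y z * ((mhOp wF q₂)^[k] g.1 (y + z) + k * c -
          ((mhOp wF q₂)^[k] g.1 y + k * c)) =
          q₂ z * accept wF y z * ((mhOp wF q₂)^[k] g.1 (y + z) - (mhOp wF q₂)^[k] g.1 y) := by
        intro z
        by_cases hz : ‖z‖ ≤ σ
        · rw [hwF, h.accept_flatWeight_eq hym (hz.trans hσε)]; ring
        · rw [hsupp z (not_le.1 hz)]; ring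
      simp only [e1]
      rw [Function.iterate_succ_apply']
      change _ ≤ ((mhOp wF q₂)^[k] g.1 y + ∫ z, q₂ z * accept wF y z *
        ((mhOp wF q₂)^[k] g.1 (y + z) - (mhOp wF q₂)^[k] g.1 y)) + ((k + 1 : ℕ) : ℝ) * c
      push_cast
      have h2 : 0 ≤ (∫ z, min (q z) κ * accept w y z) *
          ((mhOp wF q₂)^[k] g.1 y + k * c) := by positivity
      linarith) n x (h.ball_subset (mem_closedBall_iff_norm.2 hx))
  rw [barrier_eq_zero hx, zero_add] at key
  have h3 := drift_error_le hε hd hn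
  linarith

/-- If the small moves spread out the law by about `ε` in `n` steps, then they smooth it. -/
theorem smoothing_small_moves [NeZero d] (h : FlatMode w Θ m ε P) (hw1 : ∫ x, w x ≤ 1)
    {q : Eu d → ℝ} (hq : IsProposal q) {C : ℝ} (hC : ∀ x, q x ≤ C)
    {σ : ℝ} (hσ : σ = ε / 1000 ^ d) (hsupp : ∀ x, σ < ‖x‖ → q x = 0)
    {v : ℝ} (hv : v = ∫ x, q x * ‖x‖ ^ 2) (hv0 : 0 < v) {n : ℕ}
    (hnX : n * v * (10 ^ 4 * d) ≤ ε ^ 2) (hnX' : ε ^ 2 ≤ (n + 1) * v * (10 ^ 4 * d))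
    (g : bddMeas d) (hg1 : ∀ x, g.1 x ≤ 1) {x : Eu d} (hx : ‖x - m‖ ≤ ε) :
    (mhOp (flatWeight w m ε) q)^[n] g.1 x ≤
      1 / 32 + 16 / 15 * (5 / 2) ^ d * (16 / 15 * (5 * (5 / 2) ^ d * (3400 * 10 ^ d * d) ^ d)) /
        (unitVol d * ε ^ d * P) * Real.sqrt (wInner h.weight g g) := by
  have hε := h.eps_pos
  have hP := h.max_pos
  have hω := unitVol_pos d
  have hdN : 1 ≤ d := Nat.pos_of_ne_zero (NeZero.ne d)
  have hd1 : (1 : ℝ) ≤ d := by exact_mod_cast hdN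
  have hd : 0 < (d : ℝ) := by linarith
  have hσ0 : 0 < σ := by rw [hσ]; positivity
  have hσε : σ ≤ 2 / 5 * ε := by
    rw [hσ, div_le_iff₀ (by positivity)]
    have : (1000 : ℝ) ≤ 1000 ^ d := le_self_pow₀ (by norm_num) (by omega)
    nlinarith
  have hvσ : v ≤ σ ^ 2 := by
    rw [hv]
    exact (second_moment_le hq hsupp).trans
      (mul_le_of_le_one_right (sq_nonneg σ) hq.integral_le_one)
  have hσsq : σ ^ 2 * (10 ^ 6) ^ d = ε ^ 2 := by
    rw [hσ, div_pow, ← pow_mul, mul_comm d 2, pow_mul]; norm_num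
  have hvd : 0 < v * (10 ^ 4 * d) := by positivity
  obtain ⟨X, hX⟩ : ∃ X, X = ε ^ 2 / (v * (10 ^ 4 * d)) := ⟨_, rfl⟩
  have hXv : X * v * (10 ^ 4 * d) = ε ^ 2 := by rw [hX]; field_simp
  have hnX1 : (n : ℝ) ≤ X := by rw [hX, le_div_iff₀ hvd]; linarith
  have hnX2 : X ≤ n + 1 := by rw [hX, div_le_iff₀ hvd]; linarith
  -- the number of steps is large
  have hX99 : 99 ≤ X := by
    rw [hX, le_div_iff₀ (by positivity)]
    have h1 := natCast_mul_le_pow (c := 10 ^ 6) (by norm_num) d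
    calc 99 * (v * (10 ^ 4 * d)) = v * (d * (99 * 10 ^ 4)) := by ring
      _ ≤ v * (d * (10 ^ 6 - 1)) := by gcongr; norm_num
      _ ≤ σ ^ 2 * (10 ^ 6) ^ d :=
          mul_le_mul hvσ h1 (mul_nonneg hd.le (by norm_num)) (by positivity)
      _ = ε ^ 2 := hσsq
  obtain ⟨n₁, k, hk, hn₁a, hn₁b⟩ : ∃ n₁ k : ℕ, n = n₁ + k ∧ 2 * n₁ ≤ n ∧ n ≤ 2 * n₁ + 1 :=
    ⟨n / 2, n - n / 2, by omega, by omega, by omega⟩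
  have hn₁a' : 2 * (n₁ : ℝ) ≤ n := by exact_mod_cast hn₁a
  have hn₁b' : (n : ℝ) ≤ 2 * n₁ + 1 := by exact_mod_cast hn₁b
  have hk' : (n : ℝ) = n₁ + k := by exact_mod_cast hk
  have hn₁0 : (0 : ℝ) < n₁ := by linarith
  have hxF : x ∈ flatRegion Θ m ε :=
    ⟨h.ball_subset (mem_closedBall_iff_norm.2 hx), mem_closedBall_iff_norm.2 (by linarith)⟩
  have h10 : (1 : ℝ) ≤ 10 ^ d := one_le_pow₀ (by norm_num)
  have smooth := h.smoothing hq hσ0 (by linarith) hsupp (c := C) hC (hv ▸ hv0) (n := n₁)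
    (by
      rw [← hv]
      have h5 : v / (192 * 10 ^ d * d) * n₁ ≤ ε ^ 2 := by
        rw [← hXv, div_mul_eq_mul_div, div_le_iff₀ (by positivity)]
        have h6 : v * n₁ ≤ v * X := mul_le_mul_of_nonneg_left (by linarith) hv0.le
        have h7 : (1 : ℝ) ≤ 10 ^ 4 * d * (192 * 10 ^ d * d) := by
          have h8 : (1 : ℝ) ≤ 192 * 10 ^ d * d := by nlinarith
          nlinarith
        calc v * n₁ ≤ X * v * 1 := by linarith
          _ ≤ X * v * (10 ^ 4 * d * (192 * 10 ^ d * d)) :=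
              mul_le_mul_of_nonneg_left h7 (by positivity)
          _ = _ := by ring
      have h6 : σ ^ 2 ≤ (2 / 5 * ε) ^ 2 := pow_le_pow_left₀ hσ0.le hσε 2
      nlinarith [sq_nonneg ε])
    (by exact_mod_cast hn₁0) g hg1 k x hxF
  rw [← hk, ← hv] at smooth
  -- the moves at the scale of the second moment
  have h4 : (1 - 15 / 16 * (2 / 5) ^ d * (v / (2 * σ ^ 2))) ^ k ≤ 1 / 32 := by
    have ha1 : (2 / 5 : ℝ) ^ d ≤ 1 := pow_le_one₀ (by norm_num) (by norm_num)
    have hvσ' : v / (2 * σ ^ 2) ≤ 1 := (div_le_one (by positivity)).2 (by linarith)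
    refine pow_one_sub_le (by
      have : (2 / 5 : ℝ) ^ d * (v / (2 * σ ^ 2)) ≤ 1 := mul_le_one₀ ha1 (by positivity) hvσ'
      have : 0 ≤ (2 / 5 : ℝ) ^ d * (v / (2 * σ ^ 2)) := by positivity
      linarith) k ?_
    exact rate_exponent_ge hdN hσ0 hv0 hσsq hXv (by linarith)
  -- the spread after the first half of the steps
  have h5 := sqrt_nash_le (d := d) hd1 hP hε (V := v * n₁) (by
      rw [← hXv]
      have h8 : 48 / 100 * X ≤ n₁ := by linarith
      have := mul_le_mul_of_nonneg_left h8 hvd.le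
      linarith) (by linarith [h.unitVol_mul_le hw1])
  rw [← div_mul_eq_mul_div] at h5
  have h6 := h.sqrt_wInner_flat_le g
  refine smooth.trans ?_
  rw [add_comm]
  refine add_le_add h4 ?_
  refine (mul_le_mul_of_nonneg_left (mul_le_mul h5 h6 (Real.sqrt_nonneg _) (by positivity))
    (by positivity)).trans (le_of_eq ?_)
  ring

/-- The effect of the proposals of height at most `κ` over the time in which they regenerate the
chain. -/
theorem effect_of_height_le [NeZero d] (h : FlatMode w Θ m ε P) (hw1 : ∫ x, w x ≤ 1) {κ b : ℝ}
    (hε : 0 < ε) (hb0 : 0 < b)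
    (hκb : κ * ((ε / 1000 ^ d) ^ d * unitVol d) ≤ b) (g : bddMeas d) (hg0 : ∀ x, 0 ≤ g.1 x) :
    6 * (16 / 15 * κ / P * (∫ x, g.1 x * w x) / (15 / 16 * (2 / 5) ^ d * b)) ≤
      6 * (16 / 15) ^ 2 * (5 / 2) ^ d * 1000 ^ (d ^ 2) / (unitVol d * ε ^ d * P) *
        Real.sqrt (wInner h.weight g g) := by
  have hP := h.max_pos
  have hω := unitVol_pos d
  have h0 : 0 ≤ ∫ x, g.1 x * w x :=
    integral_nonneg fun x => mul_nonneg (hg0 x) (h.weight.nonneg x)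
  have h1 := integral_mul_le_sqrt h.weight hw1 g
  have h2 : κ / b ≤ 1000 ^ (d ^ 2) / (ε ^ d * unitVol d) := by
    rw [div_pow, ← pow_mul, ← pow_two, div_mul_eq_mul_div, mul_div_assoc',
      div_le_iff₀ (by positivity)] at hκb
    rw [div_le_div_iff₀ hb0 (by positivity)]
    linarith
  have e52 : 1 / (15 / 16 * (2 / 5 : ℝ) ^ d) = 16 / 15 * (5 / 2) ^ d := by
    have : (2 / 5 : ℝ) ^ d * (5 / 2) ^ d = 1 := by rw [← mul_pow]; norm_num
    rw [div_eq_iff (by positivity)]; linear_combination -this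
  calc 6 * (16 / 15 * κ / P * (∫ x, g.1 x * w x) / (15 / 16 * (2 / 5) ^ d * b))
      = 6 * (16 / 15) * (1 / (15 / 16 * (2 / 5 : ℝ) ^ d)) * (κ / b) / P *
          ∫ x, g.1 x * w x := by field_simp
    _ ≤ 6 * (16 / 15) * (1 / (15 / 16 * (2 / 5 : ℝ) ^ d)) *
          (1000 ^ (d ^ 2) / (ε ^ d * unitVol d)) / P *
          Real.sqrt (wInner h.weight g g) := by gcongr
    _ = _ := by rw [e52]; field_simp

/-- Smoothing of the chain started within `ε` of the mode, in a number of steps proportional to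
`δ⁻¹`: up to an error of `1 / 16`, the law has a density that is bounded in square norm. -/
theorem local_smoothing [NeZero d] (h : FlatMode w Θ m ε P) (hmode : ∀ x, w x ≤ w m)
    (hw1 : ∫ x, w x ≤ 1) {q : Eu d → ℝ} (hq : IsProposal q) {C : ℝ} (hC : ∀ x, q x ≤ C)
    {δ : ℝ} (hδ : 0 < δ) (hqδ : ∀ x, ‖x‖ ≤ ε → δ / (unitVol d * ε ^ d) ≤ q x) :
    ∃ n : ℕ, (n : ℝ) ≤ 8 * (5 / 2) ^ d / δ ∧ ∀ g : bddMeas d, (∀ x, 0 ≤ g.1 x) →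
      (∀ x, g.1 x ≤ 1) → ∀ x, ‖x - m‖ ≤ ε → (mhOp w q)^[n] g.1 x ≤
        1 / 16 + (10 ^ 8) ^ (d ^ 2) / (unitVol d * ε ^ d * P) *
          Real.sqrt (wInner h.weight g g) := by
  have hε := h.eps_pos
  have hP := h.max_pos
  have hw := h.weight
  have hω := unitVol_pos d
  have hdN : 0 < d := Nat.pos_of_ne_zero (NeZero.ne d)
  have hd : 0 < (d : ℝ) := by exact_mod_cast hdN
  -- `σ` is so small that small moves take long to spread out the law, see `rate_exponent_ge`, and
  -- so large that `κ / δ` is bounded independently of `q`, see `hκb`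
  set σ := ε / 1000 ^ d with hσ
  have hσ0 : 0 < σ := by positivity
  have hσε : σ ≤ 2 / 5 * ε := by
    rw [hσ, div_le_iff₀ (by positivity)]
    have : (1000 : ℝ) ≤ 1000 ^ d := le_self_pow₀ (by norm_num) (by omega)
    nlinarith
  obtain ⟨z₀, hz₀⟩ : ∃ z : Eu d, ‖z‖ = σ := by
    refine ⟨EuclideanSpace.single 0 σ, ?_⟩
    rw [PiLp.norm_single, Real.norm_of_nonneg hσ0.le]
  set κ := q z₀ with hκdef
  have hκ : ∀ x, σ < ‖x‖ → q x ≤ κ := fun x hx => hq.antitone _ _ (by rw [hz₀]; exact hx.le)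
  have hκ0 : 0 ≤ κ := hq.nonneg _
  have hq₁ : IsProposal fun x => min (q x) κ := hq.trunc hκ0
  have hq₃ := hq₁.near ε
  set b := ∫ x, (Metric.closedBall 0 ε).indicator (fun x => min (q x) κ) x with hb
  have hball : (volume : Measure (Eu d)).real (Metric.closedBall 0 ε) = ε ^ d * unitVol d := by
    rw [Measure.addHaar_real_closedBall_eq_addHaar_real_ball, volume_real_ball _ hε]
  have hbδ : δ ≤ b := by
    calc δ = ∫ x in Metric.closedBall (0 : Eu d) ε, δ / (unitVol d * ε ^ d) := by
          rw [setIntegral_const, smul_eq_mul, hball]; field_simp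
      _ ≤ ∫ x in Metric.closedBall (0 : Eu d) ε, min (q x) κ :=
          setIntegral_mono_on (integrableOn_const measure_closedBall_lt_top.ne)
            hq₁.integrable.integrableOn Metric.isClosed_closedBall.measurableSet fun x hx =>
            le_min (hqδ x (mem_closedBall_zero_iff.1 hx)) (hqδ z₀ (by linarith))
      _ = b := (integral_indicator Metric.isClosed_closedBall.measurableSet).symm
  have hb0 : 0 < b := lt_of_lt_of_le hδ hbδ
  have hb1 : b ≤ 1 := hq₃.integral_le_one
  have hκb : κ * (σ ^ d * unitVol d) ≤ b := by
    calc κ * (σ ^ d * unitVol d) = ∫ x in Metric.ball (0 : Eu d) σ, κ := by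
          rw [setIntegral_const, smul_eq_mul, volume_real_ball _ hσ0, mul_comm]
      _ ≤ ∫ x in Metric.ball (0 : Eu d) σ,
            (Metric.closedBall 0 ε).indicator (fun x => min (q x) κ) x :=
          setIntegral_mono_on (integrableOn_const measure_ball_lt_top.ne)
            hq₃.integrable.integrableOn Metric.isOpen_ball.measurableSet fun x hx => by
              have hx' := mem_ball_zero_iff.1 hx
              rw [indicator_of_mem (mem_closedBall_zero_iff.2 (by linarith))]
              exact le_min (hq.antitone _ _ (by rw [hz₀]; exact hx'.le)) le_rfl
      _ ≤ b := setIntegral_le_integral hq₃.integrable (Filter.Eventually.of_forall hq₃.nonneg)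
  set a : ℝ := 15 / 16 * (2 / 5) ^ d with ha
  have ha0 : 0 < a := by positivity
  have ha1 : a ≤ 1 := by
    have : (2 / 5 : ℝ) ^ d ≤ 1 := pow_le_one₀ (by norm_num) (by norm_num)
    rw [ha]; linarith
  have e52 : (2 / 5 : ℝ) ^ d * (5 / 2) ^ d = 1 := by rw [← mul_pow]; norm_num
  have hainv : 1 / a = 16 / 15 * (5 / 2) ^ d := by
    rw [div_eq_iff ha0.ne', ha]; linear_combination -e52
  set v := ∫ x, max (q x - κ) 0 * ‖x‖ ^ 2 with hv
  set N := ⌈5 / (a * b)⌉₊ with hN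
  have hab0 : 0 < a * b := by positivity
  have hab1 : a * b ≤ 1 := mul_le_one₀ ha1 hb0.le hb1
  have hN1 : 5 / (a * b) ≤ N := Nat.le_ceil _
  have hN2 : (N : ℝ) ≤ 6 / (a * b) := by
    have h1 : (N : ℝ) < 5 / (a * b) + 1 := Nat.ceil_lt_add_one (by positivity)
    have h2 : 1 ≤ 1 / (a * b) := (one_le_div hab0).2 hab1
    have h3 : 6 / (a * b) = 5 / (a * b) + 1 / (a * b) := by ring
    linarith
  have hN3 : (N : ℝ) ≤ 8 * (5 / 2) ^ d / δ := by
    refine hN2.trans ?_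
    calc 6 / (a * b) = 6 * (1 / a) / b := by field_simp
      _ ≤ 6 * (1 / a) / δ := div_le_div_of_nonneg_left (by positivity) hδ hbδ
      _ ≤ 8 * (5 / 2) ^ d / δ := by
          rw [hainv]
          refine div_le_div_of_nonneg_right ?_ hδ.le
          have : (0 : ℝ) ≤ (5 / 2) ^ d := by positivity
          linarith
  set A := unitVol d * ε ^ d * P with hA
  have hA0 : 0 < A := by positivity
  obtain ⟨Λ, hΛ⟩ : ∃ Λ : ℝ, Λ = (10 ^ 8) ^ (d ^ 2) := ⟨_, rfl⟩
  obtain ⟨Y, hY⟩ : ∃ Y : ℝ, Y =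
    16 / 15 * (5 / 2) ^ d * (16 / 15 * (5 * (5 / 2) ^ d * (3400 * 10 ^ d * d) ^ d)) := ⟨_, rfl⟩
  obtain ⟨Z, hZ⟩ : ∃ Z : ℝ, Z = 6 * (16 / 15) ^ 2 * (5 / 2) ^ d * 1000 ^ (d ^ 2) := ⟨_, rfl⟩
  have hY0 : 0 ≤ Y := by rw [hY]; positivity
  have hΛYZ : Y + Z ≤ Λ := by rw [hΛ, hY, hZ]; exact smoothConst_bound hdN
  have hbig : ∀ g : bddMeas d, (∀ x, 0 ≤ g.1 x) →
      6 * (16 / 15 * κ / P * (∫ x, g.1 x * w x) / (a * b)) ≤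
        Z / A * Real.sqrt (wInner hw g g) := by
    intro g hg0
    have h1 := h.effect_of_height_le hw1 hε hb0 (by rwa [hσ] at hκb) g hg0
    rw [← hZ, ← hA, ← ha] at h1
    exact h1
  have hconst : ∀ S : ℝ, 0 ≤ S → Y / A * S + Z / A * S ≤ Λ / A * S := fun S hS => by
    rw [← add_mul, ← add_div]
    exact mul_le_mul_of_nonneg_right (div_le_div_of_nonneg_right hΛYZ hA0.le) hS
  rw [← hΛ]
  -- within `N` steps a move of height at most `κ` is likely; the cases are whether the small moves
  -- spread out the law before that
  rcases le_or_gt (N * v) (ε ^ 2 / (10 ^ 4 * d)) with hc | hc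
  · refine ⟨N, hN3, fun g hg0 hg1 x hx => ?_⟩
    have h1 := h.smoothing_of_frequent hmode hq hσε hκ0 hκ hb0 hb hN1 hc g hg0 hg1 hx
    have h2 := hbig g hg0
    have h3 : 0 ≤ 16 / 15 * κ / P * (∫ x, g.1 x * w x) / (a * b) := by
      have : 0 ≤ ∫ x, g.1 x * w x := integral_nonneg fun x => mul_nonneg (hg0 x) (hw.nonneg x)
      positivity
    have h4 := hconst _ (Real.sqrt_nonneg (wInner hw g g))
    have h5 : 0 ≤ Y / A * Real.sqrt (wInner hw g g) := by positivity
    linarith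
  · have hv0 : 0 < v := by
      have h1 : 0 < N * v := lt_of_le_of_lt (by positivity) hc
      by_contra hcon
      exact absurd h1 (not_lt.2 (mul_nonpos_of_nonneg_of_nonpos (Nat.cast_nonneg N)
        (not_lt.1 hcon)))
    obtain ⟨n, hn1, hn2⟩ := exists_nat_mul_between hv0
      (by positivity : 0 ≤ ε ^ 2 / (10 ^ 4 * (d : ℝ)))
    have hnN : (n : ℝ) ≤ N := (lt_of_mul_lt_mul_right (lt_of_le_of_lt hn1 hc) hv0.le).le
    refine ⟨n, hnN.trans hN3, fun g hg0 hg1 x hx => ?_⟩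
    have h1 := h.iterate_le_small_moves hmode hq hσε hκ0 hκ hn1 g hg0 hg1 hx
    have hD : (0 : ℝ) < 10 ^ 4 * d := by positivity
    have h3 := h.smoothing_small_moves hw1 (hq.excess hκ0)
      (fun x => max_le (by linarith [hC x]) ((hq.nonneg x).trans (hC x))) hσ
      (fun x hx => max_eq_right (by linarith [hκ x hx])) hv hv0
      ((le_div_iff₀ hD).1 hn1) ((div_le_iff₀ hD).1 hn2) g hg1 hx
    rw [← hA, ← hY] at h3
    have h2 := hbig g hg0
    have h4 := hconst _ (Real.sqrt_nonneg (wInner hw g g))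
    have h5 : n * (16 / 15 * κ / P * ∫ x, g.1 x * w x) ≤
        6 * (16 / 15 * κ / P * (∫ x, g.1 x * w x) / (a * b)) := by
      have : 0 ≤ ∫ x, g.1 x * w x := integral_nonneg fun x => mul_nonneg (hg0 x) (hw.nonneg x)
      calc n * (16 / 15 * κ / P * ∫ x, g.1 x * w x)
          ≤ 6 / (a * b) * (16 / 15 * κ / P * ∫ x, g.1 x * w x) :=
            mul_le_mul_of_nonneg_right (hnN.trans hN2) (by positivity)
        _ = _ := by ring
    linarith

end FlatMode

end localSmoothing

/-! ### The spectral gap -/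

section gap

variable {d : ℕ} {w : Eu d → ℝ} {Θ : Set (Eu d)} {m : Eu d} {ε P : ℝ}

/-- Comparison of the variance with the increments of scale at most `R`: the distance of `f` from
its value at a point `y` is averaged over `y` with weight `u`. -/
theorem integral_mul_sq_norm_le_ballIncr (hw : IsWeight w) (hw1 : ∫ x, w x = 1) {u : Eu d → ℝ}
    (hu : Integrable u) (hum : Measurable u) (hu0 : ∀ x, 0 ≤ u x) {c R : ℝ}
    (hsupp : ∀ x h, R ≤ ‖h‖ → u (x + h) * w x = 0)
    (hc : ∀ x h, ‖h‖ < R → u (x + h) * w x ≤ c * overlap w x h)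
    (f : bddMeas d) (hf : ∫ x, f.1 x * w x = 0) :
    (∫ x, u x) * wInner hw f f ≤ c * ballIncr w f.1 R := by
  have hfb := isBdd_coe f
  obtain ⟨M, hM0, hM⟩ := hfb.exists_bound
  have hsqM : ∀ x y, (f.1 x - f.1 y) ^ 2 ≤ (2 * M) ^ 2 := fun x y => by
    rw [← sq_abs]
    exact pow_le_pow_left₀ (abs_nonneg _) ((abs_sub _ _).trans (by linarith [hM x, hM y])) 2
  have i0 : Integrable (fun z : Eu d × Eu d => u z.1 * w z.2 * (f.1 z.2 - f.1 z.1) ^ 2)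
      (volume.prod volume) := by
    refine ((hu.mul_prod hw.integrable).mul_const ((2 * M) ^ 2)).mono'
      (((hum.comp measurable_fst).mul (hw.measurable.comp measurable_snd)).mul
        (((hfb.1.comp measurable_snd).sub (hfb.1.comp measurable_fst)).pow_const
          2)).aestronglyMeasurable (Filter.Eventually.of_forall fun z => ?_)
    have h0 := mul_nonneg (hu0 z.1) (hw.nonneg z.2)
    rw [Real.norm_of_nonneg (mul_nonneg h0 (sq_nonneg _))]
    exact mul_le_mul_of_nonneg_left (hsqM _ _) h0
  -- the distance from a constant is least for the mean, which is `0`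
  have pt : ∀ y, u y * wInner hw f f ≤ ∫ x, u y * w x * (f.1 x - f.1 y) ^ 2 := by
    intro y
    have j1 : Integrable fun x => f.1 x * f.1 x * w x := (hfb.mul hfb).integrable_mul hw.integrable
    have j2 : Integrable fun x => f.1 x * w x := hfb.integrable_mul hw.integrable
    have e1 : ∫ x, u y * w x * (f.1 x - f.1 y) ^ 2 = u y * (wInner hw f f + f.1 y ^ 2) := by
      calc ∫ x, u y * w x * (f.1 x - f.1 y) ^ 2
          = ∫ x, (u y * (f.1 x * f.1 x * w x) + (-(2 * u y * f.1 y) * (f.1 x * w x) +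
              u y * f.1 y ^ 2 * w x)) := by congr 1; funext x; ring
        _ = u y * (wInner hw f f) + (-(2 * u y * f.1 y) * 0 + u y * f.1 y ^ 2 * 1) := by
            rw [integral_add (j1.const_mul _) ((j2.const_mul _).fun_add
              (hw.integrable.const_mul _)), integral_add (j2.const_mul _)
              (hw.integrable.const_mul _), integral_const_mul, integral_const_mul,
              integral_const_mul, hf, hw1, wInner_apply]
        _ = _ := by ring
    rw [e1]
    exact mul_le_mul_of_nonneg_left (by linarith [sq_nonneg (f.1 y)]) (hu0 y)
  obtain ⟨i1, e1⟩ := integral_overlap_ball hw hfb R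
  calc (∫ x, u x) * wInner hw f f = ∫ y, u y * wInner hw f f := (integral_mul_const _ _).symm
    _ ≤ ∫ y, ∫ x, u y * w x * (f.1 x - f.1 y) ^ 2 :=
        integral_mono (hu.mul_const _) i0.integral_prod_left pt
    _ = ∫ x, ∫ y, u y * w x * (f.1 x - f.1 y) ^ 2 := integral_integral_swap i0
    _ ≤ ∫ x, c * ∫ h in Metric.ball 0 R, overlap w x h * (f.1 (x + h) - f.1 x) ^ 2 := by
        refine integral_mono i0.integral_prod_right (i1.const_mul c) fun x => ?_
        change ∫ y, u y * w x * (f.1 x - f.1 y) ^ 2 ≤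
          c * ∫ h in Metric.ball 0 R, overlap w x h * (f.1 (x + h) - f.1 x) ^ 2
        rw [← integral_const_mul,
          ← integral_add_left_eq_self (fun y => u y * w x * (f.1 x - f.1 y) ^ 2) x]
        have hzero : ∀ h, h ∉ Metric.ball (0 : Eu d) R →
            u (x + h) * w x * (f.1 x - f.1 (x + h)) ^ 2 = 0 := fun h hh => by
          rw [hsupp x h (not_lt.1 fun hc => hh (mem_ball_zero_iff.2 hc)), zero_mul]
        rw [← setIntegral_eq_integral_of_forall_compl_eq_zero hzero]
        refine setIntegral_mono_on ?_ ?_ Metric.isOpen_ball.measurableSet fun h hh => ?_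
        · refine Integrable.integrableOn ?_
          refine ((hu.comp_add_left x).mul_const (w x * (2 * M) ^ 2)).mono'
            ((((hum.comp (measurable_const_add x)).mul_const _).mul
              ((measurable_const.sub (hfb.shift_left x).1).pow_const 2))).aestronglyMeasurable
            (Filter.Eventually.of_forall fun h => ?_)
          have h0 := mul_nonneg (hu0 (x + h)) (hw.nonneg x)
          rw [Real.norm_of_nonneg (mul_nonneg h0 (sq_nonneg _)), ← mul_assoc]
          exact mul_le_mul_of_nonneg_left (hsqM _ _) h0
        · refine (integrableOn_ball_of_le ((hw.measurable_overlap.comp measurable_prodMk_left).mul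
            (((hfb.shift_left x).1.sub_const _).pow_const 2)) 0 R (w x * (2 * M) ^ 2)
              fun k _ => ?_).const_mul c
          change |overlap w x k * (f.1 (x + k) - f.1 x) ^ 2| ≤ _
          rw [abs_of_nonneg (mul_nonneg (overlap_nonneg hw _ _) (sq_nonneg _))]
          exact mul_le_mul (overlap_le _ _) (hsqM _ _) (sq_nonneg _) (hw.nonneg x)
        · have h1 := mul_le_mul_of_nonneg_right (hc x h (mem_ball_zero_iff.1 hh))
            (sq_nonneg (f.1 (x + h) - f.1 x))
          calc u (x + h) * w x * (f.1 x - f.1 (x + h)) ^ 2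
              = u (x + h) * w x * (f.1 (x + h) - f.1 x) ^ 2 := by ring
            _ ≤ _ := h1.trans (le_of_eq (mul_assoc _ _ _))
    _ = c * ballIncr w f.1 R := by rw [integral_const_mul, e1]

/-- A bound for the inverse of the spectral gap. -/
noncomputable def gapInv (d : ℕ) (ε L P δ : ℝ) : ℝ :=
  18 * (P * unitVol d * L ^ d) * (L / ε) ^ 2 * (32 / 11) ^ d / δ

theorem ballIncr_le_integral [NeZero d] (hw : IsWeight w) {q : Eu d → ℝ} (hq : IsProposal q)
    {δ : ℝ} (hδ : 0 < δ) (hε : 0 < ε) (hqδ : ∀ x, ‖x‖ ≤ ε → δ / (unitVol d * ε ^ d) ≤ q x)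
    {f : Eu d → ℝ} (hf : IsBdd f) :
    ballIncr w f ε ≤ unitVol d * ε ^ d / δ * ∫ h, q h * incr w f h := by
  have hω := unitVol_pos d
  have h1 : δ / (unitVol d * ε ^ d) * ballIncr w f ε ≤ ∫ h, q h * incr w f h := by
    rw [ballIncr, ← integral_const_mul]
    refine (setIntegral_mono_on ((integrableOn_incr hw hf ε).const_mul _)
      (integrable_proposal_mul hq (isBdd_incr hw hf)).integrableOn Metric.isOpen_ball.measurableSet
      fun h hh => mul_le_mul_of_nonneg_right (hqδ h (mem_ball_zero_iff.1 hh).le)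
        (incr_nonneg hw f h)).trans ?_
    exact setIntegral_le_integral (integrable_proposal_mul hq (isBdd_incr hw hf))
      (Filter.Eventually.of_forall fun h => mul_nonneg (hq.nonneg h) (incr_nonneg hw f h))
  rw [div_mul_eq_mul_div, le_div_iff₀ hδ]
  rw [div_mul_eq_mul_div, div_le_iff₀ (by positivity)] at h1
  linarith

namespace FlatMode

theorem le_radius [NeZero d] (h : FlatMode w Θ m ε P) {L : ℝ} (hL : Θ ⊆ Metric.closedBall m L) :
    ε ≤ L := by
  have hε := h.eps_pos
  have h1 : m + EuclideanSpace.single 0 ε ∈ Metric.closedBall m ε := by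
    rw [mem_closedBall_iff_norm, add_sub_cancel_left, PiLp.norm_single,
      Real.norm_of_nonneg hε.le]
  have h2 := hL (h.ball_subset h1)
  rwa [mem_closedBall_iff_norm, add_sub_cancel_left, PiLp.norm_single,
      Real.norm_of_nonneg hε.le] at h2

theorem one_le_mass [NeZero d] (h : FlatMode w Θ m ε P) (hw1 : ∫ x, w x = 1) {L : ℝ}
    (hL : Θ ⊆ Metric.closedBall m L) : 1 ≤ P * unitVol d * L ^ d := by
  have hL0 : 0 < L := lt_of_lt_of_le h.eps_pos (h.le_radius hL)
  calc 1 = ∫ x, w x := hw1.symm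
    _ = ∫ x in Metric.closedBall m L, w x :=
        (setIntegral_eq_integral_of_forall_compl_eq_zero fun x hx =>
          h.zero_off x fun hc => hx (hL hc)).symm
    _ ≤ ∫ _ in Metric.closedBall m L, P :=
        setIntegral_mono_on h.weight.integrable.integrableOn
          (integrableOn_const measure_closedBall_lt_top.ne)
          Metric.isClosed_closedBall.measurableSet fun x _ => h.le_max x
    _ = _ := by
        rw [setIntegral_const, smul_eq_mul, Measure.addHaar_real_closedBall_eq_addHaar_real_ball,
          volume_real_ball _ hL0]
        ring

theorem mass_le_one [NeZero d] {q : Eu d → ℝ} (hq : IsProposal q) {δ : ℝ} (hε : 0 < ε)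
    (hqδ : ∀ x, ‖x‖ ≤ ε → δ / (unitVol d * ε ^ d) ≤ q x) : δ ≤ 1 := by
  have hω := unitVol_pos d
  calc δ = ∫ _ in Metric.ball (0 : Eu d) ε, δ / (unitVol d * ε ^ d) := by
        rw [setIntegral_const, smul_eq_mul, volume_real_ball _ hε]; field_simp
    _ ≤ ∫ x in Metric.ball (0 : Eu d) ε, q x :=
        setIntegral_mono_on (integrableOn_const measure_ball_lt_top.ne)
          hq.integrable.integrableOn Metric.isOpen_ball.measurableSet fun x hx =>
          hqδ x (mem_ball_zero_iff.1 hx).le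
    _ ≤ ∫ x, q x := setIntegral_le_integral hq.integrable (Filter.Eventually.of_forall hq.nonneg)
    _ ≤ 1 := hq.integral_le_one

/-- The Poincaré inequality. If `L` exceeds `11 / 10 ε`, then increments of length up to `2 L` are
split into at most `2 L / ε + 1 ≤ 32 / 11 * (L / ε)` increments of length at most `ε`. For smaller
`L` this argument needs up to `3` pieces, more than `32 / 11 * (L / ε)`. In that case `f` is compared
with its values on the flat ball of radius `9 / 10 ε` only; these points are within `2 ε` of all of
`Θ`, so that `2` pieces suffice. -/
theorem poincare [NeZero d] (h : FlatMode w Θ m ε P) (hw1 : ∫ x, w x = 1) {L : ℝ}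
    (hL : Θ ⊆ Metric.closedBall m L) {q : Eu d → ℝ} (hq : IsProposal q) {δ : ℝ} (hδ : 0 < δ)
    (hqδ : ∀ x, ‖x‖ ≤ ε → δ / (unitVol d * ε ^ d) ≤ q x) (f : bddMeas d)
    (hf : ∫ x, f.1 x * w x = 0) :
    wInner h.weight f f ≤ gapInv d ε L P δ * ((∫ k, q k * incr w f.1 k) / 2) := by
  have hε := h.eps_pos
  have hP := h.max_pos
  have hw := h.weight
  have hω := unitVol_pos d
  have hεL := h.le_radius hL
  have hL0 : 0 < L := hε.trans_le hεL
  have hb := isBdd_coe f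
  have hE0 := integral_incr_nonneg hw hq f.1
  have hE := ballIncr_le_integral hw hq hδ hε hqδ hb
  set E := ∫ k, q k * incr w f.1 k with hEdef
  have hℓ : 1 ≤ L / ε := (one_le_div hε).2 hεL
  rcases le_or_gt L (11 / 10 * ε) with hsmall | hlarge
  · set B := Metric.ball m (9 / 10 * ε) with hB
    have hBm : MeasurableSet B := Metric.isOpen_ball.measurableSet
    have h1 := integral_mul_sq_norm_le_ballIncr hw hw1 (u := B.indicator fun _ => 1) (c := 16 / 15)
      (R := 2 * ε) ((integrable_indicator_iff hBm).2 (integrableOn_const measure_ball_lt_top.ne))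
      (measurable_const.indicator hBm) (fun x => indicator_nonneg (fun _ _ => zero_le_one) x)
      (fun x k hk => by
        by_contra hcon
        have hx : x ∈ Θ := by
          by_contra hc; exact hcon (by rw [h.zero_off x hc, mul_zero])
        have hy : x + k ∈ B := by
          by_contra hc; exact hcon (by rw [indicator_of_notMem hc, zero_mul])
        have h2 := mem_closedBall_iff_norm.1 (hL hx)
        have h3 := mem_ball_iff_norm.1 hy
        have h4 : k = (x + k - m) - (x - m) := by abel
        have h5 : ‖k‖ < 2 * ε := by
          rw [h4]; exact (norm_sub_le _ _).trans_lt (by linarith)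
        linarith)
      (fun x k _ => by
        by_cases hy : x + k ∈ B
        · rw [indicator_of_mem hy, one_mul]
          have h3 := mem_ball_iff_norm.1 hy
          have h4 := h.flat (x + k) (h.ball_subset (mem_closedBall_iff_norm.2 (by linarith)))
            (by linarith)
          have h5 := h.le_max x
          have : 15 / 16 * w x ≤ overlap w x k := le_min (by linarith [hw.nonneg x]) (by linarith)
          linarith
        · rw [indicator_of_notMem hy, zero_mul]
          exact mul_nonneg (by norm_num) (overlap_nonneg hw _ _)) f hf
    rw [integral_indicator hBm, setIntegral_const, smul_eq_mul, mul_one, hB,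
      volume_real_ball _ (by positivity)] at h1
    have h2 := ballIncr_natCast_mul_le hw hb (N := 2) (by norm_num) ε
    push_cast at h2
    have h3 : (9 / 10 * ε) ^ d * unitVol d * wInner hw f f ≤
        16 / 15 * (2 ^ (d + 2) * (unitVol d * ε ^ d / δ * E)) :=
      h1.trans (mul_le_mul_of_nonneg_left (h2.trans
        (mul_le_mul_of_nonneg_left hE (by positivity))) (by norm_num))
    have h4 : wInner hw f f ≤ 18 * (20 / 9) ^ d / δ * (E / 2) := by
      have hpos : 0 < (9 / 10 * ε) ^ d * unitVol d := by positivity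
      refine le_of_mul_le_mul_left (h3.trans ?_) hpos
      have e1 : (9 / 10 * ε) ^ d * (20 / 9) ^ d = 2 ^ d * ε ^ d := by
        rw [← mul_pow, ← mul_pow]; congr 1; ring
      calc 16 / 15 * (2 ^ (d + 2) * (unitVol d * ε ^ d / δ * E))
          = 64 / 15 * ((2 ^ d * ε ^ d) * (unitVol d / δ * E)) := by rw [pow_add]; ring
        _ ≤ 9 * ((2 ^ d * ε ^ d) * (unitVol d / δ * E)) :=
            mul_le_mul_of_nonneg_right (by norm_num) (by positivity)
        _ = _ := by rw [← e1]; ring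
    refine h4.trans (mul_le_mul_of_nonneg_right ?_ (by positivity))
    unfold gapInv
    refine div_le_div_of_nonneg_right ?_ hδ.le
    have hA := h.one_le_mass hw1 hL
    calc 18 * (20 / 9 : ℝ) ^ d ≤ 18 * (32 / 11) ^ d :=
          mul_le_mul_of_nonneg_left (pow_le_pow_left₀ (by norm_num) (by norm_num) d) (by norm_num)
      _ = 18 * 1 * 1 ^ 2 * (32 / 11) ^ d := by ring
      _ ≤ _ := by gcongr
  · obtain ⟨N, hN⟩ : ∃ N, N = ⌊2 * (L / ε)⌋₊ + 1 := ⟨_, rfl⟩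
    have hN1 : 2 * L < N * ε := by
      have := Nat.lt_floor_add_one (2 * (L / ε))
      rw [← div_lt_iff₀ hε, hN]
      push_cast
      rwa [mul_div_assoc]
    have hN2 : (N : ℝ) ≤ 2 * (L / ε) + 1 := by
      rw [hN]; push_cast
      exact add_le_add (Nat.floor_le (by positivity)) le_rfl
    have hℓ' : 11 / 10 ≤ L / ε := by rw [le_div_iff₀ hε]; exact hlarge.le
    have h1 := integral_mul_sq_norm_le_ballIncr hw hw1 (u := w) (c := P) (R := N * ε)
      hw.integrable hw.measurable hw.nonneg
      (fun x k hk => by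
        by_contra hcon
        have hx : x ∈ Θ := by
          by_contra hc; exact hcon (by rw [h.zero_off x hc, mul_zero])
        have hy : x + k ∈ Θ := by
          by_contra hc; exact hcon (by rw [h.zero_off _ hc, zero_mul])
        have h2 := mem_closedBall_iff_norm.1 (hL hx)
        have h3 := mem_closedBall_iff_norm.1 (hL hy)
        have h4 : k = (x + k - m) - (x - m) := by abel
        have h5 : ‖k‖ ≤ 2 * L := by
          rw [h4]; exact (norm_sub_le _ _).trans (by linarith)
        linarith)
      (fun x k _ => by
        unfold overlap
        rcases le_total (w x) (w (x + k)) with h' | h'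
        · rw [min_eq_left h']; exact mul_le_mul_of_nonneg_right (h.le_max _) (hw.nonneg _)
        · rw [min_eq_right h', mul_comm]
          exact mul_le_mul_of_nonneg_right (h.le_max _) (hw.nonneg _)) f hf
    rw [hw1, one_mul] at h1
    have h2 := ballIncr_natCast_mul_le hw hb (N := N) (by omega) ε
    have h3 : wInner hw f f ≤ P * ((N : ℝ) ^ (d + 2) * (unitVol d * ε ^ d / δ * E)) :=
      h1.trans (mul_le_mul_of_nonneg_left (h2.trans
        (mul_le_mul_of_nonneg_left hE (by positivity))) hP.le)
    refine h3.trans ?_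
    have h4 : (N : ℝ) ^ (d + 2) ≤ (32 / 11 * (L / ε)) ^ d * (3 * (L / ε)) ^ 2 := by
      rw [pow_add]
      exact mul_le_mul (pow_le_pow_left₀ (Nat.cast_nonneg _) (by linarith) _)
        (pow_le_pow_left₀ (Nat.cast_nonneg _) (by linarith) _) (by positivity) (by positivity)
    calc P * ((N : ℝ) ^ (d + 2) * (unitVol d * ε ^ d / δ * E))
        ≤ P * (((32 / 11 * (L / ε)) ^ d * (3 * (L / ε)) ^ 2) * (unitVol d * ε ^ d / δ * E)) :=
          mul_le_mul_of_nonneg_left (mul_le_mul_of_nonneg_right h4 (by positivity)) hP.le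
      _ = _ := by
          unfold gapInv
          rw [mul_pow, div_pow L ε d]
          field_simp
          ring

theorem six_mul_two_pow_le_gapInv [NeZero d] (h : FlatMode w Θ m ε P) (hw1 : ∫ x, w x = 1) {L : ℝ}
    (hL : Θ ⊆ Metric.closedBall m L) {δ : ℝ} (hδ : 0 < δ) (hδ1 : δ ≤ 1) :
    6 * 2 ^ d ≤ gapInv d ε L P δ := by
  have hε := h.eps_pos
  have hA := h.one_le_mass hw1 hL
  have hℓ : 1 ≤ L / ε := (one_le_div hε).2 (h.le_radius hL)
  unfold gapInv
  rw [le_div_iff₀ hδ]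
  calc (6 * 2 ^ d * δ : ℝ) ≤ 6 * 2 ^ d * 1 := by gcongr
    _ ≤ 18 * 1 * 1 ^ 2 * (32 / 11) ^ d := by
        have : (2 : ℝ) ^ d ≤ (32 / 11) ^ d := pow_le_pow_left₀ (by norm_num) (by norm_num) d
        have : (0 : ℝ) ≤ 2 ^ d := by positivity
        linarith
    _ ≤ _ := by gcongr

/-- Geometric convergence in square norm, for functions of mean zero. -/
theorem sq_norm_iterate_le [NeZero d] (h : FlatMode w Θ m ε P) (hw1 : ∫ x, w x = 1) {L : ℝ}
    (hL : Θ ⊆ Metric.closedBall m L) {q : Eu d → ℝ} (hq : IsProposal q) {δ : ℝ} (hδ : 0 < δ)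
    (hqδ : ∀ x, ‖x‖ ≤ ε → δ / (unitVol d * ε ^ d) ≤ q x) (f : bddMeas d)
    (hf : ∫ x, f.1 x * w x = 0) (s : ℕ) :
    wInner h.weight ((mhLin h.weight hq ^ s) f) ((mhLin h.weight hq ^ s) f) ≤
      ((1 - 1 / gapInv d ε L P δ) ^ s) ^ 2 * wInner h.weight f f := by
  have hw := h.weight
  have hR6 := h.six_mul_two_pow_le_gapInv hw1 hL hδ (mass_le_one hq h.eps_pos hqδ)
  have h2d : (1 : ℝ) ≤ 2 ^ d := one_le_pow₀ (by norm_num)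
  obtain ⟨R, hR⟩ : ∃ R, R = gapInv d ε L P δ := ⟨_, rfl⟩
  rw [← hR] at hR6 ⊢
  have hR0 : 0 < R := by linarith
  have hRinv : 1 / R ≤ 1 / (6 * 2 ^ d) := one_div_le_one_div_of_le (by positivity) hR6
  have hc : 0 < 1 - 1 / R := by
    have : 1 / R < 1 := (div_lt_one hR0).2 (by linarith)
    linarith
  let W : Submodule ℝ (bddMeas d) := LinearMap.ker (wInner hw ⟨fun _ => 1, IsBdd.const 1⟩)
  have hWiff : ∀ f : bddMeas d, f ∈ W ↔ ∫ x, f.1 x * w x = 0 := fun f => by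
    rw [LinearMap.mem_ker, wInner_apply]
    simp only [one_mul]
  have hWT : ∀ f ∈ W, mhLin hw hq f ∈ W := fun f hf => by
    rw [hWiff] at hf ⊢
    exact (integral_mhOp_mul hw hq (isBdd_coe f)).trans hf
  have form : ∀ f ∈ W, |wInner hw f (mhLin hw hq f)| ≤ (1 - 1 / R) * wInner hw f f := by
    intro f hf
    have h1 := h.poincare hw1 hL hq hδ hqδ f ((hWiff f).1 hf)
    rw [← hR] at h1
    have h2 := dirichlet_eq hw hq f
    have h3 := wInner_add_mhLin_ge hw hq f
    have h4 : 1 / R * wInner hw f f ≤ (∫ k, q k * incr w f.1 k) / 2 := by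
      rw [one_div, inv_mul_le_iff₀ hR0]; exact h1
    have h5 := mul_le_mul_of_nonneg_right hRinv (wInner_self_nonneg hw f)
    rw [abs_le]
    constructor <;> linarith
  have hmem : ∀ s : ℕ, (mhLin hw hq ^ s) f ∈ W := fun s => by
    induction s with
    | zero => exact (hWiff f).2 hf
    | succ s ih => rw [pow_succ']; exact hWT _ ih
  induction s with
  | zero => simp
  | succ s ih =>
    have e1 : (mhLin hw hq ^ (s + 1)) f = mhLin hw hq ((mhLin hw hq ^ s) f) := by
      rw [pow_succ']; rfl
    have h1 := sq_norm_le_of_abs_form_le (wInner hw) (mhLin hw hq) (wInner_comm hw)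
      (wInner_mhLin_symm hw hq) W hWT hc form (hmem s)
    rw [e1]
    refine h1.trans ((mul_le_mul_of_nonneg_left ih (sq_nonneg _)).trans (le_of_eq ?_))
    ring

end FlatMode

end gap

/-! ### Uniform convergence from the neighbourhood of the mode -/

section mixing

theorem sq_le_const_mul_pow (d : ℕ) : (d : ℝ) ^ 2 ≤ 4445 * (33 / 32) ^ d := by
  have h1 := natCast_mul_le_pow (c := 1015 / 1000) (by norm_num) d
  have h2 : ((d : ℝ) * (1015 / 1000 - 1)) ^ 2 ≤ ((1015 / 1000 : ℝ) ^ d) ^ 2 :=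
    pow_le_pow_left₀ (by positivity) h1 2
  have h3 : ((1015 / 1000 : ℝ) ^ d) ^ 2 ≤ (33 / 32) ^ d := by
    rw [← pow_mul, mul_comm, pow_mul]
    exact pow_le_pow_left₀ (by norm_num) (by norm_num) d
  nlinarith

/-- The number of steps: since `32 / 11 < 3`, the factors polynomial in `d` are absorbed. -/
theorem gapInv_mul_log_le {d : ℕ} (hd : 0 < d) {ε L P δ : ℝ} (hε : 0 < ε) (hεL : ε ≤ L)
    (hδ : 0 < δ) (hδ1 : δ ≤ 1) (hA : 1 ≤ P * unitVol d * L ^ d) :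
    8 * (5 / 2) ^ d / δ +
        (gapInv d ε L P δ * Real.log (16 * (10 ^ 8) ^ (d ^ 2) * (L / ε) ^ d) + 1) ≤
      10 ^ 6 * Real.log 16 * (L / ε) ^ 3 * (P * unitVol d * L ^ d) * (9 * 3 ^ d) / δ := by
  obtain ⟨A, hAdef⟩ : ∃ A, A = P * unitVol d * L ^ d := ⟨_, rfl⟩
  obtain ⟨ℓ, hℓdef⟩ : ∃ ℓ, ℓ = L / ε := ⟨_, rfl⟩
  have hℓ : 1 ≤ ℓ := by rw [hℓdef]; exact (one_le_div hε).2 hεL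
  unfold gapInv
  rw [← hAdef] at hA ⊢
  rw [← hℓdef]
  have hd1 : (1 : ℝ) ≤ d := by exact_mod_cast hd
  have h16 : 1 ≤ Real.log 16 := by
    rw [Real.le_log_iff_exp_le (by norm_num)]
    linarith [Real.exp_one_lt_d9]
  have hlog16 : Real.log 16 ≤ 15 := by
    have := Real.log_le_sub_one_of_pos (x := 16) (by norm_num)
    linarith
  have hlog10 : Real.log 10 ≤ 9 := by
    have := Real.log_le_sub_one_of_pos (x := 10) (by norm_num)
    linarith
  have hlogℓ : Real.log ℓ ≤ ℓ := by
    have := Real.log_le_sub_one_of_pos (x := ℓ) (by linarith)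
    linarith
  have hlog : Real.log (16 * (10 ^ 8) ^ (d ^ 2) * ℓ ^ d) ≤ 88 * d ^ 2 * ℓ := by
    rw [Real.log_mul (by positivity) (by positivity), Real.log_mul (by norm_num) (by positivity),
      Real.log_pow, Real.log_pow, Real.log_pow]
    push_cast
    have h1 : (d : ℝ) ≤ d ^ 2 := by nlinarith
    have h2 : (d : ℝ) ^ 2 ≤ d ^ 2 * ℓ := le_mul_of_one_le_right (by positivity) hℓ
    have h3 : (d : ℝ) * Real.log ℓ ≤ d ^ 2 * ℓ :=
      mul_le_mul h1 hlogℓ (Real.log_nonneg hℓ) (by positivity)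
    have h4 : (d : ℝ) ^ 2 * (8 * Real.log 10) ≤ d ^ 2 * 72 :=
      mul_le_mul_of_nonneg_left (by linarith) (by positivity)
    linarith
  have h3d : (3 : ℝ) ^ d = (32 / 11) ^ d * (33 / 32) ^ d := by rw [← mul_pow]; norm_num
  have hℓ2 : 1 ≤ ℓ ^ 2 := one_le_pow₀ hℓ
  have hℓ3 : 1 ≤ ℓ ^ 3 := one_le_pow₀ hℓ
  have hX : 1 ≤ A * ℓ ^ 3 := one_le_mul_of_one_le_of_one_le hA hℓ3
  have h52 : (5 / 2 : ℝ) ^ d ≤ 3 ^ d := pow_le_pow_left₀ (by norm_num) (by norm_num) d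
  have h3pos : (1 : ℝ) ≤ 3 ^ d := one_le_pow₀ (by norm_num)
  have t1 : 8 * (5 / 2 : ℝ) ^ d / δ ≤ 8 * (A * ℓ ^ 3 * 3 ^ d) / δ := by
    refine div_le_div_of_nonneg_right (mul_le_mul_of_nonneg_left ?_ (by norm_num)) hδ.le
    exact h52.trans (le_mul_of_one_le_left (by positivity) hX)
  have t2 : (1 : ℝ) ≤ (A * ℓ ^ 3 * 3 ^ d) / δ := by
    rw [le_div_iff₀ hδ, one_mul]
    exact hδ1.trans (one_le_mul_of_one_le_of_one_le hX h3pos)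
  have t3 : 18 * A * ℓ ^ 2 * (32 / 11) ^ d / δ * Real.log (16 * (10 ^ 8) ^ (d ^ 2) * ℓ ^ d) ≤
      1584 * 4445 * (A * ℓ ^ 3 * 3 ^ d) / δ := by
    calc 18 * A * ℓ ^ 2 * (32 / 11) ^ d / δ * Real.log (16 * (10 ^ 8) ^ (d ^ 2) * ℓ ^ d)
        ≤ 18 * A * ℓ ^ 2 * (32 / 11) ^ d / δ * (88 * d ^ 2 * ℓ) :=
          mul_le_mul_of_nonneg_left hlog (by positivity)
      _ = 1584 * A * ℓ ^ 3 * (32 / 11) ^ d / δ * d ^ 2 := by ring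
      _ ≤ 1584 * A * ℓ ^ 3 * (32 / 11) ^ d / δ * (4445 * (33 / 32) ^ d) :=
          mul_le_mul_of_nonneg_left (sq_le_const_mul_pow d) (by positivity)
      _ = _ := by rw [h3d]; ring
  calc _ ≤ 8 * (A * ℓ ^ 3 * 3 ^ d) / δ + (1584 * 4445 * (A * ℓ ^ 3 * 3 ^ d) / δ +
        (A * ℓ ^ 3 * 3 ^ d) / δ) := add_le_add t1 (add_le_add t3 t2)
    _ = (8 + 1584 * 4445 + 1) * ((A * ℓ ^ 3 * 3 ^ d) / δ) := by ring
    _ ≤ (10 ^ 6 * Real.log 16 * 9) * ((A * ℓ ^ 3 * 3 ^ d) / δ) :=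
        mul_le_mul_of_nonneg_right (by linarith) (by positivity)
    _ = _ := by ring

variable {d : ℕ} {w : Eu d → ℝ} {Θ : Set (Eu d)} {m : Eu d} {ε P : ℝ}

theorem iterate_mono {q : Eu d → ℝ} (hw : IsWeight w) (hq : IsProposal q) {f g : Eu d → ℝ}
    (hf : IsBdd f) (hg : IsBdd g) (h : ∀ x, f x ≤ g x) (n : ℕ) :
    ∀ x, (mhOp w q)^[n] f x ≤ (mhOp w q)^[n] g x := by
  induction n with
  | zero => exact h
  | succ n ih =>
    intro x
    rw [Function.iterate_succ_apply', Function.iterate_succ_apply']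
    exact mhOp_mono hw hq (isBdd_iterate hw hq hf n) (isBdd_iterate hw hq hg n) x ih

theorem abs_iterate_le {q : Eu d → ℝ} (hw : IsWeight w) (hq : IsProposal q) (f : bddMeas d)
    (n : ℕ) (x : Eu d) :
    |(mhOp w q)^[n] f.1 x| ≤ (mhOp w q)^[n] (fun y => |f.1 y|) x := by
  have hb := isBdd_coe f
  have hneg : (mhOp w q)^[n] (fun y => -f.1 y) x = -(mhOp w q)^[n] f.1 x := by
    have h1 := coe_mhLin_pow hw hq (-f) n
    rw [map_neg] at h1
    have h2 := congrFun h1 x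
    rw [← coe_mhLin_pow hw hq f n]
    exact h2.symm
  rw [abs_le']
  refine ⟨iterate_mono hw hq hb hb.abs (fun y => le_abs_self _) n x, ?_⟩
  rw [← hneg]
  exact iterate_mono hw hq (isBdd_coe (-f)) hb.abs (fun y => neg_le_abs _) n x

theorem iterate_sub_const {q : Eu d → ℝ} (hw : IsWeight w) (hq : IsProposal q) {f : Eu d → ℝ}
    (hf : IsBdd f) (c : ℝ) (n : ℕ) :
    (mhOp w q)^[n] (fun x => f x - c) = fun x => (mhOp w q)^[n] f x - c := by
  induction n with
  | zero => rfl
  | succ n ih =>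
    rw [Function.iterate_succ_apply', Function.iterate_succ_apply', ih]
    have e : (fun x => (mhOp w q)^[n] f x - c) = (mhOp w q)^[n] f + fun _ => -c := by
      funext x; simp [sub_eq_add_neg]
    rw [e, mhOp_add hw hq (isBdd_iterate hw hq hf n) (IsBdd.const _), mhOp_const]
    funext x; simp [sub_eq_add_neg]

/-- The chain started near the mode converges uniformly: the spectral gap makes the deviation from
the mean small in square norm, and the smoothing turns this into a pointwise bound. -/
theorem FlatMode.mixing [NeZero d] (h : FlatMode w Θ m ε P) (hmode : ∀ x, w x ≤ w m)
    (hw1 : ∫ x, w x = 1) {L : ℝ} (hL : Θ ⊆ Metric.closedBall m L) {q : Eu d → ℝ}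
    (hq : IsProposal q) {C : ℝ} (hC : ∀ x, q x ≤ C) {δ : ℝ} (hδ : 0 < δ)
    (hqδ : ∀ x, ‖x‖ ≤ ε → δ / (unitVol d * ε ^ d) ≤ q x) :
    ∃ t : ℕ, (t : ℝ) ≤
        10 ^ 6 * Real.log 16 * (L / ε) ^ 3 * (P * unitVol d * L ^ d) * (9 * 3 ^ d) / δ ∧
      ∀ f : Eu d → ℝ, Measurable f → (∀ x, 0 ≤ f x) → (∀ x, f x ≤ 1) → ∀ x, ‖x - m‖ ≤ ε →
        |(mhOp w q)^[t] f x - ∫ y, f y * w y| ≤ 1 / 8 := by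
  have hε := h.eps_pos
  have hP := h.max_pos
  have hw := h.weight
  have hω := unitVol_pos d
  have hd : 0 < d := Nat.pos_of_ne_zero (NeZero.ne d)
  have hεL := h.le_radius hL
  have hL0 : 0 < L := hε.trans_le hεL
  have hδ1 := mass_le_one hq hε hqδ
  have hA := h.one_le_mass hw1 hL
  have hR6 := h.six_mul_two_pow_le_gapInv hw1 hL hδ hδ1
  have h2d : (1 : ℝ) ≤ 2 ^ d := one_le_pow₀ (by norm_num)
  have hnum := gapInv_mul_log_le hd hε hεL hδ hδ1 hA
  have hgap := h.sq_norm_iterate_le hw1 hL hq hδ hqδ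
  obtain ⟨n, hn, hsmooth⟩ := h.local_smoothing hmode hw1.le hq hC hδ hqδ
  obtain ⟨R, hR⟩ : ∃ R, R = gapInv d ε L P δ := ⟨_, rfl⟩
  obtain ⟨Λ, hΛ⟩ : ∃ Λ : ℝ, Λ = (10 ^ 8) ^ (d ^ 2) := ⟨_, rfl⟩
  have hΛ1 : 1 ≤ Λ := by rw [hΛ]; exact one_le_pow₀ (by norm_num)
  rw [← hR, ← hΛ] at hnum
  rw [← hR] at hR6 hgap
  rw [← hΛ] at hsmooth
  have hR0 : 0 < R := by linarith
  have hℓ : 1 ≤ L / ε := (one_le_div hε).2 hεL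
  have hℓd : 1 ≤ (L / ε) ^ d := one_le_pow₀ hℓ
  have hX1 : 1 ≤ 16 * Λ * (L / ε) ^ d :=
    one_le_mul_of_one_le_of_one_le (by linarith) hℓd
  have hlog0 : 0 ≤ R * Real.log (16 * Λ * (L / ε) ^ d) := mul_nonneg hR0.le (Real.log_nonneg hX1)
  obtain ⟨s, hs1, hs2⟩ : ∃ s : ℕ, R * Real.log (16 * Λ * (L / ε) ^ d) ≤ s ∧
      (s : ℝ) ≤ R * Real.log (16 * Λ * (L / ε) ^ d) + 1 :=
    ⟨⌈R * Real.log (16 * Λ * (L / ε) ^ d)⌉₊, Nat.le_ceil _, (Nat.ceil_lt_add_one hlog0).le⟩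
  -- `s` steps of contraction make the square norm smaller than the constant of the `n` smoothing steps
  refine ⟨n + s, ?_, fun f hfm hf0 hf1 x hx => ?_⟩
  · push_cast
    linarith
  have hfb : IsBdd f := IsBdd.of_nonneg_le hfm hf0 hf1
  set c := ∫ y, f y * w y with hc
  have hc0 : 0 ≤ c := integral_nonneg fun y => mul_nonneg (hf0 y) (hw.nonneg y)
  have hc1 : c ≤ 1 := by
    rw [← hw1]
    exact integral_mono (hfb.integrable_mul hw.integrable) hw.integrable fun y =>
      mul_le_of_le_one_left (hw.nonneg y) (hf1 y)
  let f₀ : bddMeas d := ⟨fun y => f y - c, hfb.sub (IsBdd.const c)⟩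
  have hf₀ : ∀ y, |f₀.1 y| ≤ 1 := fun y =>
    abs_le.2 ⟨by change -1 ≤ f y - c; linarith [hf0 y], by change f y - c ≤ 1; linarith [hf1 y]⟩
  have hmean : ∫ y, f₀.1 y * w y = 0 := by
    change ∫ y, (f y - c) * w y = 0
    simp only [sub_mul]
    rw [integral_sub (hfb.integrable_mul hw.integrable) (hw.integrable.const_mul c),
      integral_const_mul, hw1, ← hc]
    ring
  set u : bddMeas d := (mhLin hw hq ^ s) f₀ with hu
  have hu1 : u.1 = (mhOp w q)^[s] f₀.1 := coe_mhLin_pow hw hq f₀ s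
  let g : bddMeas d := ⟨fun y => |u.1 y|, (isBdd_coe u).abs⟩
  have hg1 : ∀ y, g.1 y ≤ 1 := fun y => by
    change |u.1 y| ≤ 1
    rw [hu1]
    refine (abs_iterate_le hw hq f₀ s y).trans ?_
    exact iterate_le hw hq (isBdd_coe f₀).abs hf₀ s y
  have hnormf : wInner hw f₀ f₀ ≤ 1 := by
    rw [wInner_apply, ← hw1]
    refine integral_mono (((isBdd_coe f₀).mul (isBdd_coe f₀)).integrable_mul hw.integrable)
      hw.integrable fun y => mul_le_of_le_one_left (hw.nonneg y) ?_
    have := abs_le.1 (hf₀ y)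
    nlinarith
  have hRinv : 1 / R ≤ 1 := (div_le_one hR0).2 (by linarith)
  have hnorm : Real.sqrt (wInner hw g g) ≤ 1 / (16 * Λ * (L / ε) ^ d) := by
    have e1 : wInner hw g g = wInner hw u u := by
      rw [wInner_apply, wInner_apply]
      congr 1; funext y
      change |u.1 y| * |u.1 y| * w y = _
      rw [abs_mul_abs_self]
    have h1 : Real.sqrt (wInner hw g g) ≤ (1 - 1 / R) ^ s := by
      refine Real.sqrt_le_iff.2 ⟨pow_nonneg (by linarith) s, ?_⟩
      rw [e1]
      exact (hgap f₀ hmean s).trans (mul_le_of_le_one_right (sq_nonneg _) hnormf)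
    refine h1.trans ?_
    calc (1 - 1 / R) ^ s ≤ Real.exp (-(1 / R)) ^ s :=
          pow_le_pow_left₀ (by linarith) (by linarith [Real.add_one_le_exp (-(1 / R))]) s
      _ = Real.exp (-(s / R)) := by rw [← Real.exp_nat_mul]; congr 1; ring
      _ ≤ Real.exp (-Real.log (16 * Λ * (L / ε) ^ d)) := by
          refine Real.exp_le_exp.2 (neg_le_neg ?_)
          rw [le_div_iff₀ hR0]; linarith
      _ = _ := by rw [Real.exp_neg, Real.exp_log (by linarith), one_div]
  have hsm := hsmooth g (fun y => abs_nonneg _) hg1 x hx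
  have hlast : Λ / (unitVol d * ε ^ d * P) * Real.sqrt (wInner hw g g) ≤ 1 / 16 := by
    have h1 : 1 / (unitVol d * ε ^ d * P) ≤ (L / ε) ^ d := by
      rw [div_pow, div_le_div_iff₀ (by positivity) (by positivity)]
      have := mul_le_mul_of_nonneg_right hA (by positivity : 0 ≤ ε ^ d)
      linarith
    calc Λ / (unitVol d * ε ^ d * P) * Real.sqrt (wInner hw g g)
        = Λ * (1 / (unitVol d * ε ^ d * P)) * Real.sqrt (wInner hw g g) := by ring
      _ ≤ Λ * (L / ε) ^ d * (1 / (16 * Λ * (L / ε) ^ d)) := by gcongr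
      _ = 1 / 16 := by
          have : 0 < Λ := by linarith
          have : 0 < (L / ε) ^ d := by linarith
          field_simp
  have e2 : (mhOp w q)^[n + s] f x - c = (mhOp w q)^[n] u.1 x := by
    rw [hu1, ← Function.iterate_add_apply]
    exact (congrFun (iterate_sub_const hw hq hfb c (n + s)) x).symm
  rw [e2]
  refine (abs_iterate_le hw hq u n x).trans ?_
  have : (mhOp w q)^[n] (fun y => |u.1 y|) x ≤ _ := hsm
  linarith

end mixing

/-! ### The Metropolis-Hastings kernel as an operator -/

section kernel

variable {d : ℕ}

theorem mhAccept_mul_eq {w : Eu d → ℝ} (q : ℝ → ℝ) (x y : Eu d) :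
    mhAccept w (fun x y => q ‖x - y‖) x y * q ‖x - y‖ = q ‖y - x‖ * accept w x (y - x) := by
  unfold mhAccept accept
  simp only
  rw [norm_sub_rev y x, add_sub_cancel]
  rcases eq_or_ne (q ‖x - y‖) 0 with h | h
  · rw [h]; simp
  · rw [mul_div_mul_right _ _ h, mul_comm]

theorem one_sub_mhAccept_mul_eq {w : Eu d → ℝ} (q : ℝ → ℝ) (x y : Eu d) :
    (1 - mhAccept w (fun x y => q ‖x - y‖) x y) * q ‖x - y‖ =
      q ‖y - x‖ * (1 - accept w x (y - x)) := by
  rw [sub_mul, mhAccept_mul_eq, norm_sub_rev x y]; ring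

/-- One step of the kernel, tested against a bounded function, is the operator `mhOp`. -/
theorem lintegral_mhStep {w : Eu d → ℝ} (hw : IsWeight w) {q : ℝ → ℝ}
    (hq : IsProposal fun x : Eu d => q ‖x‖) (hq1 : ∫ x : Eu d, q ‖x‖ = 1) {g : Eu d → ℝ}
    (hg : IsBdd g) (hg0 : ∀ x, 0 ≤ g x) (x : Eu d) :
    ∫⁻ y, ENNReal.ofReal (g y) ∂(mhStep w (fun x y => q ‖x - y‖) x) =
      ENNReal.ofReal (mhOp w (fun x => q ‖x‖) g x) := by
  have hmeas : Measurable fun y : Eu d =>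
      ENNReal.ofReal (mhAccept w (fun x y => q ‖x - y‖) x y * q ‖x - y‖) := by
    simp only [mhAccept_mul_eq]
    exact ((hq.measurable.comp (measurable_id.sub_const x)).mul
      ((measurable_accept_right hw x).comp (measurable_id.sub_const x))).ennreal_ofReal
  have h1 : ∫⁻ y, ENNReal.ofReal (mhAccept w (fun x y => q ‖x - y‖) x y * q ‖x - y‖) *
      ENNReal.ofReal (g y) = ENNReal.ofReal (∫ h, q ‖h‖ * accept w x h * g (x + h)) := by
    have e1 : ∀ y, ENNReal.ofReal (mhAccept w (fun x y => q ‖x - y‖) x y * q ‖x - y‖) *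
        ENNReal.ofReal (g y) =
        ENNReal.ofReal (q ‖y - x‖ * accept w x (y - x) * g (x + (y - x))) := fun y => by
      rw [mhAccept_mul_eq, add_sub_cancel, ← ENNReal.ofReal_mul (mul_nonneg (hq.nonneg _)
        (accept_nonneg hw _ _))]
    simp only [e1]
    rw [lintegral_sub_right_eq_self
      (fun h => ENNReal.ofReal (q ‖h‖ * accept w x h * g (x + h))) x,
      ofReal_integral_eq_lintegral_ofReal (integrable_rate_mul hw hq x (hg.shift_left x))
        (Filter.Eventually.of_forall fun h => mul_nonneg (mul_nonneg (hq.nonneg h)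
          (accept_nonneg hw _ _)) (hg0 _))]
  have h2 : ∫⁻ y, ENNReal.ofReal ((1 - mhAccept w (fun x y => q ‖x - y‖) x y) * q ‖x - y‖) =
      ENNReal.ofReal (1 - ∫ h, q ‖h‖ * accept w x h) := by
    simp only [one_sub_mhAccept_mul_eq]
    have i1 : Integrable fun h : Eu d => q ‖h‖ * accept w x h := integrable_rate hw hq x
    have i2 : Integrable fun h : Eu d => q ‖h‖ := hq.integrable
    have e1 : (fun h : Eu d => q ‖h‖ * (1 - accept w x h)) =
        fun h => q ‖h‖ - q ‖h‖ * accept w x h := by funext h; ring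
    rw [lintegral_sub_right_eq_self (fun h => ENNReal.ofReal (q ‖h‖ * (1 - accept w x h))) x,
      ← ofReal_integral_eq_lintegral_ofReal (by rw [e1]; exact i2.sub i1)
        (Filter.Eventually.of_forall fun h => mul_nonneg (hq.nonneg h)
          (by linarith [accept_le_one (w := w) x h])), e1, integral_sub i2 i1, hq1]
  have hr := integral_rate_le_one hw hq x
  rw [mhStep, lintegral_add_measure, lintegral_smul_measure,
    lintegral_withDensity_eq_lintegral_mul _ hmeas hg.1.ennreal_ofReal,
    lintegral_dirac' _ hg.1.ennreal_ofReal, h2, mhOp_eq hw hq hg x, ENNReal.ofReal_add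
      (integral_nonneg fun h => mul_nonneg (mul_nonneg (hq.nonneg h) (accept_nonneg hw _ _))
        (hg0 _)) (mul_nonneg (by linarith) (hg0 x)), ENNReal.ofReal_mul (by linarith), ← h1]
  rfl

theorem lintegral_pow_mhKernel {w : Eu d → ℝ} (hw : IsWeight w) {q : ℝ → ℝ} (hqm : Measurable q)
    (hq : IsProposal fun x : Eu d => q ‖x‖) (hq1 : ∫ x : Eu d, q ‖x‖ = 1) (t : ℕ) {g : Eu d → ℝ}
    (hg : IsBdd g) (hg0 : ∀ x, 0 ≤ g x) (x : Eu d) :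
    ∫⁻ y, ENNReal.ofReal (g y)
        ∂((mhKernel w (fun x y => q ‖x - y‖) hw.measurable (measurable_isotropic hqm) ^ t) x) =
      ENNReal.ofReal ((mhOp w fun x => q ‖x‖)^[t] g x) := by
  induction t generalizing x with
  | zero =>
    rw [pow_zero]
    change ∫⁻ y, ENNReal.ofReal (g y) ∂(Kernel.id x) = _
    rw [Kernel.id_apply, lintegral_dirac' _ hg.1.ennreal_ofReal]
    rfl
  | succ t ih =>
    rw [pow_succ]
    change ∫⁻ y, ENNReal.ofReal (g y) ∂((_ ∘ₖ _) x) = _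
    rw [Kernel.lintegral_comp _ _ _ hg.1.ennreal_ofReal]
    simp only [ih]
    rw [Function.iterate_succ_apply']
    exact lintegral_mhStep hw hq hq1 (isBdd_iterate hw hq hg t) (iterate_nonneg hw hq hg hg0 t) x

theorem real_pow_mhKernel {w : Eu d → ℝ} (hw : IsWeight w) {q : ℝ → ℝ} (hqm : Measurable q)
    (hq : IsProposal fun x : Eu d => q ‖x‖) (hq1 : ∫ x : Eu d, q ‖x‖ = 1) (t : ℕ) {A : Set (Eu d)}
    (hA : MeasurableSet A) (x : Eu d) :
    ((mhKernel w (fun x y => q ‖x - y‖) hw.measurable (measurable_isotropic hqm) ^ t) x).real A =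
      (mhOp w fun x => q ‖x‖)^[t] (A.indicator fun _ => 1) x := by
  have hm : Measurable (A.indicator fun _ : Eu d => (1 : ℝ)) := measurable_const.indicator hA
  have h0 : ∀ y, 0 ≤ A.indicator (fun _ : Eu d => (1 : ℝ)) y := fun y =>
    indicator_nonneg (fun _ _ => zero_le_one) y
  have hb : IsBdd (A.indicator fun _ : Eu d => (1 : ℝ)) :=
    IsBdd.of_nonneg_le (M := 1) hm h0 fun y => indicator_le_self' (fun _ _ => zero_le_one) y
  have h1 := lintegral_pow_mhKernel hw hqm hq hq1 t hb h0 x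
  have e1 : ∀ y, ENNReal.ofReal (A.indicator (fun _ : Eu d => (1 : ℝ)) y) =
      A.indicator (fun _ => (1 : ℝ≥0∞)) y := fun y => by
    by_cases hy : y ∈ A <;> simp [hy]
  simp only [e1] at h1
  rw [lintegral_indicator_const hA, one_mul] at h1
  rw [Measure.real, h1, ENNReal.toReal_ofReal (iterate_nonneg hw hq hb h0 t x)]

end kernel

/-! ### Unimodal densities -/

section unimodal

variable {d : ℕ}

theorem IsProbDensity.integrable {p : Eu d → ℝ} (hp : IsProbDensity p) : Integrable p := by
  refine ⟨hp.measurable.aestronglyMeasurable, ?_⟩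
  rw [hasFiniteIntegral_iff_ofReal (Filter.Eventually.of_forall hp.nonneg), hp.lintegral_eq_one]
  exact ENNReal.one_lt_top

theorem IsProbDensity.integral_eq_one {p : Eu d → ℝ} (hp : IsProbDensity p) : ∫ x, p x = 1 := by
  rw [integral_eq_lintegral_of_nonneg_ae (Filter.Eventually.of_forall hp.nonneg)
    hp.measurable.aestronglyMeasurable, hp.lintegral_eq_one, ENNReal.toReal_one]

/-- An even unimodal function decreases on the positive half-line, even if `0` is not its only
mode. -/
theorem IsUnimodalOn.antitoneOn_of_even {φ : ℝ → ℝ} (h : IsUnimodalOn φ univ)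
    (heven : ∀ s, φ (-s) = φ s) : AntitoneOn φ (Ici 0) := by
  obtain ⟨s₀, -, hmono, hanti⟩ := h
  simp only [univ_inter] at hmono hanti
  intro a ha b hb hab
  rw [mem_Ici] at ha hb
  rcases le_or_gt s₀ a with h1 | h1
  · exact hanti h1 (h1.trans hab) hab
  have hmin : φ s₀ ≤ φ a := by
    rw [← heven s₀]
    exact hmono (by rw [mem_Iic]; linarith) h1.le (by linarith)
  refine le_trans ?_ hmin
  rcases le_or_gt s₀ b with h2 | h2
  · exact hanti (mem_Ici.2 le_rfl) h2 h2
  · exact hmono h2.le (mem_Iic.2 le_rfl) h2.le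

/-- An isotropic unimodal density decreases with the norm. -/
theorem isProposal_of_unimodal {q : ℝ → ℝ} (hq : IsProbDensity fun x : Eu d => q ‖x‖)
    (huni : IsMultivariateUnimodalOn (fun x : Eu d => q ‖x‖) univ) :
    IsProposal fun x : Eu d => q ‖x‖ where
  measurable := hq.measurable
  nonneg := hq.nonneg
  integrable := hq.integrable
  integral_le_one := hq.integral_eq_one.le
  antitone x y hxy := by
    rcases eq_or_lt_of_le (norm_nonneg y) with hy | hy
    · have : ‖x‖ = ‖y‖ := le_antisymm hxy (by rw [← hy]; exact norm_nonneg x)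
      rw [this]
    · have h1 := huni 0 (mem_univ _) y
      have h2 := h1.antitoneOn_of_even (fun s => by simp only [zero_add, neg_smul, norm_neg])
        (a := ‖x‖ / ‖y‖) (mem_Ici.2 (by positivity)) (b := 1) (mem_Ici.2 zero_le_one)
        ((div_le_one hy).2 hxy)
      simp only [zero_add, one_smul, norm_smul] at h2
      rwa [Real.norm_of_nonneg (by positivity), div_mul_cancel₀ _ hy.ne'] at h2

theorem IsMultivariateUnimodalOn.min_le {p : Eu d → ℝ} {Θ : Set (Eu d)}
    (h : IsMultivariateUnimodalOn p Θ) (hΘ : Convex ℝ Θ) {x y : Eu d} (hx : x ∈ Θ) (hy : y ∈ Θ)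
    {t : ℝ} (ht0 : 0 ≤ t) (ht1 : t ≤ 1) : min (p x) (p y) ≤ p (x + t • (y - x)) := by
  obtain ⟨s₀, hs₀, hmono, hanti⟩ := h x hx (y - x)
  have hmem : ∀ s : ℝ, 0 ≤ s → s ≤ 1 → x + s • (y - x) ∈ Θ := fun s h0 h1 =>
    hΘ.add_smul_sub_mem hx hy ⟨h0, h1⟩
  have m0 := hmem 0 le_rfl zero_le_one
  have m1 := hmem 1 zero_le_one le_rfl
  have mt := hmem t ht0 ht1
  rcases le_total t s₀ with hts | hts
  · have := hmono ⟨m0, ht0.trans hts⟩ ⟨mt, hts⟩ ht0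
    simp only [zero_smul, add_zero] at this
    exact (min_le_left _ _).trans this
  · have := hanti ⟨mt, hts⟩ ⟨m1, hts.trans ht1⟩ ht1
    simp only [one_smul, add_sub_cancel] at this
    exact (min_le_right _ _).trans this

theorem unitVol_eq [NeZero d] :
    unitVol d = Real.pi ^ ((d : ℝ) / 2) / Real.Gamma ((d : ℝ) / 2 + 1) := by
  have hG : 0 < Real.Gamma ((d : ℝ) / 2 + 1) := Real.Gamma_pos_of_pos (by positivity)
  rw [unitVol, Measure.real, EuclideanSpace.volume_ball, Fintype.card_fin, ENNReal.ofReal_one,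
    one_pow, one_mul, ENNReal.toReal_ofReal (by positivity), Real.sqrt_eq_rpow,
    ← Real.rpow_mul_natCast Real.pi_pos.le]
  congr 2
  ring

end unimodal

/-! ### The restricted target -/

section restricted

variable {d : ℕ} {p : Eu d → ℝ} {Θ : Set (Eu d)} {m : Eu d} {ε : ℝ}

theorem IsProbDensity.real_densityMeasure (hp : IsProbDensity p) {A : Set (Eu d)}
    (hA : MeasurableSet A) : (densityMeasure p).real A = ∫ x in A, p x := by
  rw [Measure.real, densityMeasure, withDensity_apply _ hA,
    integral_eq_lintegral_of_nonneg_ae (Filter.Eventually.of_forall hp.nonneg)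
      hp.measurable.aestronglyMeasurable]

theorem IsProbDensity.densityMeasure_pos (hp : IsProbDensity p) (hΘ : MeasurableSet Θ)
    (hpos : ∀ x ∈ Θ, 0 < p x) (hε : 0 < ε) (hball : Metric.closedBall m ε ⊆ Θ) :
    0 < (densityMeasure p).real Θ := by
  rw [hp.real_densityMeasure hΘ]
  refine (setIntegral_pos_iff_support_of_nonneg_ae (Filter.Eventually.of_forall hp.nonneg)
    hp.integrable.integrableOn).2 ?_
  refine (Metric.measure_ball_pos volume m hε).trans_le (measure_mono fun x hx => ?_)
  have hxΘ := hball (Metric.ball_subset_closedBall hx)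
  exact ⟨(hpos x hxΘ).ne', hxΘ⟩

theorem isWeight_restrictDensity (hp : IsProbDensity p) (hΘ : MeasurableSet Θ)
    (hconv : Convex ℝ Θ) (huni : IsMultivariateUnimodalOn p Θ) :
    IsWeight (restrictDensity p Θ) where
  measurable := measurable_restrictDensity hp.measurable hΘ
  nonneg x := mul_nonneg (inv_nonneg.2 measureReal_nonneg)
    (indicator_nonneg (fun x _ => hp.nonneg x) x)
  integrable := (hp.integrable.indicator hΘ).const_mul _
  quasiconcave x y t ht0 ht1 := by
    unfold restrictDensity
    have hM : 0 ≤ ((densityMeasure p).real Θ)⁻¹ := inv_nonneg.2 measureReal_nonneg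
    rw [← mul_min_of_nonneg _ _ hM]
    refine mul_le_mul_of_nonneg_left ?_ hM
    have h0 := indicator_nonneg (s := Θ) (fun x _ => hp.nonneg x) (x + t • (y - x))
    by_cases hx : x ∈ Θ
    · by_cases hy : y ∈ Θ
      · rw [indicator_of_mem hx, indicator_of_mem hy,
          indicator_of_mem (hconv.add_smul_sub_mem hx hy ⟨ht0, ht1⟩)]
        exact huni.min_le hconv hx hy ht0 ht1
      · rw [indicator_of_notMem hy]
        exact (min_le_right _ _).trans h0
    · rw [indicator_of_notMem hx]
      exact (min_le_left _ _).trans h0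

theorem restrictDensity_le (hp : IsProbDensity p) (hm : m ∈ Θ) (hmax : IsMaxOn p Θ m) (x : Eu d) :
    restrictDensity p Θ x ≤ restrictDensity p Θ m := by
  refine mul_le_mul_of_nonneg_left ?_ (inv_nonneg.2 measureReal_nonneg)
  rw [indicator_of_mem hm]
  by_cases hx : x ∈ Θ
  · rw [indicator_of_mem hx]; exact hmax hx
  · rw [indicator_of_notMem hx]; exact hp.nonneg m

theorem flatMode_restrictDensity (hp : IsProbDensity p) (hΘ : MeasurableSet Θ)
    (hconv : Convex ℝ Θ) (huni : IsMultivariateUnimodalOn p Θ) (hpos : ∀ x ∈ Θ, 0 < p x)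
    (hε : 0 < ε) (hball : Metric.closedBall m ε ⊆ Θ) (hm : m ∈ Θ) (hmax : IsMaxOn p Θ m)
    (hflat : 15 / 16 * p m < sInf (p '' Metric.closedBall m (2 * ε))) :
    FlatMode (restrictDensity p Θ) Θ m ε (restrictDensity p Θ m) where
  weight := isWeight_restrictDensity hp hΘ hconv huni
  convex := hconv
  eps_pos := hε
  max_pos := by
    rw [restrictDensity, indicator_of_mem hm]
    exact mul_pos (inv_pos.2 (hp.densityMeasure_pos hΘ hpos hε hball)) (hpos m hm)
  ball_subset := hball
  zero_off x hx := by rw [restrictDensity, indicator_of_notMem hx, mul_zero]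
  le_max := restrictDensity_le hp hm hmax
  flat x hx hxm := by
    rw [restrictDensity, restrictDensity, indicator_of_mem hm, indicator_of_mem hx,
      mul_left_comm]
    refine mul_le_mul_of_nonneg_left ?_ (inv_nonneg.2 measureReal_nonneg)
    refine hflat.le.trans (csInf_le ⟨0, ?_⟩ ⟨x, mem_closedBall_iff_norm.2 hxm, rfl⟩)
    rintro _ ⟨y, -, rfl⟩
    exact hp.nonneg y

theorem integral_indicator_mul_restrictDensity (hp : IsProbDensity p) (hΘ : MeasurableSet Θ)
    {A : Set (Eu d)} (hA : MeasurableSet A) :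
    ∫ x, A.indicator (fun _ => (1 : ℝ)) x * restrictDensity p Θ x =
      (ProbabilityTheory.cond (densityMeasure p) Θ).real A := by
  have e1 : ∀ x, A.indicator (fun _ => (1 : ℝ)) x * restrictDensity p Θ x =
      ((densityMeasure p).real Θ)⁻¹ * (Θ ∩ A).indicator p x := fun x => by
    unfold restrictDensity
    by_cases hx : x ∈ A <;> by_cases hx' : x ∈ Θ <;> simp [hx, hx']
  simp only [e1]
  rw [integral_const_mul, integral_indicator (hΘ.inter hA),
    ← hp.real_densityMeasure (hΘ.inter hA), Measure.real, Measure.real, Measure.real,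
    cond_apply hΘ, ENNReal.toReal_mul, ENNReal.toReal_inv]

theorem integral_restrictDensity (hp : IsProbDensity p) (hΘ : MeasurableSet Θ)
    (h0 : 0 < (densityMeasure p).real Θ) : ∫ x, restrictDensity p Θ x = 1 := by
  unfold restrictDensity
  rw [integral_const_mul, integral_indicator hΘ, ← hp.real_densityMeasure hΘ,
    inv_mul_cancel₀ h0.ne']

end restricted

theorem lemma2 :
    ∃ C : ℝ, 0 < C ∧
      ∀ (d : ℕ) (_ : 0 < d)
        (p : EuclideanSpace ℝ (Fin d) → ℝ) (hp : IsProbDensity p)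
        (q : ℝ → ℝ) (hq : Measurable q)
        (_ : IsProbDensity fun x : EuclideanSpace ℝ (Fin d) => q ‖x‖)
        (_ : IsMultivariateUnimodalOn (fun x : EuclideanSpace ℝ (Fin d) => q ‖x‖) Set.univ)
        (Θ : Set (EuclideanSpace ℝ (Fin d))) (hΘ : MeasurableSet Θ) (_ : Convex ℝ Θ)
        (m : EuclideanSpace ℝ (Fin d)) (ε L δ₁ c₁ c₂ : ℝ)
        (_ : 0 < ε) (_ : 0 < L) (_ : 0 < δ₁) (_ : 0 < c₁) (_ : 0 < c₂)
        -- the proposal dominates `δ₁` times the uniform distribution on the `ε`-ball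
        (_ : ∀ x : EuclideanSpace ℝ (Fin d), ‖x‖ ≤ ε →
          δ₁ * (Real.Gamma ((d : ℝ) / 2 + 1) / (Real.pi ^ ((d : ℝ) / 2) * ε ^ d)) ≤ q ‖x‖)
        -- and has exponential tails at scale `ε`
        (_ : ∀ x : EuclideanSpace ℝ (Fin d), q ‖x‖ ≤ c₁ * Real.exp (-(c₂ * ‖x‖ / ε)))
        -- the target is positive and unimodal on `Θ`, with mode `m`
        (_ : ∀ x ∈ Θ, 0 < p x)
        (_ : IsMultivariateUnimodalOn p Θ)
        (_ : m ∈ Θ) (_ : IsMaxOn p Θ m)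
        (_ : Θ ⊆ Metric.closedBall m L) (_ : Metric.closedBall m ε ⊆ Θ)
        -- the target is almost constant on the ball of radius `2 ε` around the mode
        (_ : 15 / 16 * p m < sInf (p '' Metric.closedBall m (2 * ε))),
        ((mixingTimeFrom (restrictedChain p q Θ hp.measurable hq hΘ)
            (ProbabilityTheory.cond (densityMeasure p) Θ)
            (Metric.closedBall m ε) : ℕ∞) : ENNReal) ≤
          ENNReal.ofReal (C * Real.log 16 * ε⁻¹ ^ 3 * δ₁⁻¹ * L ^ (d + 3) *
            restrictDensity p Θ m *
            (Real.pi ^ ((d : ℝ) / 2) * 3 ^ (d + 2) / Real.Gamma ((d : ℝ) / 2 + 1))) := by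
  refine ⟨10 ^ 6, by norm_num, ?_⟩
  intro d hd p hp q hqm hqd hquni Θ hΘ hconv m ε L δ₁ c₁ c₂ hε hL hδ hc₁ hc₂ hqδ hqc hpos huni hm
    hmax hΘL hball hflat
  have : NeZero d := ⟨hd.ne'⟩
  have hq := isProposal_of_unimodal hqd hquni
  have hflatMode := flatMode_restrictDensity hp hΘ hconv huni hpos hε hball hm hmax hflat
  have hw := isWeight_restrictDensity hp hΘ hconv huni
  have hw1 := integral_restrictDensity hp hΘ (hp.densityMeasure_pos hΘ hpos hε hball)
  have hG : 0 < Real.Gamma ((d : ℝ) / 2 + 1) := Real.Gamma_pos_of_pos (by positivity)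
  have hqC : ∀ x : Eu d, q ‖x‖ ≤ c₁ := fun x => (hqc x).trans (mul_le_of_le_one_right hc₁.le
    (Real.exp_le_one_iff.2 (neg_nonpos.2 (by positivity))))
  obtain ⟨t, ht, hmix⟩ := hflatMode.mixing (restrictDensity_le hp hm hmax) hw1 hΘL hq hqC hδ
    (fun x hx => by
      refine le_trans (le_of_eq ?_) (hqδ x hx)
      rw [unitVol_eq]
      field_simp)
  have hle : mixingTimeFrom (restrictedChain p q Θ hp.measurable hqm hΘ)
      (ProbabilityTheory.cond (densityMeasure p) Θ) (Metric.closedBall m ε) ≤ (t : ℕ∞) := by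
    refine iInf_le_of_le t (iInf_le_of_le (iSup₂_le fun x hx => iSup₂_le fun A hA => ?_) le_rfl)
    have h1 : (((restrictedChain p q Θ hp.measurable hqm hΘ) ^ t) x).real A = _ :=
      real_pow_mhKernel hw hqm hq hqd.integral_eq_one t hA x
    rw [h1, ← integral_indicator_mul_restrictDensity hp hΘ hA]
    have h2 := hmix (A.indicator fun _ => 1) (measurable_const.indicator hA)
      (fun y => indicator_nonneg (fun _ _ => zero_le_one) y)
      (fun y => indicator_le_self' (fun _ _ => zero_le_one) y) x (mem_closedBall_iff_norm.1 hx)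
    refine (ENNReal.ofReal_le_ofReal h2).trans (le_of_eq ?_)
    rw [ENNReal.ofReal_div_of_pos (by norm_num), ENNReal.ofReal_one, ENNReal.ofReal_ofNat]
  refine (ENat.toENNReal_le.2 hle).trans ?_
  rw [ENat.toENNReal_coe, ← ENNReal.ofReal_natCast]
  refine ENNReal.ofReal_le_ofReal (ht.trans (le_of_eq ?_))
  rw [unitVol_eq, pow_add, pow_add, div_pow]
  field_simp
  norm_num
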